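/- Notation. Put $e(x)=e^{2\pi i x}$; $[x]$ and $\{x\}$ are the integer and fractional parts of a real $x$, and $\lambda_x=1$ if $x\in\mathbb Z$, $\lambda_x=0$ otherwise. Powers $w^{s}$ are taken with $-\pi\le\arg w<\pi$, except in the loop integral below. Let $k\ge 1$ be an integer and let $f,f^{*}:\mathbb Z\to\mathbb C$ have period $k$. For $\alpha\in\mathbb Z$ write $A_\alpha=\{f(\alpha n)\}_{n\in\mathbb Z}$ and $B_\alpha=\{f^{*}(\alpha n)\}_{n\in\mathbb Z}$. For $k$-periodic sequences $X=\{x(n)\}$, $Y=\{y(n)\}$, real $r_1,r_2,\theta$ and $\operatorname{Im} z>0$ let $$G(z,s;X,Y;r_1,r_2)=\sum_{m,n=-\infty}^{\infty}{}^{\!\!\prime}\ \frac{x(m)y(n)}{((m+r_1)z+n+r_2)^{s}}\quad(\operatorname{Re}s>2),\qquad L(s;X;\theta)=\sum_{n>-\theta}x(n)(n+\theta)^{-s}\quad(\operatorname{Re}s>1),$$ where the dash means that the possible pair $(m,n)=(-r_1,-r_2)$ is omitted, and let $G$ and $L$ also denote the analytic continuations in $s$ to $\mathbb C\setminus\{1\}$.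 Theorem. Let $\alpha,\beta\in\mathbb Z$, $r_1,r_2\in\mathbb R$, and let $a,b,c,d\in\mathbb Z$ with $ad-bc=1$, $c>0$ and $a\equiv d\equiv 0\pmod k$. Put $Vz=\frac{az+b}{cz+d}$, $R_1=ar_1+cr_2$, $R_2=br_1+dr_2$, $\rho=\{R_2\}c-\{R_1\}d$, and let $\operatorname{Im}z>0$, $\operatorname{Re}z>-d/c$. Then the series above that define $G(Vz,s;B_{-\beta},A_{-\alpha};r_1,r_2)$, $G(z,s;A_{\alpha b},B_{\beta c};R_1,R_2)$ and $L(s;B_{-\beta c};-R_2)$ converge absolutely and have analytic continuations to $s\in\mathbb C\setminus\{1\}$, and for all $s$ $$\begin{aligned} &(cz+d)^{-s}\,\Gamma(s)\,G(Vz,s;B_{-\beta},A_{-\alpha};r_1,r_2)\\ &=\Gamma(s)\,G(z,s;A_{\alpha b},B_{\beta c};R_1,R_2)-2i\,\Gamma(s)\sin(\pi s)\,f(-\alpha bR_1)\,\lambda_{R_1}\,L(s;B_{-\beta c};-R_2)\\ &\quad+e(-s/2)\sum_{j=1}^{c}\sum_{\mu=0}^{k-1}\sum_{v=0}^{k-1}f\bigl(-\alpha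 b(\mu c+j+[R_1])\bigr)\,f^{*}\Bigl(-\beta c\bigl(\bigl[R_2+\tfrac{d(j-\{R_1\})}{c}\bigr]-v\bigr)\Bigr)\,I_{j,\mu,v}(z,s,c,d), \end{aligned}$$ where $f(-\alpha bR_1)\lambda_{R_1}$ means $0$ if $R_1\notin\mathbb Z$, and $$I_{j,\mu,v}(z,s,c,d)=\int_{C}u^{s-1}\,\frac{\exp\bigl(-\frac{c\mu+j-\{R_1\}}{ck}(cz+d)ku\bigr)}{\exp(-ku(cz+d))-1}\cdot\frac{\exp\bigl(\frac{v+\{(dj+\rho)/c\}}{k}\,ku\bigr)}{\exp(ku)-1}\,du .$$ Here $u^{s-1}$ is taken with $0<\arg u<2\pi$, and $C$ is a loop that runs from $+\infty+i\varepsilon$ to $-\delta+i\varepsilon$, then to $-\delta-i\varepsilon$, then to $+\infty-i\varepsilon$ along straight lines, with $\delta,\varepsilon>0$ such that $u=0$ is the only zero of $(\exp(-ku(cz+d))-1)(\exp(ku)-1)$ inside or on $C$. Such loops exist, the integrals converge absolutely for every $s\in\mathbb C$, and the formula holds for every such loop. The formula is an equality of values for $s\notin\{1,0,-1,-2,\dots\}$;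 at every $s_0\in\mathbb C$ (in particular at these exceptional points) it also holds in the sense that the left side minus the terms with $G$ and $L$ on the right side tends, as $s\to s_0$, $s\ne s_0$, to the value of the last term at $s_0$. In particular ($a=d=0$, $c=-b=1$, so that $R_1=r_2$ and $R_2=-r_1$), for $\operatorname{Re}z>0$, $\operatorname{Im}z>0$, in the same sense and for the same kind of loops, $$\begin{aligned} &z^{-s}\,\Gamma(s)\,G(-1/z,s;B_{-\beta},A_{-\alpha};r_1,r_2)\\ &=\Gamma(s)\,G(z,s;A_{-\alpha},B_{\beta};R_1,R_2)-2i\,\Gamma(s)\sin(\pi s)\,f(\alpha R_1)\,\lambda_{R_1}\,L(s;B_{-\beta};-R_2)\\ &\quad+e(-s/2)\sum_{\mu=0}^{k-1}\sum_{v=0}^{k-1}f\bigl(\alpha(\mu+1+[R_1])\bigr)\,f^{*}\bigl(-\beta([R_2]-v)\bigr)\,I_{1,\mu,v}(z,s,1,0). \end{aligned}$$ -/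

import Mathlib

open Complex Filter Topology MeasureTheory

noncomputable section

namespace PeriodicEisenstein

/-- The argument of `w` in the branch `-π ≤ arg w < π`. -/
def lowerArg (w : ℂ) : ℝ := if w.arg = Real.pi then -Real.pi else w.arg

/-- The power `w ^ s` (for `w ≠ 0`) in the branch `-π ≤ arg w < π`. -/
def lowerPow (w s : ℂ) : ℂ :=
  Complex.exp (s * ((Real.log ‖w‖ : ℂ) + (lowerArg w : ℂ) * Complex.I))

/-- The power `u ^ s` in the branch `0 < arg u < 2π`, for `u` off the half-line `[0, ∞)`:
there `-u` lies off `(-∞, 0]`, and `log u = log (-u) + π i`. -/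
def loopPow (u s : ℂ) : ℂ :=
  Complex.exp (s * (Complex.log (-u) + (Real.pi : ℂ) * Complex.I))

/-- `e(x) = exp (2 π i x)`. -/
def e (x : ℂ) : ℂ := Complex.exp (2 * (Real.pi : ℂ) * Complex.I * x)

/-- The characteristic function of the integers. -/
def intChar (x : ℝ) : ℂ := if Int.fract x = 0 then 1 else 0

/-- The sequence `A_α = {f (α n)}` made from the sequence `A = {f n}`. -/
def dilate (f : ℤ → ℂ) (α : ℤ) : ℤ → ℂ := fun n => f (α * n)

open Classical in
/-- The terms of the Eisenstein series `∑' A(m) B(n) ((m + r₁) z + n + r₂) ^ (-s)`;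
the possible pair `m = -r₁`, `n = -r₂` is left out. -/
def eisensteinTerm (z s : ℂ) (A B : ℤ → ℂ) (r₁ r₂ : ℝ) (p : ℤ × ℤ) : ℂ :=
  if (p.1 : ℝ) = -r₁ ∧ (p.2 : ℝ) = -r₂ then 0
  else A p.1 * B p.2 * lowerPow (((p.1 : ℂ) + (r₁ : ℂ)) * z + (p.2 : ℂ) + (r₂ : ℂ)) (-s)

/-- `g` is the analytic continuation to `ℂ \ {1}` of the Eisenstein series, which is given
for `Re s > 2` by the (unconditionally convergent) double sum. -/
def IsEisensteinContinuation (z : ℂ) (A B : ℤ → ℂ) (r₁ r₂ : ℝ) (g : ℂ → ℂ) : Prop :=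
  DifferentiableOn ℂ g {1}ᶜ ∧
    ∀ s : ℂ, 2 < s.re → HasSum (eisensteinTerm z s A B r₁ r₂) (g s)

/-- `G(z, s; A, B; r₁, r₂)`, the analytic continuation of the Eisenstein series. By the
identity theorem its values at `s ≠ 1` do not depend on the choice made by `epsilon`. -/
def G (z s : ℂ) (A B : ℤ → ℂ) (r₁ r₂ : ℝ) : ℂ :=
  Classical.epsilon (IsEisensteinContinuation z A B r₁ r₂) s

/-- `g` is the analytic continuation to `ℂ \ {1}` of `∑_{n > -θ} A(n) (n + θ) ^ (-s)`,
`Re s > 1`. -/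
def IsLContinuation (A : ℤ → ℂ) (θ : ℝ) (g : ℂ → ℂ) : Prop :=
  DifferentiableOn ℂ g {1}ᶜ ∧
    ∀ s : ℂ, 1 < s.re →
      HasSum (fun n : {n : ℤ // -θ < (n : ℝ)} =>
        A n.1 * lowerPow ((n.1 : ℂ) + (θ : ℂ)) (-s)) (g s)

/-- `L(s; A; θ)`, the analytic continuation of the Dirichlet series. By the identity theorem
its values at `s ≠ 1` do not depend on the choice made by `epsilon`. -/
def L (s : ℂ) (A : ℤ → ℂ) (θ : ℝ) : ℂ :=
  Classical.epsilon (IsLContinuation A θ) s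

/-- The integral of `F` along the loop with parameters `δ, ε > 0` that runs from
`+∞ + i ε` to `-δ + i ε`, then down to `-δ - i ε`, and then to `+∞ - i ε`. -/
def loopIntegral (δ ε : ℝ) (F : ℂ → ℂ) : ℂ :=
  -(∫ x in Set.Ioi (-δ), F ((x : ℂ) + (ε : ℂ) * Complex.I))
    - Complex.I * (∫ y in (-ε)..ε, F (-(δ : ℂ) + (y : ℂ) * Complex.I))
    + ∫ x in Set.Ioi (-δ), F ((x : ℂ) - (ε : ℂ) * Complex.I)

/-- The three integrals in `loopIntegral` converge absolutely. -/
def LoopIntegrable (δ ε : ℝ) (F : ℂ → ℂ) : Prop :=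
  IntegrableOn (fun x : ℝ => F ((x : ℂ) + (ε : ℂ) * Complex.I)) (Set.Ioi (-δ)) ∧
  IntervalIntegrable (fun y : ℝ => F (-(δ : ℂ) + (y : ℂ) * Complex.I)) volume (-ε) ε ∧
  IntegrableOn (fun x : ℝ => F ((x : ℂ) - (ε : ℂ) * Complex.I)) (Set.Ioi (-δ))

/-- `u = 0` is the only zero of `(exp (-k u (c z + d)) - 1) (exp (k u) - 1)` inside or on the
loop with parameters `δ, ε > 0`. -/
def IsAdmissibleLoop (k : ℕ) (c d : ℤ) (z : ℂ) (δ ε : ℝ) : Prop :=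
  0 < δ ∧ 0 < ε ∧
    ∀ u : ℂ, -δ ≤ u.re → |u.im| ≤ ε →
      (Complex.exp (-((k : ℂ) * u * ((c : ℂ) * z + (d : ℂ)))) - 1) *
        (Complex.exp ((k : ℂ) * u) - 1) = 0 → u = 0

/-- `ρ(R₁, R₂, c, d) = {R₂} c - {R₁} d`. -/
def rho (R₁ R₂ : ℝ) (c d : ℤ) : ℝ := Int.fract R₂ * (c : ℝ) - Int.fract R₁ * (d : ℝ)

/-- The integrand of the loop integral `I`. -/
def loopIntegrand (k : ℕ) (z s : ℂ) (c d : ℤ) (R₁ R₂ : ℝ) (j : ℤ) (μ v : ℕ) (u : ℂ) : ℂ :=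
  loopPow u (s - 1) *
    (Complex.exp (-((((c : ℝ) * (μ : ℝ) + (j : ℝ) - Int.fract R₁) / ((c : ℝ) * (k : ℝ)) : ℝ) : ℂ)
        * ((c : ℂ) * z + (d : ℂ)) * (k : ℂ) * u) /
      (Complex.exp (-((k : ℂ) * u * ((c : ℂ) * z + (d : ℂ)))) - 1)) *
    (Complex.exp (((((v : ℝ) + Int.fract (((d : ℝ) * (j : ℝ) + rho R₁ R₂ c d) / (c : ℝ)))
        / (k : ℝ) : ℝ) : ℂ) * (k : ℂ) * u) /
      (Complex.exp ((k : ℂ) * u) - 1))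

/-- The loop integral `I`, taken along the loop with parameters `δ, ε`. -/
def loopI (δ ε : ℝ) (k : ℕ) (z s : ℂ) (c d : ℤ) (R₁ R₂ : ℝ) (j : ℤ) (μ v : ℕ) : ℂ :=
  loopIntegral δ ε (loopIntegrand k z s c d R₁ R₂ j μ v)

end PeriodicEisenstein

end

/-!
The terms of `G(V z)` and of `G(z)` correspond under the linear change of variables
`(M, N) = (a m + c n, b m + d n)` of the lattice, because `(m + r₁) V z + n + r₂ = w / (c z + d)` with
`w = (M + R₁) z + N + R₂`, and the congruences `a ≡ d ≡ 0` match the periodic coefficients. Since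
`arg (w / (c z + d))` has to be normalized to `[-π, π)`, the factor `(c z + d) ^ (-s)` turns the power
of `w / (c z + d)` into that of `w`, except when `-w` lies in the sector `0 ≤ arg < arg (c z + d)`, where
a factor `exp (-2 π i s)` appears (`lowerPow_div_of_upper`, `lowerPow_div_of_upper_neg`,
`lowerPow_mul_eisensteinTerm`). Hence `(c z + d) ^ (-s) G(V z) - G(z)` is `-2 i sin (π s)` times the
sum over a sector, whose boundary ray gives the function `L` (`hasSum_positiveRay`) and whose interior is
a cone `x > 0`, `y > x d / c`.

The cone splits into residue classes parametrized by `ℕ × ℕ`, on which the summands are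
`(τ k (A + t) + k (q + 1 - B)) ^ (-s)` with `τ = c z + d`. Writing each as a Gamma integral and summing two
geometric series gives a Mellin transform of the kernel `loopKernel` (`hasSum_quadrant`, `hasSum_cone`).
For `Re s > 3` the loop integral of `u ^ (s - 1)` times this kernel is `exp (2 π i s) - 1` times the
Mellin transform: Cauchy's theorem is applied above and below the real axis, and the double pole of the
kernel at the origin is killed by `u ^ (s - 1)`, so the origin may lie on the boundary of both
half-strips (`IsLoopKernel.loopIntegral_eq`). This proves the formula for `Re s > 3`.

All terms continue analytically, which extends the formula. The loop integrals are entire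
(`IsLoopKernel.differentiable_loopIntegral`). The Dirichlet series is a combination of Hurwitz zeta
functions (`exists_isLContinuation`). The rows of the Eisenstein series off the real axis are turned by
Lipschitz's formula (`hasSum_lipschitz`, from Poisson summation) into a double series that converges
for every `s`, and the row on the real axis consists of Dirichlet series
(`exists_isEisensteinContinuation`). After division by `Γ(s)` both sides are holomorphic in `ℂ ∖ {1}`,
so they agree there (`transformation_div_Gamma`); the statement about limits follows since the
loop integrals are continuous in `s`.
-/

namespace PeriodicEisenstein

/-! ### Powers in the branch `-π ≤ arg w < π` -/

/-- The logarithm of `w` in the branch `-π ≤ arg w < π`. -/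
noncomputable def lowerLog (w : ℂ) : ℂ :=
  (Real.log ‖w‖ : ℂ) + (lowerArg w : ℂ) * Complex.I

lemma lowerPow_eq_exp (w s : ℂ) : lowerPow w s = Complex.exp (s * lowerLog w) := rfl

@[simp] lemma lowerLog_im (w : ℂ) : (lowerLog w).im = lowerArg w := by simp [lowerLog]

lemma neg_pi_le_lowerArg (w : ℂ) : -Real.pi ≤ lowerArg w := by
  unfold lowerArg
  split_ifs
  · exact le_rfl
  · exact (Complex.neg_pi_lt_arg w).le

lemma lowerArg_lt_pi (w : ℂ) : lowerArg w < Real.pi := by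
  unfold lowerArg
  split_ifs with h
  · linarith [Real.pi_pos]
  · exact lt_of_le_of_ne (Complex.arg_le_pi w) h

lemma exp_lowerLog {w : ℂ} (hw : w ≠ 0) : Complex.exp (lowerLog w) = w := by
  unfold lowerLog lowerArg
  split_ifs with h
  · have h1 : Complex.exp (Complex.log w) = w := Complex.exp_log hw
    rw [Complex.log, h] at h1
    rw [← Complex.exp_periodic]
    refine Eq.trans ?_ h1
    congr 1
    push_cast
    ring
  · exact Complex.exp_log hw

/-- `lowerLog w` is the only logarithm of `w` with imaginary part in `[-π, π)`. -/
lemma eq_lowerLog_of_exp_eq {w l : ℂ} (h : Complex.exp l = w)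
    (h1 : -Real.pi ≤ l.im) (h2 : l.im < Real.pi) : l = lowerLog w := by
  have hw : w ≠ 0 := h ▸ Complex.exp_ne_zero l
  obtain ⟨n, hn⟩ := Complex.exp_eq_exp_iff_exists_int.1 (h.trans (exp_lowerLog hw).symm)
  have him := congrArg Complex.im hn
  have h3 := neg_pi_le_lowerArg w
  have h4 := lowerArg_lt_pi w
  simp only [Complex.add_im, lowerLog_im, Complex.mul_im, Complex.intCast_re, Complex.intCast_im,
    Complex.mul_re, Complex.re_ofNat, Complex.im_ofNat, Complex.ofReal_re, Complex.ofReal_im,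
    Complex.I_re, Complex.I_im] at him
  have h5 : l.im = lowerArg w + n * (2 * Real.pi) := by linarith
  have h6 : n = 0 := by
    have hp := Real.pi_pos
    have : -1 < (n : ℝ) := by nlinarith
    have : (n : ℝ) < 1 := by nlinarith
    have h7 : -1 < n := by exact_mod_cast ‹-1 < (n : ℝ)›
    have h8 : n < 1 := by exact_mod_cast this
    omega
  rw [hn, h6]
  simp

/-- The nonzero `w` with `0 ≤ arg w < π`. -/
def IsUpper (w : ℂ) : Prop := 0 < w.im ∨ (w.im = 0 ∧ 0 < w.re)

lemma IsUpper.ne_zero {w : ℂ} (h : IsUpper w) : w ≠ 0 := by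
  rintro rfl
  simp [IsUpper] at h

lemma IsUpper.arg_nonneg {w : ℂ} (h : IsUpper w) : 0 ≤ w.arg := by
  rw [Complex.arg_nonneg_iff]
  rcases h with h | h
  · exact h.le
  · exact h.1.ge

lemma IsUpper.arg_lt_pi {w : ℂ} (h : IsUpper w) : w.arg < Real.pi := by
  rw [Complex.arg_lt_pi_iff]
  rcases h with h | h
  · exact Or.inr h.ne'
  · exact Or.inl h.2.le

lemma IsUpper.lowerLog_eq {w : ℂ} (h : IsUpper w) : lowerLog w = Complex.log w := by
  refine (eq_lowerLog_of_exp_eq (Complex.exp_log h.ne_zero) ?_ ?_).symm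
  · rw [Complex.log_im]
    linarith [h.arg_nonneg, Real.pi_pos]
  · rw [Complex.log_im]
    exact h.arg_lt_pi

lemma IsUpper.lowerLog_neg {w : ℂ} (h : IsUpper w) :
    lowerLog (-w) = Complex.log w - Real.pi * Complex.I := by
  refine (eq_lowerLog_of_exp_eq ?_ ?_ ?_).symm
  · rw [Complex.exp_sub, Complex.exp_log h.ne_zero, Complex.exp_pi_mul_I]
    ring
  · simp only [Complex.sub_im, Complex.log_im, Complex.mul_im, Complex.ofReal_re, Complex.I_im,
      Complex.ofReal_im, Complex.I_re]
    linarith [h.arg_nonneg]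
  · simp only [Complex.sub_im, Complex.log_im, Complex.mul_im, Complex.ofReal_re, Complex.I_im,
      Complex.ofReal_im, Complex.I_re]
    linarith [h.arg_lt_pi, Real.pi_pos]

lemma IsUpper.lowerPow_eq {w : ℂ} (h : IsUpper w) (s : ℂ) : lowerPow w s = w ^ s := by
  rw [lowerPow_eq_exp, h.lowerLog_eq, Complex.cpow_def_of_ne_zero h.ne_zero, mul_comm]

lemma IsUpper.lowerPow_neg {w : ℂ} (h : IsUpper w) (s : ℂ) :
    lowerPow (-w) (-s) = Complex.exp (Real.pi * Complex.I * s) * w ^ (-s) := by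
  rw [lowerPow_eq_exp, h.lowerLog_neg, Complex.cpow_def_of_ne_zero h.ne_zero, ← Complex.exp_add]
  congr 1
  ring

/-- The branch of a quotient: for `τ` and `w` in the upper half-plane,
no correction is needed. -/
lemma lowerPow_div_of_upper {w τ : ℂ} (hw : IsUpper w) (hi : 0 < τ.im) (s : ℂ) :
    lowerPow τ (-s) * lowerPow (w / τ) (-s) = w ^ (-s) := by
  have hτ : IsUpper τ := Or.inl hi
  have h1 : Complex.log w - Complex.log τ = lowerLog (w / τ) := by
    refine eq_lowerLog_of_exp_eq ?_ ?_ ?_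
    · rw [Complex.exp_sub, Complex.exp_log hw.ne_zero, Complex.exp_log hτ.ne_zero]
    · rw [Complex.sub_im, Complex.log_im, Complex.log_im]
      linarith [hw.arg_nonneg, hτ.arg_lt_pi]
    · rw [Complex.sub_im, Complex.log_im, Complex.log_im]
      linarith [hw.arg_lt_pi, hτ.arg_nonneg]
  rw [lowerPow_eq_exp, lowerPow_eq_exp, hτ.lowerLog_eq, ← h1,
    Complex.cpow_def_of_ne_zero hw.ne_zero, ← Complex.exp_add]
  congr 1
  ring

/-- The sign of `Im (w conj τ)` tells which of `w` and `τ` has the larger argument. -/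
lemma im_mul_conj_eq (w τ : ℂ) :
    (w * (starRingEnd ℂ) τ).im = ‖w‖ * ‖τ‖ * Real.sin (w.arg - τ.arg) := by
  rw [Real.sin_sub, Complex.mul_im, Complex.conj_im, Complex.conj_re]
  have h1 := Complex.norm_mul_cos_arg w
  have h2 := Complex.norm_mul_sin_arg w
  have h3 := Complex.norm_mul_cos_arg τ
  have h4 := Complex.norm_mul_sin_arg τ
  rw [← h1, ← h2, ← h3, ← h4]
  ring

/-- The branch of a quotient: for `τ` in the first quadrant and `w` in the upper half-plane, the
quotient `-w / τ` leaves the range of the branch exactly when `arg w < arg τ`, that is when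
`Im (w conj τ) < 0`. -/
lemma lowerPow_div_of_upper_neg {w τ : ℂ} (hw : IsUpper w) (hi : 0 < τ.im) (hr : 0 < τ.re)
    (s : ℂ) [Decidable ((w * (starRingEnd ℂ) τ).im < 0)] :
    lowerPow τ (-s) * lowerPow (-w / τ) (-s) =
      (if (w * (starRingEnd ℂ) τ).im < 0 then Complex.exp (-(Real.pi * Complex.I * s))
        else Complex.exp (Real.pi * Complex.I * s)) * w ^ (-s) := by
  have hτ : IsUpper τ := Or.inl hi
  have hτ2 : τ.arg < Real.pi / 2 := (abs_lt.1 (Complex.abs_arg_lt_pi_div_two_iff.2 (Or.inl hr))).2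
  have hτ1 := hτ.arg_nonneg
  have hw1 := hw.arg_nonneg
  have hw2 := hw.arg_lt_pi
  have hpos : 0 < ‖w‖ * ‖τ‖ := mul_pos (norm_pos_iff.2 hw.ne_zero) (norm_pos_iff.2 hτ.ne_zero)
  have hpi := Real.pi_pos
  have key := im_mul_conj_eq w τ
  rw [lowerPow_eq_exp, lowerPow_eq_exp, hτ.lowerLog_eq, Complex.cpow_def_of_ne_zero hw.ne_zero,
    ← Complex.exp_add]
  split_ifs with h
  · have hlt : w.arg < τ.arg := by
      by_contra! hge
      have : 0 ≤ Real.sin (w.arg - τ.arg) :=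
        Real.sin_nonneg_of_nonneg_of_le_pi (by linarith) (by linarith)
      rw [key] at h
      nlinarith
    have h1 : Complex.log w - Complex.log τ + Real.pi * Complex.I = lowerLog (-w / τ) := by
      refine eq_lowerLog_of_exp_eq ?_ ?_ ?_
      · rw [Complex.exp_add, Complex.exp_sub, Complex.exp_log hw.ne_zero,
          Complex.exp_log hτ.ne_zero, Complex.exp_pi_mul_I]
        ring
      · simp [Complex.log_im]
        linarith
      · simp [Complex.log_im]
        linarith
    rw [← h1, ← Complex.exp_add]
    congr 1
    ring
  · have hge : τ.arg ≤ w.arg := by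
      by_contra! hlt
      have : Real.sin (w.arg - τ.arg) < 0 :=
        Real.sin_neg_of_neg_of_neg_pi_lt (by linarith) (by linarith)
      rw [key] at h
      nlinarith
    have h1 : Complex.log w - Complex.log τ - Real.pi * Complex.I = lowerLog (-w / τ) := by
      refine eq_lowerLog_of_exp_eq ?_ ?_ ?_
      · rw [Complex.exp_sub, Complex.exp_sub, Complex.exp_log hw.ne_zero,
          Complex.exp_log hτ.ne_zero, Complex.exp_pi_mul_I]
        ring
      · simp [Complex.log_im]
        linarith
      · simp [Complex.log_im]
        linarith
    rw [← h1, ← Complex.exp_add]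
    congr 1
    ring

/-! ### Integrals depending holomorphically on a parameter -/

/-- Differentiation under the integral sign for a locally dominated family of holomorphic
functions; the derivatives are dominated by Cauchy's estimate. -/
lemma differentiableOn_integral_of_dominated {X : Type*} [MeasurableSpace X] {μ : Measure X}
    {F : ℂ → X → ℂ} {U : Set ℂ} (hU : IsOpen U)
    (hmeas : ∀ w ∈ U, AEStronglyMeasurable (F w) μ)
    (hdiff : ∀ᵐ x ∂μ, DifferentiableOn ℂ (fun w => F w x) U)
    (hbound : ∀ w₀ ∈ U, ∃ r > 0, ∃ b : X → ℝ, Integrable b μ ∧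
      ∀ᵐ x ∂μ, ∀ w ∈ Metric.ball w₀ r, ‖F w x‖ ≤ b x) :
    DifferentiableOn ℂ (fun w => ∫ x, F w x ∂μ) U := by
  intro w₀ hw₀
  obtain ⟨r₁, hr₁, b, hb, hle⟩ := hbound w₀ hw₀
  obtain ⟨r₂, hr₂, hsub⟩ := Metric.isOpen_iff.1 hU w₀ hw₀
  obtain ⟨r, hr, hr1, hr2⟩ : ∃ r > 0, 2 * r ≤ r₁ ∧ 2 * r ≤ r₂ :=
    ⟨min r₁ r₂ / 2, by positivity, by linarith [min_le_left r₁ r₂],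
      by linarith [min_le_right r₁ r₂]⟩
  have hderiv : ∀ᵐ x ∂μ, ∀ w ∈ Metric.ball w₀ r,
      HasDerivAt (fun w => F w x) (deriv (fun w => F w x) w) w := by
    filter_upwards [hdiff] with x hx w hw
    refine ((hx w ?_).differentiableAt (hU.mem_nhds ?_)).hasDerivAt <;>
    exact hsub (Metric.ball_subset_ball (by linarith) hw)
  refine (hasDerivAt_integral_of_dominated_loc_of_deriv_le (F := F) (x₀ := w₀)
    (bound := fun x => b x / r) (F' := fun w x => deriv (fun w => F w x) w)
    (Metric.ball_mem_nhds w₀ hr) ?_ ?_ ?_ ?_ (hb.div_const r)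
    hderiv).2.differentiableAt.differentiableWithinAt
  · exact eventually_of_mem (hU.mem_nhds hw₀) hmeas
  · refine hb.mono' (hmeas _ hw₀) ?_
    filter_upwards [hle] with x hx using hx w₀ (Metric.mem_ball_self hr₁)
  -- the derivative is measurable as a limit of difference quotients
  · refine aestronglyMeasurable_of_tendsto_ae (Filter.atTop : Filter ℕ)
      (f := fun n x => ((r / (n + 2) : ℝ) : ℂ)⁻¹ • (F (w₀ + ((r / (n + 2) : ℝ) : ℂ)) x - F w₀ x))
      ?_ ?_
    · intro n
      refine ((hmeas _ ?_).sub (hmeas _ hw₀)).const_smul (𝕜 := ℂ) _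
      refine hsub ?_
      rw [Metric.mem_ball, dist_self_add_left, Complex.norm_real, Real.norm_of_nonneg (by positivity)]
      have : r / (n + 2) ≤ r := div_le_self hr.le (by linarith [n.cast_nonneg (α := ℝ)])
      linarith
    · filter_upwards [hderiv] with x hx
      have h1 := (hx w₀ (Metric.mem_ball_self hr)).tendsto_slope_zero
      refine h1.comp (tendsto_nhdsWithin_iff.2 ⟨?_, ?_⟩)
      · have : Tendsto (fun n : ℕ => r / ((n : ℝ) + 2)) atTop (𝓝 0) :=
          (tendsto_atTop_add_const_right _ _ tendsto_natCast_atTop_atTop).const_div_atTop r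
        have h2 := (Complex.continuous_ofReal.tendsto 0).comp this
        simpa [Function.comp_def] using h2
      · refine Eventually.of_forall fun n => ?_
        simp only [Set.mem_compl_iff, Set.mem_singleton_iff, Complex.ofReal_eq_zero]
        positivity
  · filter_upwards [hle, hdiff] with x hx hd w hw
    refine Complex.norm_deriv_le_of_forall_mem_sphere_norm_le hr ?_ ?_
    · refine DifferentiableOn.diffContOnCl_ball (U := Metric.ball w₀ (2 * r))
        (hd.mono ((Metric.ball_subset_ball hr2).trans hsub)) ?_
      intro y hy
      rw [Metric.mem_ball] at *
      rw [Metric.mem_closedBall] at hy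
      linarith [dist_triangle y w w₀]
    · intro y hy
      refine hx y ?_
      rw [Metric.mem_ball] at *
      rw [Metric.mem_sphere] at hy
      linarith [dist_triangle y w w₀]

/-- A function `s ↦ ∫ exp (s ℓ) h` is entire as soon as `h` is integrable against all
exponentials of multiples of `‖ℓ‖`. -/
lemma differentiable_integral_exp_mul {X : Type*} [MeasurableSpace X] {μ : Measure X}
    {l h : X → ℂ} (hl : AEStronglyMeasurable l μ) (hh : AEStronglyMeasurable h μ)
    (hint : ∀ R : ℝ, Integrable (fun x => Real.exp (R * ‖l x‖) * ‖h x‖) μ) :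
    Differentiable ℂ (fun s : ℂ => ∫ x, Complex.exp (s * l x) * h x ∂μ) := by
  rw [← differentiableOn_univ]
  refine differentiableOn_integral_of_dominated isOpen_univ ?_ ?_ ?_
  · intro w _
    exact (Complex.continuous_exp.comp_aestronglyMeasurable (hl.const_mul w)).mul hh
  · refine Eventually.of_forall fun x => ?_
    exact (((differentiable_id.mul_const _).cexp).mul_const _).differentiableOn
  · intro w₀ _
    refine ⟨1, one_pos, _, hint (‖w₀‖ + 1), Eventually.of_forall fun x w hw => ?_⟩
    rw [norm_mul, Complex.norm_exp]
    refine mul_le_mul_of_nonneg_right (Real.exp_le_exp.2 ?_) (norm_nonneg _)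
    refine (Complex.re_le_norm _).trans ?_
    rw [norm_mul]
    refine mul_le_mul_of_nonneg_right ?_ (norm_nonneg _)
    rw [Metric.mem_ball, dist_eq_norm] at hw
    linarith [norm_sub_norm_le w w₀]

lemma integrableOn_cpow_mul_exp_neg_mul {s W : ℂ} (hs : 0 < s.re) (hW : 0 < W.re) :
    IntegrableOn (fun t : ℝ => (t : ℂ) ^ (s - 1) * Complex.exp (-(W * t))) (Set.Ioi 0) := by
  have h1 := integrableOn_rpow_mul_exp_neg_mul_rpow (p := 1) (s := s.re - 1) (b := W.re)
    (by linarith) one_pos hW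
  refine Integrable.mono' h1 ?_ ?_
  · refine ContinuousOn.aestronglyMeasurable ?_ measurableSet_Ioi
    refine ContinuousOn.mul (fun t ht => ?_) (by fun_prop)
    exact ((continuousAt_ofReal_cpow_const _ _ (Or.inr (ne_of_gt ht)))).continuousWithinAt
  · refine (ae_restrict_iff' measurableSet_Ioi).2 (Eventually.of_forall fun t ht => ?_)
    rw [norm_mul, Complex.norm_cpow_eq_rpow_re_of_pos ht, Complex.norm_exp]
    simp

lemma integral_norm_cpow_mul_exp_neg_mul {s W : ℂ} (hs : 0 < s.re) (hW : 0 < W.re) :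
    ∫ t : ℝ in Set.Ioi 0, ‖(t : ℂ) ^ (s - 1) * Complex.exp (-(W * t))‖ =
      (1 / W.re) ^ s.re * Real.Gamma s.re := by
  rw [← Real.integral_rpow_mul_exp_neg_mul_Ioi hs hW]
  refine setIntegral_congr_fun measurableSet_Ioi fun t ht => ?_
  rw [norm_mul, Complex.norm_cpow_eq_rpow_re_of_pos ht, Complex.norm_exp]
  simp

/-- The Gamma integral with a rate in the right half-plane, by analytic continuation in the rate
from the positive axis. -/
lemma integral_cpow_mul_exp_neg_mul {s W : ℂ} (hs : 0 < s.re) (hW : 0 < W.re) :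
    ∫ t : ℝ in Set.Ioi 0, (t : ℂ) ^ (s - 1) * Complex.exp (-(W * t)) =
      W ^ (-s) * Complex.Gamma s := by
  set U : Set ℂ := {w | 0 < w.re} with hUdef
  have hU : IsOpen U := isOpen_lt continuous_const Complex.continuous_re
  have hd1 : DifferentiableOn ℂ
      (fun w : ℂ => ∫ t : ℝ in Set.Ioi 0, (t : ℂ) ^ (s - 1) * Complex.exp (-(w * t))) U := by
    refine differentiableOn_integral_of_dominated hU ?_ ?_ ?_
    · exact fun w hw => (integrableOn_cpow_mul_exp_neg_mul hs hw).aestronglyMeasurable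
    · refine Eventually.of_forall fun x => ?_
      fun_prop
    · intro w₀ hw₀
      have hw₀' : 0 < w₀.re := hw₀
      have h1 := (integrableOn_cpow_mul_exp_neg_mul hs
        (W := ((w₀.re / 2 : ℝ) : ℂ)) (by simpa using hw₀')).norm
      refine ⟨w₀.re / 2, by positivity, _, h1, ?_⟩
      refine (ae_restrict_iff' measurableSet_Ioi).2 (Eventually.of_forall fun t ht w hw => ?_)
      rw [norm_mul, norm_mul]
      refine mul_le_mul_of_nonneg_left ?_ (norm_nonneg _)
      rw [Complex.norm_exp, Complex.norm_exp]
      refine Real.exp_le_exp.2 ?_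
      have h2 : w₀.re / 2 ≤ w.re := by
        have h3 := (Complex.abs_re_le_norm (w - w₀)).trans_lt (by simpa [dist_eq_norm] using hw)
        rw [Complex.sub_re] at h3
        linarith [(abs_lt.1 h3).1]
      have ht' : 0 < t := ht
      simp only [Complex.neg_re, Complex.re_mul_ofReal, Complex.ofReal_re]
      nlinarith
  have hd2 : DifferentiableOn ℂ (fun w : ℂ => w ^ (-s) * Complex.Gamma s) U := by
    intro w hw
    refine DifferentiableAt.differentiableWithinAt ?_
    exact (differentiableAt_id.cpow_const (Or.inl hw)).mul_const _
  have hconn : IsPreconnected U := (convex_halfSpace_re_gt 0).isPreconnected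
  have hfreq : ∃ᶠ w in 𝓝[≠] (1 : ℂ),
      (∫ t : ℝ in Set.Ioi 0, (t : ℂ) ^ (s - 1) * Complex.exp (-(w * t))) =
        w ^ (-s) * Complex.Gamma s := by
    have ht : Tendsto (fun n : ℕ => ((1 + 1 / ((n : ℝ) + 1) : ℝ) : ℂ)) atTop (𝓝[≠] 1) := by
      refine tendsto_nhdsWithin_iff.2 ⟨?_, Eventually.of_forall fun n => ?_⟩
      · have h1 : Tendsto (fun n : ℕ => 1 + 1 / ((n : ℝ) + 1)) atTop (𝓝 (1 + 0)) :=
          tendsto_const_nhds.add tendsto_one_div_add_atTop_nhds_zero_nat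
        have h2 := (Complex.continuous_ofReal.tendsto _).comp h1
        simpa [Function.comp_def] using h2
      · have : (0 : ℝ) < 1 / ((n : ℝ) + 1) := by positivity
        simp only [Set.mem_compl_iff, Set.mem_singleton_iff]
        intro h
        have h3 : (1 + 1 / ((n : ℝ) + 1) : ℝ) = 1 := by exact_mod_cast h
        linarith
    refine ht.frequently (Frequently.of_forall fun n => ?_)
    have hpos : (0 : ℝ) < 1 + 1 / ((n : ℝ) + 1) := by positivity
    rw [Complex.integral_cpow_mul_exp_neg_mul_Ioi hs hpos, one_div, Complex.inv_cpow,
      Complex.cpow_neg]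
    rw [Complex.arg_ofReal_of_nonneg hpos.le]
    exact Real.pi_pos.ne
  exact (hd1.analyticOnNhd hU).eqOn_of_preconnected_of_frequently_eq (hd2.analyticOnNhd hU) hconn
    (by simp [hUdef]) hfreq hW

/-! ### Summation over residue classes and the Dirichlet series -/

/-- A sum over `X` splits into finitely many sums along injective parametrizations with disjoint
ranges that cover the support. -/
lemma hasSum_of_finset_partition {ι κ X : Type*} {T : X → ℂ} (S : Finset ι) (φ : ι → κ → X)
    (A : ι → ℂ)
    (hinj : ∀ i ∈ S, ∀ i' ∈ S, ∀ a a', φ i a = φ i' a' → i = i' ∧ a = a')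
    (hsupp : ∀ x, T x ≠ 0 → ∃ i ∈ S, ∃ a, φ i a = x)
    (h : ∀ i ∈ S, HasSum (fun a => T (φ i a)) (A i)) :
    HasSum T (∑ i ∈ S, A i) := by
  classical
  have h1 : ∀ i ∈ S, HasSum ((Set.range (φ i)).indicator T) (A i) := by
    intro i hi
    have hin : Function.Injective (φ i) := fun a a' haa => (hinj i hi i hi a a' haa).2
    rw [← hin.hasSum_iff (fun x hx => Set.indicator_of_notMem hx T)]
    convert h i hi using 2 with a
    simp [Set.indicator_of_mem]
  have h2 := hasSum_sum h1
  convert h2 using 2 with x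
  by_cases hx : T x = 0
  · rw [hx]
    refine (Finset.sum_eq_zero fun i _ => ?_).symm
    by_cases hm : x ∈ Set.range (φ i)
    · rw [Set.indicator_of_mem hm, hx]
    · rw [Set.indicator_of_notMem hm]
  · obtain ⟨i, hi, a, rfl⟩ := hsupp x hx
    rw [Finset.sum_eq_single i]
    · rw [Set.indicator_of_mem (Set.mem_range_self a)]
    · rintro j hj hji
      refine Set.indicator_of_notMem ?_ T
      rintro ⟨a', ha'⟩
      exact hji (hinj j hj i hi a' a ha').1
    · exact fun hn => absurd hi hn

lemma int_residue_unique {c i i' q q' : ℤ} (hi : 0 ≤ i) (hic : i < c) (hi' : 0 ≤ i')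
    (hic' : i' < c) (h : i + c * q = i' + c * q') : i = i' ∧ q = q' := by
  have h1 : (i + c * q) % c = i := by
    rw [Int.add_mul_emod_self_left, Int.emod_eq_of_lt hi hic]
  have h2 : (i' + c * q') % c = i' := by
    rw [Int.add_mul_emod_self_left, Int.emod_eq_of_lt hi' hic']
  have h3 : i = i' := by rw [← h1, h, h2]
  refine ⟨h3, mul_left_cancel₀ (show c ≠ 0 by omega) (by linarith)⟩

lemma residue_unique {k v v' : ℕ} (hv : v < k) (hv' : v' < k) {q q' : ℤ}
    (h : (v : ℤ) + k * q = v' + k * q') : v = v' ∧ q = q' := by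
  obtain ⟨h1, h2⟩ := int_residue_unique (by omega) (by omega) (by omega) (by omega) h
  exact ⟨by exact_mod_cast h1, h2⟩

lemma residue_exists {k : ℕ} (hk : 0 < k) (n : ℤ) : ∃ v < k, ∃ q : ℤ, (v : ℤ) + k * q = n := by
  have h0 : (0 : ℤ) < k := by exact_mod_cast hk
  have h1 := Int.emod_nonneg n h0.ne'
  have h2 := Int.emod_lt_of_pos n h0
  refine ⟨(n % k).toNat, by omega, n / k, ?_⟩
  rw [Int.toNat_of_nonneg h1]
  exact Int.emod_add_mul_ediv n k

lemma natCast_mul_cpow {k : ℕ} (hk : 0 < k) (w s : ℂ) :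
    ((k : ℂ) * w) ^ s = (k : ℂ) ^ s * w ^ s := by
  have hk' : (k : ℂ) ≠ 0 := by exact_mod_cast hk.ne'
  rcases eq_or_ne w 0 with rfl | hw
  · rcases eq_or_ne s 0 with rfl | hs
    · simp
    · simp [hs]
  · have h1 := Complex.log_ofReal_mul (r := k) (by exact_mod_cast hk) hw
    rw [Complex.ofReal_natCast] at h1
    rw [Complex.cpow_def_of_ne_zero (mul_ne_zero hk' hw), h1, Complex.cpow_def_of_ne_zero hk',
      Complex.cpow_def_of_ne_zero hw, ← Complex.exp_add, Complex.natCast_log, add_mul]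

/-- The Dirichlet series of a periodic sequence continues analytically to `ℂ ∖ {1}`, being a
combination of Hurwitz zeta functions. -/
theorem exists_isLContinuation {k : ℕ} (hk : 0 < k) {A : ℤ → ℂ}
    (hA : Function.Periodic A (k : ℤ)) (θ : ℝ) : ∃ g, IsLContinuation A θ g := by
  have hk0 : (0 : ℝ) < k := by exact_mod_cast hk
  set n₀ : ℤ := ⌊-θ⌋ + 1 with hn₀
  have hfl := Int.floor_le (-θ)
  have hlf := Int.lt_floor_add_one (-θ)
  have hn₀r : (n₀ : ℝ) = ⌊-θ⌋ + 1 := by rw [hn₀]; push_cast; rfl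
  set x : ℕ → ℝ := fun v => ((n₀ : ℝ) + v + θ) / k with hx
  have hx0 : ∀ v, 0 < x v := fun v => by
    have : (0 : ℝ) ≤ v := v.cast_nonneg
    simp only [hx]; apply div_pos _ hk0; linarith
  have hx1 : ∀ v < k, x v ≤ 1 := fun v hv => by
    have : (v : ℝ) + 1 ≤ k := by exact_mod_cast hv
    simp only [hx]; rw [div_le_one hk0]; linarith
  refine ⟨fun s => ∑ v ∈ Finset.range k,
    A (n₀ + v) * (k : ℂ) ^ (-s) * HurwitzZeta.hurwitzZeta (x v : UnitAddCircle) s, ?_, ?_⟩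
  · intro s hs
    refine DifferentiableAt.differentiableWithinAt ?_
    refine DifferentiableAt.fun_sum fun v _ => ?_
    refine DifferentiableAt.mul (DifferentiableAt.const_mul ?_ _)
      (HurwitzZeta.differentiableAt_hurwitzZeta _ hs)
    exact (differentiable_id.neg.differentiableAt).const_cpow
      (Or.inl (by exact_mod_cast hk.ne'))
  · intro s hs
    have hmem : ∀ v q : ℕ, -θ < ((n₀ + v + k * q : ℤ) : ℝ) := fun v q => by
      have h1 : (0 : ℝ) ≤ v := v.cast_nonneg
      have h2 : (0 : ℝ) ≤ k * q := by positivity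
      push_cast
      linarith
    refine hasSum_of_finset_partition (Finset.range k)
      (fun v (q : ℕ) => (⟨n₀ + v + k * q, hmem v q⟩ : {n : ℤ // -θ < (n : ℝ)})) _ ?_ ?_ ?_
    · intro v hv v' hv' q q' h
      have h1 := congrArg Subtype.val h
      simp only at h1
      have h2 := residue_unique (Finset.mem_range.1 hv) (Finset.mem_range.1 hv')
        (q := q) (q' := q') (by linarith)
      exact ⟨h2.1, by exact_mod_cast h2.2⟩
    · rintro ⟨n, hn⟩ -
      obtain ⟨v, hv, q, hq⟩ := residue_exists hk (n - n₀)
      have hge : n₀ ≤ n := by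
        rw [hn₀]
        exact Int.add_one_le_iff.2 (by rw [Int.floor_lt]; exact hn)
      have hq0 : 0 ≤ q := by
        by_contra! hneg
        have h1 : (k : ℤ) * q ≤ k * (-1) := mul_le_mul_of_nonneg_left (by omega) (by omega)
        omega
      lift q to ℕ using hq0
      refine ⟨v, Finset.mem_range.2 hv, q, Subtype.ext ?_⟩
      simp only
      linarith
    · intro v hv
      have h1 := (HurwitzZeta.hasSum_hurwitzZeta_of_one_lt_re (a := x v)
        ⟨(hx0 v).le, hx1 v (Finset.mem_range.1 hv)⟩ hs).mul_left (A (n₀ + v) * (k : ℂ) ^ (-s))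
      refine h1.congr_fun ?_
      intro q
      have hpos : 0 < (q : ℝ) + x v := by have := hx0 v; positivity
      have hA' : A (n₀ + v + k * q) = A (n₀ + v) := by
        have := hA.int_mul q (n₀ + v)
        rw [mul_comm] at this
        exact this
      have hcast : (((n₀ + v + k * q : ℤ) : ℂ) + (θ : ℂ)) = (k : ℂ) * (((q : ℝ) + x v : ℝ) : ℂ) := by
        have : ((n₀ + v + k * q : ℤ) : ℝ) + θ = k * ((q : ℝ) + x v) := by
          simp only [hx]; field_simp; push_cast; ring
        exact_mod_cast congrArg (fun y : ℝ => (y : ℂ)) this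
      rw [hA', hcast, IsUpper.lowerPow_eq, natCast_mul_cpow hk, Complex.cpow_neg (_ : ℂ) s,
        Complex.cpow_neg (((q : ℝ) + x v : ℝ) : ℂ) s]
      · push_cast
        ring
      · right
        rw [show ((k : ℂ) * (((q : ℝ) + x v : ℝ) : ℂ)) = ((k * ((q : ℝ) + x v) : ℝ) : ℂ) by
          push_cast; ring]
        exact ⟨Complex.ofReal_im _, by rw [Complex.ofReal_re]; positivity⟩

theorem isLContinuation_L {k : ℕ} (hk : 0 < k) {A : ℤ → ℂ}
    (hA : Function.Periodic A (k : ℤ)) (θ : ℝ) : IsLContinuation A θ (fun s => L s A θ) :=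
  Classical.epsilon_spec (exists_isLContinuation hk hA θ)

/-! ### Absolute convergence of the Eisenstein series -/

lemma exists_norm_le_of_periodic {k : ℕ} (hk : 0 < k) {A : ℤ → ℂ}
    (hA : Function.Periodic A (k : ℤ)) : ∃ C, 0 ≤ C ∧ ∀ n, ‖A n‖ ≤ C := by
  refine ⟨∑ v ∈ Finset.range k, ‖A v‖, Finset.sum_nonneg fun _ _ => norm_nonneg _, fun n => ?_⟩
  obtain ⟨v, hv, q, rfl⟩ := residue_exists hk n
  have h1 : A (v + k * q) = A v := by
    have := hA.int_mul q v
    rwa [mul_comm] at this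
  rw [h1]
  exact Finset.single_le_sum (f := fun v : ℕ => ‖A v‖) (fun _ _ => norm_nonneg _)
    (Finset.mem_range.2 hv)

/-- A translate of `ℤ` has a gap around zero. -/
lemma exists_gap (r : ℝ) : ∃ η > 0, η ≤ 1 ∧ ∀ m : ℤ, (m : ℝ) + r ≠ 0 → η ≤ |(m : ℝ) + r| := by
  rcases eq_or_ne (Int.fract r) 0 with h | h
  · refine ⟨1, one_pos, le_rfl, fun m hm => ?_⟩
    have h1 : r = ⌊r⌋ := by rw [Int.fract] at h; linarith
    rw [h1] at hm ⊢
    have h2 : m + ⌊r⌋ ≠ 0 := fun h0 => hm (by exact_mod_cast h0)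
    exact_mod_cast Int.one_le_abs h2
  · have h0 : 0 < Int.fract r := lt_of_le_of_ne (Int.fract_nonneg r) (Ne.symm h)
    have h1 := Int.fract_lt_one r
    refine ⟨min (Int.fract r) (1 - Int.fract r), lt_min h0 (by linarith),
      (min_le_left _ _).trans h1.le, fun m _ => ?_⟩
    have h2 : (m : ℝ) + r = (m + ⌊r⌋ : ℤ) + Int.fract r := by
      push_cast; rw [Int.fract]; ring
    rw [h2]
    rcases le_or_gt 0 (m + ⌊r⌋) with h3 | h3
    · have : (0 : ℝ) ≤ (m + ⌊r⌋ : ℤ) := by exact_mod_cast h3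
      rw [abs_of_nonneg (by linarith)]
      exact (min_le_left _ _).trans (by linarith)
    · have : ((m + ⌊r⌋ : ℤ) : ℝ) ≤ -1 := by exact_mod_cast (by omega : m + ⌊r⌋ ≤ -1)
      rw [abs_of_nonpos (by linarith)]
      exact (min_le_right _ _).trans (by linarith)

/-- The summand `|m + r| ^ (-p)`, with the value `1` at a possible zero of `m + r`. -/
noncomputable def shiftedPower (r p : ℝ) (m : ℤ) : ℝ :=
  1 / |(m : ℝ) + r| ^ p + if (m : ℝ) + r = 0 then 1 else 0

lemma shiftedPower_nonneg (r p : ℝ) (m : ℤ) : 0 ≤ shiftedPower r p m := by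
  unfold shiftedPower
  positivity

lemma summable_shiftedPower (r : ℝ) {p : ℝ} (hp : 1 < p) : Summable (shiftedPower r p) := by
  refine ((Real.summable_one_div_int_add_rpow r p).2 hp).add (summable_of_hasFiniteSupport ?_)
  refine Set.Subsingleton.finite fun m hm m' hm' => ?_
  have h1 : (m : ℝ) + r = 0 := by by_contra h; simp [h] at hm
  have h2 : (m' : ℝ) + r = 0 := by by_contra h; simp [h] at hm'
  exact_mod_cast (by linarith : (m : ℝ) = m')

/-- The size of `x z + y` controls both coordinates. -/
lemma exists_norm_lower_bound {z : ℂ} (hz : 0 < z.im) :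
    ∃ c > 0, ∀ x y : ℝ, c * |x| ≤ ‖(x : ℂ) * z + y‖ ∧ c * |y| ≤ ‖(x : ℂ) * z + y‖ := by
  have hpos : 0 < z.im + ‖z‖ := by positivity
  refine ⟨min z.im (z.im / (z.im + ‖z‖)), lt_min hz (by positivity), fun x y => ?_⟩
  set N := ‖(x : ℂ) * z + y‖ with hN
  have h1 : z.im * |x| ≤ N := by
    have := Complex.abs_im_le_norm ((x : ℂ) * z + y)
    simp only [Complex.add_im, Complex.im_ofReal_mul, Complex.ofReal_im, add_zero, abs_mul,
      abs_of_pos hz] at this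
    linarith
  have h2 : |y| ≤ N + |x| * ‖z‖ := by
    have h3 : (y : ℂ) = ((x : ℂ) * z + y) - x * z := by ring
    have := norm_sub_le ((x : ℂ) * z + y) (x * z)
    rw [← h3, norm_mul, Complex.norm_real, Complex.norm_real] at this
    exact this
  constructor
  · exact (mul_le_mul_of_nonneg_right (min_le_left _ _) (abs_nonneg _)).trans h1
  · refine (mul_le_mul_of_nonneg_right (min_le_right _ _) (abs_nonneg _)).trans ?_
    rw [div_mul_eq_mul_div, div_le_iff₀ hpos]
    have h4 : z.im * |y| ≤ z.im * (N + |x| * ‖z‖) := mul_le_mul_of_nonneg_left h2 hz.le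
    nlinarith [norm_nonneg z]

/-- The bound behind absolute convergence: off the origin `‖x z + y‖ ^ (-σ)` is at most a
constant times `|x| ^ (-σ / 2) |y| ^ (-σ / 2)`. -/
lemma exists_rpow_norm_bound {z : ℂ} (hz : 0 < z.im) (r₁ r₂ : ℝ) {σ : ℝ} (hσ : 0 < σ) :
    ∃ C, 0 ≤ C ∧ ∀ m n : ℤ, ¬ ((m : ℝ) + r₁ = 0 ∧ (n : ℝ) + r₂ = 0) →
      ‖(((m : ℝ) + r₁ : ℝ) : ℂ) * z + ((n : ℝ) + r₂ : ℝ)‖ ^ (-σ) ≤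
        C * (shiftedPower r₁ (σ / 2) m * shiftedPower r₂ (σ / 2) n) := by
  obtain ⟨c, hc, hN⟩ := exists_norm_lower_bound hz
  obtain ⟨η₁, hη₁, hη₁', hg₁⟩ := exists_gap r₁
  obtain ⟨η₂, hη₂, hη₂', hg₂⟩ := exists_gap r₂
  set η := min η₁ η₂
  have hη : 0 < η := lt_min hη₁ hη₂
  have hη1 : η ≤ 1 := (min_le_left _ _).trans hη₁'
  refine ⟨(c ^ 2 * η) ^ (-(σ / 2)), by positivity, fun m n hmn => ?_⟩
  set x := (m : ℝ) + r₁
  set y := (n : ℝ) + r₂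
  set N := ‖((x : ℝ) : ℂ) * z + (y : ℝ)‖
  obtain ⟨hx, hy⟩ := hN x y
  have hN0 : 0 ≤ N := norm_nonneg _
  -- it suffices to bound `N ^ 2` below by a product of the two (nonzero) coordinates
  have key : ∀ a b : ℝ, 0 < a → 0 < b → c ^ 2 * η * (a * b) ≤ N ^ 2 →
      N ^ (-σ) ≤ (c ^ 2 * η) ^ (-(σ / 2)) * (1 / a ^ (σ / 2) * (1 / b ^ (σ / 2))) := by
    intro a b ha hb hab
    have hab0 : 0 < c ^ 2 * η * (a * b) := by positivity
    have h1 : N ^ (-σ) = (N ^ 2) ^ (-(σ / 2)) := by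
      rw [← Real.rpow_natCast, ← Real.rpow_mul hN0]; congr 1; push_cast; ring
    rw [h1]
    refine (Real.rpow_le_rpow_of_nonpos hab0 hab (by linarith)).trans_eq ?_
    rw [Real.mul_rpow (by positivity) (by positivity), Real.mul_rpow ha.le hb.le,
      Real.rpow_neg ha.le, Real.rpow_neg hb.le, one_div, one_div]
  have hp : σ / 2 ≠ 0 := by positivity
  have hsx : x ≠ 0 → shiftedPower r₁ (σ / 2) m = 1 / |x| ^ (σ / 2) := fun h => by
    simp [shiftedPower, x, h]
  have hsy : y ≠ 0 → shiftedPower r₂ (σ / 2) n = 1 / |y| ^ (σ / 2) := fun h => by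
    simp [shiftedPower, y, h]
  have hsx0 : x = 0 → shiftedPower r₁ (σ / 2) m = 1 / 1 ^ (σ / 2) := fun h => by
    simp only [x] at h
    simp [shiftedPower, h, Real.zero_rpow hp]
  have hsy0 : y = 0 → shiftedPower r₂ (σ / 2) n = 1 / 1 ^ (σ / 2) := fun h => by
    simp only [y] at h
    simp [shiftedPower, h, Real.zero_rpow hp]
  have hax : x ≠ 0 → η ≤ |x| := fun h => (min_le_left _ _).trans (hg₁ m h)
  have hay : y ≠ 0 → η ≤ |y| := fun h => (min_le_right _ _).trans (hg₂ n h)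
  by_cases h1 : x = 0
  · have h2 : y ≠ 0 := fun h2 => hmn ⟨h1, h2⟩
    rw [hsx0 h1, hsy h2]
    refine key _ _ one_pos (abs_pos.2 h2) ?_
    calc c ^ 2 * η * (1 * |y|) ≤ c ^ 2 * |y| * (1 * |y|) := by gcongr; exact hay h2
      _ = (c * |y|) ^ 2 := by ring
      _ ≤ N ^ 2 := by gcongr
  · by_cases h2 : y = 0
    · rw [hsx h1, hsy0 h2]
      refine key _ _ (abs_pos.2 h1) one_pos ?_
      calc c ^ 2 * η * (|x| * 1) ≤ c ^ 2 * |x| * (|x| * 1) := by gcongr; exact hax h1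
        _ = (c * |x|) ^ 2 := by ring
        _ ≤ N ^ 2 := by gcongr
    · rw [hsx h1, hsy h2]
      refine key _ _ (abs_pos.2 h1) (abs_pos.2 h2) ?_
      calc c ^ 2 * η * (|x| * |y|) ≤ c ^ 2 * 1 * (|x| * |y|) := by gcongr
        _ = (c * |x|) * (c * |y|) := by ring
        _ ≤ N * N := by gcongr
        _ = N ^ 2 := by ring

lemma norm_lowerPow_le {w : ℂ} (hw : w ≠ 0) (s : ℂ) :
    ‖lowerPow w (-s)‖ ≤ Real.exp (Real.pi * |s.im|) * ‖w‖ ^ (-s.re) := by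
  have h0 : 0 < ‖w‖ := norm_pos_iff.2 hw
  rw [lowerPow, Complex.norm_exp, Real.rpow_def_of_pos h0, ← Real.exp_add]
  refine Real.exp_le_exp.2 ?_
  have h1 : |lowerArg w| ≤ Real.pi := abs_le.2 ⟨neg_pi_le_lowerArg w, (lowerArg_lt_pi w).le⟩
  have h2 : s.im * lowerArg w ≤ Real.pi * |s.im| := by
    refine (le_abs_self _).trans ?_
    rw [abs_mul, mul_comm]
    gcongr
  simp
  linarith

theorem summable_eisensteinTerm {k : ℕ} (hk : 0 < k) {A B : ℤ → ℂ}
    (hA : Function.Periodic A (k : ℤ)) (hB : Function.Periodic B (k : ℤ)) {z : ℂ} (hz : 0 < z.im)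
    (r₁ r₂ : ℝ) {s : ℂ} (hs : 2 < s.re) : Summable (eisensteinTerm z s A B r₁ r₂) := by
  obtain ⟨CA, hCA0, hCA⟩ := exists_norm_le_of_periodic hk hA
  obtain ⟨CB, hCB0, hCB⟩ := exists_norm_le_of_periodic hk hB
  obtain ⟨C, hC0, hC⟩ := exists_rpow_norm_bound hz r₁ r₂ (σ := s.re) (by linarith)
  have hsum := (Summable.mul_of_nonneg (summable_shiftedPower r₁ (p := s.re / 2) (by linarith))
    (summable_shiftedPower r₂ (p := s.re / 2) (by linarith))
    (fun _ => shiftedPower_nonneg _ _ _) (fun _ => shiftedPower_nonneg _ _ _)).mul_left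
    (CA * CB * Real.exp (Real.pi * |s.im|) * C)
  refine Summable.of_norm_bounded hsum ?_
  rintro ⟨m, n⟩
  have hnn := mul_nonneg (shiftedPower_nonneg r₁ (s.re / 2) m) (shiftedPower_nonneg r₂ (s.re / 2) n)
  unfold eisensteinTerm
  simp only
  split_ifs with h
  · rw [norm_zero]
    positivity
  · have h' : ¬ ((m : ℝ) + r₁ = 0 ∧ (n : ℝ) + r₂ = 0) := fun h0 =>
      h ⟨by linarith [h0.1], by linarith [h0.2]⟩
    have hw : ((m : ℂ) + (r₁ : ℂ)) * z + (n : ℂ) + (r₂ : ℂ) =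
        (((m : ℝ) + r₁ : ℝ) : ℂ) * z + ((n : ℝ) + r₂ : ℝ) := by push_cast; ring
    have hw0 : (((m : ℝ) + r₁ : ℝ) : ℂ) * z + ((n : ℝ) + r₂ : ℝ) ≠ 0 := by
      intro h0
      obtain ⟨c, hc, hN⟩ := exists_norm_lower_bound hz
      obtain ⟨h1, h2⟩ := hN ((m : ℝ) + r₁) ((n : ℝ) + r₂)
      rw [h0, norm_zero] at h1 h2
      refine h' ⟨abs_nonpos_iff.1 ?_, abs_nonpos_iff.1 ?_⟩
      · exact nonpos_of_mul_nonpos_right h1 hc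
      · exact nonpos_of_mul_nonpos_right h2 hc
    rw [hw, norm_mul, norm_mul]
    calc ‖A m‖ * ‖B n‖ * ‖lowerPow ((((m : ℝ) + r₁ : ℝ) : ℂ) * z + ((n : ℝ) + r₂ : ℝ)) (-s)‖
        ≤ CA * CB * (Real.exp (Real.pi * |s.im|) *
          (C * (shiftedPower r₁ (s.re / 2) m * shiftedPower r₂ (s.re / 2) n))) := by
          gcongr
          · exact hCA m
          · exact hCB n
          · exact (norm_lowerPow_le hw0 s).trans
              (mul_le_mul_of_nonneg_left (hC m n h') (Real.exp_pos _).le)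
      _ = _ := by ring

/-! ### Lipschitz's summation formula -/

/-- The function `t ↦ t ^ (s - 1) exp (2 π i w t)` on `t > 0`, extended by zero, to which Poisson
summation is applied. -/
noncomputable def lipschitzFun (s w : ℂ) (t : ℝ) : ℂ :=
  ((max t 0 : ℝ) : ℂ) ^ (s - 1) * Complex.exp (2 * Real.pi * Complex.I * w * t)

lemma continuous_lipschitzFun {s w : ℂ} (hs : 1 < s.re) : Continuous (lipschitzFun s w) := by
  unfold lipschitzFun
  refine Continuous.mul ?_ (by fun_prop)
  exact (Complex.continuous_ofReal_cpow_const (by simpa using hs)).comp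
    (continuous_id.max continuous_const)

lemma lipschitzFun_of_nonpos {s w : ℂ} (hs : 1 < s.re) {t : ℝ} (ht : t ≤ 0) :
    lipschitzFun s w t = 0 := by
  have : s - 1 ≠ 0 := by
    intro h
    have := congrArg Complex.re h
    simp at this
    linarith
  simp [lipschitzFun, max_eq_right ht, Complex.zero_cpow this]

lemma lipschitzFun_of_pos {s w : ℂ} {t : ℝ} (ht : 0 < t) :
    lipschitzFun s w t = (t : ℂ) ^ (s - 1) * Complex.exp (2 * Real.pi * Complex.I * w * t) := by
  rw [lipschitzFun, max_eq_left ht.le]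

lemma isBigO_lipschitzFun {s w : ℂ} (hs : 1 < s.re) (hw : 0 < w.im) (b : ℝ) :
    lipschitzFun s w =O[cocompact ℝ] fun x => |x| ^ (-b) := by
  rw [_root_.cocompact_eq_atBot_atTop, Asymptotics.isBigO_sup]
  constructor
  · refine Asymptotics.IsBigO.of_bound 0 ?_
    filter_upwards [eventually_le_atBot (0 : ℝ)] with t ht
    rw [lipschitzFun_of_nonpos hs ht]
    simp
  · have h1 := (isLittleO_exp_neg_mul_rpow_atTop (a := 2 * Real.pi * w.im) (by positivity)
      (-b - (s.re - 1))).isBigO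
    have h2 := (Asymptotics.isBigO_refl (fun t : ℝ => t ^ (s.re - 1)) atTop).mul h1
    refine Asymptotics.IsBigO.congr' (Asymptotics.IsBigO.of_norm_left ?_) EventuallyEq.rfl
      (EventuallyEq.refl _ _) (f₁ := lipschitzFun s w)
    refine h2.congr' ?_ ?_
    · filter_upwards [eventually_gt_atTop (0 : ℝ)] with t ht
      rw [lipschitzFun_of_pos ht, norm_mul, Complex.norm_cpow_eq_rpow_re_of_pos ht,
        Complex.norm_exp]
      congr 2
      simp
    · filter_upwards [eventually_gt_atTop (0 : ℝ)] with t ht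
      rw [← Real.rpow_add ht, abs_of_pos ht]
      congr 1
      ring

lemma fourier_lipschitzFun {s w : ℂ} (hs : 1 < s.re) (hw : 0 < w.im) (ξ : ℝ) :
    FourierTransform.fourier (lipschitzFun s w) ξ =
      (-(2 * Real.pi * Complex.I * (w - ξ))) ^ (-s) * Complex.Gamma s := by
  rw [Real.fourier_real_eq_integral_exp_smul]
  rw [← integral_cpow_mul_exp_neg_mul (s := s) (by linarith)
    (by simp; positivity)]
  rw [← integral_indicator measurableSet_Ioi]
  refine integral_congr_ae (Eventually.of_forall fun t => ?_)
  rcases le_or_gt t 0 with ht | ht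
  · simp [lipschitzFun_of_nonpos hs ht, ht]
  · simp only [Set.indicator_of_mem (Set.mem_Ioi.2 ht), lipschitzFun_of_pos ht, smul_eq_mul]
    rw [mul_left_comm, ← Complex.exp_add]
    congr 2
    push_cast
    ring

/-- For `v` in the upper half-plane `arg (-2 π i v) = arg v - π / 2`. -/
lemma neg_two_pi_I_mul_cpow {v : ℂ} (hv : 0 < v.im) (s : ℂ) :
    (-(2 * Real.pi * Complex.I * v)) ^ (-s) =
      Complex.exp (-(s * (Real.log (2 * Real.pi) - Real.pi / 2 * Complex.I))) * v ^ (-s) := by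
  have hv' : IsUpper v := Or.inl hv
  have hpi : (0 : ℝ) < 2 * Real.pi := by positivity
  have harg : 0 < v.arg := lt_of_le_of_ne hv'.arg_nonneg fun h => by
    have := (Complex.arg_eq_zero_iff.1 h.symm).2
    linarith
  have h1 : Complex.log (-(2 * Real.pi * Complex.I * v)) =
      Real.log (2 * Real.pi) - Real.pi / 2 * Complex.I + Complex.log v := by
    have hexp : Complex.exp (Real.log (2 * Real.pi) - Real.pi / 2 * Complex.I + Complex.log v) =
        -(2 * Real.pi * Complex.I * v) := by
      rw [Complex.exp_add, Complex.exp_sub, Complex.exp_log hv'.ne_zero, ← Complex.ofReal_exp,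
        Real.exp_log hpi, Complex.exp_pi_div_two_mul_I]
      rw [div_eq_mul_inv, Complex.inv_I]
      push_cast
      ring
    rw [← hexp, Complex.log_exp]
    · simp [Complex.log_im]
      linarith [Real.pi_pos]
    · simp [Complex.log_im]
      linarith [Real.pi_pos, hv'.arg_lt_pi]
  have h0 : -(2 * Real.pi * Complex.I * v) ≠ 0 := by
    simp [Real.pi_ne_zero, hv'.ne_zero]
  rw [Complex.cpow_def_of_ne_zero h0, h1, Complex.cpow_def_of_ne_zero hv'.ne_zero,
    ← Complex.exp_add]
  congr 1
  ring

/-- The factor `(-2 π i) ^ s / Γ(s)` of Lipschitz's formula, an entire function. -/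
noncomputable def lipschitzFactor (s : ℂ) : ℂ :=
  Complex.exp (s * (Real.log (2 * Real.pi) - Real.pi / 2 * Complex.I)) * (Complex.Gamma s)⁻¹

lemma differentiable_lipschitzFactor : Differentiable ℂ lipschitzFactor := by
  unfold lipschitzFactor
  exact ((differentiable_id.mul_const _).cexp).mul Complex.differentiable_one_div_Gamma

/-- **Lipschitz's summation formula**
`Γ(s) ∑ (w + n) ^ (-s) = (-2 π i) ^ s ∑ l ^ (s - 1) exp (2 π i l w)` for complex `s`. -/
theorem hasSum_lipschitz {s w : ℂ} (hs : 1 < s.re) (hw : 0 < w.im) :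
    HasSum (fun n : ℤ => (w + n) ^ (-s))
      (lipschitzFactor s * ∑' l : ℕ, ((l : ℂ) + 1) ^ (s - 1) *
        Complex.exp (2 * Real.pi * Complex.I * w * (l + 1))) := by
  have hΓ : Complex.Gamma s ≠ 0 := Complex.Gamma_ne_zero_of_re_pos (by linarith)
  set κ : ℂ := s * (Real.log (2 * Real.pi) - Real.pi / 2 * Complex.I) with hκ
  have hfour : ∀ n : ℤ, FourierTransform.fourier (lipschitzFun s w) ((n : ℤ) : ℝ) =
      (Complex.exp (-κ) * Complex.Gamma s) * (w + (-n : ℤ)) ^ (-s) := by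
    intro n
    rw [fourier_lipschitzFun hs hw, show w - (((n : ℤ) : ℝ) : ℂ) = w + (-n : ℤ) by push_cast; ring,
      neg_two_pi_I_mul_cpow (by simpa using hw)]
    ring
  have hb1 := isBigO_lipschitzFun hs hw s.re
  have hb2 : FourierTransform.fourier (lipschitzFun s w) =O[cocompact ℝ] fun x => |x| ^ (-s.re) := by
    have hev : ∀ᶠ ξ : ℝ in cocompact ℝ, 2 * ‖w‖ ≤ |ξ| ∧ 1 ≤ |ξ| :=
      (tendsto_norm_cocompact_atTop.eventually_ge_atTop _).and
        (tendsto_norm_cocompact_atTop.eventually_ge_atTop _)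
    refine Asymptotics.IsBigO.of_bound
      (‖Complex.exp (-κ)‖ * (Real.exp (Real.pi * |s.im|) * (1 / 2) ^ (-s.re)) *
        ‖Complex.Gamma s‖) ?_
    filter_upwards [hev] with ξ hξ
    have hv : 0 < (w - ξ).im := by simpa using hw
    have hup : IsUpper (w - ξ) := Or.inl hv
    rw [fourier_lipschitzFun hs hw, neg_two_pi_I_mul_cpow hv, norm_mul, norm_mul,
      ← hup.lowerPow_eq]
    have h1 := norm_lowerPow_le hup.ne_zero s
    have h2 : 1 / 2 * |ξ| ≤ ‖w - ξ‖ := by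
      have := norm_sub_norm_le (ξ : ℂ) w
      rw [Complex.norm_real, Real.norm_eq_abs, norm_sub_rev] at this
      linarith [hξ.1]
    have h3 : ‖w - ξ‖ ^ (-s.re) ≤ (1 / 2) ^ (-s.re) * |ξ| ^ (-s.re) := by
      rw [← Real.mul_rpow (by norm_num) (abs_nonneg _)]
      exact Real.rpow_le_rpow_of_nonpos (by linarith [hξ.2]) h2 (by linarith)
    rw [Real.norm_of_nonneg (by positivity : (0 : ℝ) ≤ |ξ| ^ (-s.re))]
    calc _ ≤ ‖Complex.exp (-κ)‖ * (Real.exp (Real.pi * |s.im|) *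
            ((1 / 2) ^ (-s.re) * |ξ| ^ (-s.re))) * ‖Complex.Gamma s‖ := by
          gcongr
          exact h1.trans (mul_le_mul_of_nonneg_left h3 (Real.exp_pos _).le)
      _ = _ := by ring
  have hpois := Real.tsum_eq_tsum_fourier_of_rpow_decay (continuous_lipschitzFun hs) hs hb1 hb2 0
  simp only [zero_add, QuotientAddGroup.mk_zero, fourier_eval_zero, mul_one] at hpois
  have hsumm : Summable fun n : ℤ => FourierTransform.fourier (lipschitzFun s w) ((n : ℤ) : ℝ) :=
    summable_of_isBigO (Real.summable_abs_int_rpow hs) (hb2.comp_tendsto Int.tendsto_coe_cofinite)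
  have hleft : ∑' n : ℤ, lipschitzFun s w n = ∑' l : ℕ, ((l : ℂ) + 1) ^ (s - 1) *
        Complex.exp (2 * Real.pi * Complex.I * w * (l + 1)) := by
    have hinj : Function.Injective (fun l : ℕ => ((l : ℤ) + 1)) := fun a b h => by
      simpa using h
    rw [← hinj.tsum_eq]
    · refine tsum_congr fun l => ?_
      rw [lipschitzFun_of_pos (by positivity)]
      push_cast
      rfl
    · intro n hn
      have : 0 < n := by
        by_contra! h
        exact hn (lipschitzFun_of_nonpos hs (by exact_mod_cast h))
      exact ⟨(n - 1).toNat, by simp only; omega⟩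
  have h1 := hsumm.hasSum
  rw [← hpois, hleft] at h1
  rw [← (Equiv.neg ℤ).hasSum_iff]
  have h2 := h1.mul_left (lipschitzFactor s)
  refine h2.congr_fun fun n => ?_
  rw [hfour, lipschitzFactor, ← hκ, Complex.exp_neg]
  have := Complex.exp_ne_zero κ
  simp only [Function.comp_apply, Equiv.neg_apply]
  field_simp

/-! ### Analytic continuation of the Eisenstein series -/

/-- The number `(m + r₁) z + n + r₂`. -/
noncomputable def latticePoint (z : ℂ) (r₁ r₂ : ℝ) (p : ℤ × ℤ) : ℂ :=
  ((p.1 : ℂ) + (r₁ : ℂ)) * z + (p.2 : ℂ) + (r₂ : ℂ)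

lemma latticePoint_im (z : ℂ) (r₁ r₂ : ℝ) (p : ℤ × ℤ) :
    (latticePoint z r₁ r₂ p).im = ((p.1 : ℝ) + r₁) * z.im := by
  simp [latticePoint]

lemma latticePoint_re (z : ℂ) (r₁ r₂ : ℝ) (p : ℤ × ℤ) :
    (latticePoint z r₁ r₂ p).re = ((p.1 : ℝ) + r₁) * z.re + ((p.2 : ℝ) + r₂) := by
  simp [latticePoint]
  ring

lemma latticePoint_neg (z : ℂ) (r₁ r₂ : ℝ) (p : ℤ × ℤ) :
    latticePoint z (-r₁) (-r₂) (-p) = -latticePoint z r₁ r₂ p := by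
  simp [latticePoint]
  ring

lemma isUpper_latticePoint_iff {z : ℂ} (hz : 0 < z.im) (r₁ r₂ : ℝ) (p : ℤ × ℤ) :
    IsUpper (latticePoint z r₁ r₂ p) ↔
      0 < (p.1 : ℝ) + r₁ ∨ ((p.1 : ℝ) + r₁ = 0 ∧ 0 < (p.2 : ℝ) + r₂) := by
  rw [IsUpper, latticePoint_im, latticePoint_re]
  refine or_congr (mul_pos_iff_of_pos_right hz) ?_
  constructor
  · rintro ⟨h1, h2⟩
    have h3 := (mul_eq_zero.1 h1).resolve_right hz.ne'
    rw [h3] at h2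
    exact ⟨h3, by linarith⟩
  · rintro ⟨h1, h2⟩
    rw [h1]
    exact ⟨by ring, by linarith⟩

open Classical in
/-- The terms of the Eisenstein series whose pair `(m, n)` lies in `S`, with principal powers. It is
used only for sets of pairs with `(m + r₁) z + n + r₂` in the upper half-plane, where the principal
branch and the branch `-π ≤ arg w < π` agree. -/
noncomputable def partialTerm (S : Set (ℤ × ℤ)) (z s : ℂ) (A B : ℤ → ℂ) (r₁ r₂ : ℝ)
    (p : ℤ × ℤ) : ℂ :=
  if p ∈ S then A p.1 * B p.2 * latticePoint z r₁ r₂ p ^ (-s) else 0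

lemma partialTerm_of_mem {S : Set (ℤ × ℤ)} {p : ℤ × ℤ} (h : p ∈ S) (z s : ℂ) (A B : ℤ → ℂ)
    (r₁ r₂ : ℝ) :
    partialTerm S z s A B r₁ r₂ p = A p.1 * B p.2 * latticePoint z r₁ r₂ p ^ (-s) := if_pos h

lemma partialTerm_of_notMem {S : Set (ℤ × ℤ)} {p : ℤ × ℤ} (h : p ∉ S) (z s : ℂ) (A B : ℤ → ℂ)
    (r₁ r₂ : ℝ) : partialTerm S z s A B r₁ r₂ p = 0 := if_neg h

/-- The pairs with `(m + r₁) z + n + r₂` above the real axis. -/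
def positiveRows (r₁ : ℝ) : Set (ℤ × ℤ) := {p | 0 < (p.1 : ℝ) + r₁}

/-- The pairs with `(m + r₁) z + n + r₂` on the positive real axis. -/
def positiveRay (r₁ r₂ : ℝ) : Set (ℤ × ℤ) := {p | (p.1 : ℝ) + r₁ = 0 ∧ 0 < (p.2 : ℝ) + r₂}

/-- The terms of the Eisenstein series, sorted by the half-plane in which `(m + r₁) z + n + r₂`
lies. -/
lemma eisensteinTerm_eq {z : ℂ} (hz : 0 < z.im) (s : ℂ) (A B : ℤ → ℂ) (r₁ r₂ : ℝ) (p : ℤ × ℤ) :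
    eisensteinTerm z s A B r₁ r₂ p =
      partialTerm (positiveRows r₁ ∪ positiveRay r₁ r₂) z s A B r₁ r₂ p +
      Complex.exp (Real.pi * Complex.I * s) *
        partialTerm (positiveRows (-r₁) ∪ positiveRay (-r₁) (-r₂)) z s
          (fun n => A (-n)) (fun n => B (-n)) (-r₁) (-r₂) (-p) := by
  have hup := isUpper_latticePoint_iff hz r₁ r₂ p
  have hun := isUpper_latticePoint_iff hz (-r₁) (-r₂) (-p)
  have hm1 : p ∈ positiveRows r₁ ∪ positiveRay r₁ r₂ ↔ IsUpper (latticePoint z r₁ r₂ p) :=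
    hup.symm
  have hm2 : -p ∈ positiveRows (-r₁) ∪ positiveRay (-r₁) (-r₂) ↔
      IsUpper (latticePoint z (-r₁) (-r₂) (-p)) := hun.symm
  simp only [Prod.fst_neg, Prod.snd_neg, Int.cast_neg] at hun
  have he : eisensteinTerm z s A B r₁ r₂ p = if (p.1 : ℝ) = -r₁ ∧ (p.2 : ℝ) = -r₂ then 0
      else A p.1 * B p.2 * lowerPow (latticePoint z r₁ r₂ p) (-s) := rfl
  rw [he]
  rcases lt_trichotomy ((p.1 : ℝ) + r₁) 0 with h1 | h1 | h1
  · have hA : ¬ IsUpper (latticePoint z r₁ r₂ p) := by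
      rw [hup]; rintro (h | h) <;> linarith
    have hB : IsUpper (latticePoint z (-r₁) (-r₂) (-p)) := by
      rw [hun]; left; linarith
    rw [partialTerm_of_notMem (mt hm1.1 hA), partialTerm_of_mem (hm2.2 hB), if_neg (fun h => by linarith [h.1])]
    have h2 := hB.lowerPow_neg s
    rw [latticePoint_neg, neg_neg] at h2
    rw [h2, latticePoint_neg]
    simp only [Prod.fst_neg, Prod.snd_neg, neg_neg]
    ring
  · rcases lt_trichotomy ((p.2 : ℝ) + r₂) 0 with h2 | h2 | h2
    · have hA : ¬ IsUpper (latticePoint z r₁ r₂ p) := by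
        rw [hup]; rintro (h | h) <;> linarith
      have hB : IsUpper (latticePoint z (-r₁) (-r₂) (-p)) := by
        rw [hun]; right; constructor <;> linarith
      rw [partialTerm_of_notMem (mt hm1.1 hA), partialTerm_of_mem (hm2.2 hB), if_neg (fun h => by linarith [h.2])]
      have h2 := hB.lowerPow_neg s
      rw [latticePoint_neg, neg_neg] at h2
      rw [h2, latticePoint_neg]
      simp only [Prod.fst_neg, Prod.snd_neg, neg_neg]
      ring
    · have hA : ¬ IsUpper (latticePoint z r₁ r₂ p) := by
        rw [hup]; rintro (h | h) <;> linarith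
      have hB : ¬ IsUpper (latticePoint z (-r₁) (-r₂) (-p)) := by
        rw [hun]; rintro (h | h) <;> linarith
      rw [partialTerm_of_notMem (mt hm1.1 hA), partialTerm_of_notMem (mt hm2.1 hB), if_pos ⟨by linarith, by linarith⟩]
      ring
    · have hA : IsUpper (latticePoint z r₁ r₂ p) := by
        rw [hup]; right; exact ⟨h1, h2⟩
      have hB : ¬ IsUpper (latticePoint z (-r₁) (-r₂) (-p)) := by
        rw [hun]; rintro (h | h) <;> linarith
      rw [partialTerm_of_mem (hm1.2 hA), partialTerm_of_notMem (mt hm2.1 hB), if_neg (fun h => by linarith [h.2]), hA.lowerPow_eq]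
      ring
  · have hA : IsUpper (latticePoint z r₁ r₂ p) := by
      rw [hup]; left; exact h1
    have hB : ¬ IsUpper (latticePoint z (-r₁) (-r₂) (-p)) := by
      rw [hun]; rintro (h | h) <;> linarith
    rw [partialTerm_of_mem (hm1.2 hA), partialTerm_of_notMem (mt hm2.1 hB), if_neg (fun h => by linarith [h.1]), hA.lowerPow_eq]
    ring

/-- Sums over part of the closed upper half-plane converge absolutely with the whole series. -/
lemma summable_partialTerm {k : ℕ} (hk : 0 < k) {A B : ℤ → ℂ}
    (hA : Function.Periodic A (k : ℤ)) (hB : Function.Periodic B (k : ℤ)) {z : ℂ} (hz : 0 < z.im)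
    {r₁ r₂ : ℝ} {s : ℂ} (hs : 2 < s.re) {S : Set (ℤ × ℤ)}
    (hS : S ⊆ positiveRows r₁ ∪ positiveRay r₁ r₂) :
    Summable (partialTerm S z s A B r₁ r₂) := by
  have h := (summable_eisensteinTerm hk hA hB hz r₁ r₂ hs).indicator S
  refine h.congr fun p => ?_
  by_cases hp : p ∈ S
  · have hup : IsUpper (latticePoint z r₁ r₂ p) := (isUpper_latticePoint_iff hz r₁ r₂ p).2 (hS hp)
    have hne : ¬ ((p.1 : ℝ) = -r₁ ∧ (p.2 : ℝ) = -r₂) := by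
      rintro ⟨h1, h2⟩
      rcases hS hp with h | h
      · have : 0 < (p.1 : ℝ) + r₁ := h
        linarith
      · have : 0 < (p.2 : ℝ) + r₂ := h.2
        linarith
    rw [Set.indicator_of_mem hp, partialTerm, if_pos hp, eisensteinTerm, if_neg hne,
      ← hup.lowerPow_eq]
    rfl
  · rw [Set.indicator_of_notMem hp, partialTerm, if_neg hp]

lemma disjoint_positiveRows_positiveRay (r₁ r₂ : ℝ) :
    Disjoint (positiveRows r₁) (positiveRay r₁ r₂) :=
  Set.disjoint_left.2 fun _ h1 h2 => (ne_of_gt h1) h2.1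

lemma periodic_comp_neg {A : ℤ → ℂ} {c : ℤ} (h : Function.Periodic A c) :
    Function.Periodic (fun n => A (-n)) c := fun n => by
  have := h (-n - c)
  rw [sub_add_cancel] at this
  simp only
  rw [this, neg_add]
  rfl

lemma partialTerm_union {S T : Set (ℤ × ℤ)} (h : Disjoint S T) (z s : ℂ) (A B : ℤ → ℂ)
    (r₁ r₂ : ℝ) (p : ℤ × ℤ) :
    partialTerm (S ∪ T) z s A B r₁ r₂ p =
      partialTerm S z s A B r₁ r₂ p + partialTerm T z s A B r₁ r₂ p := by
  by_cases h1 : p ∈ S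
  · have h2 : p ∉ T := Set.disjoint_left.1 h h1
    rw [partialTerm_of_mem (Or.inl h1), partialTerm_of_mem h1, partialTerm_of_notMem h2, add_zero]
  · by_cases h2 : p ∈ T
    · rw [partialTerm_of_mem (Or.inr h2), partialTerm_of_notMem h1, partialTerm_of_mem h2, zero_add]
    · rw [partialTerm_of_notMem (fun h => h.elim h1 h2), partialTerm_of_notMem h1,
        partialTerm_of_notMem h2, zero_add]

/-- The terms on the positive real axis sum to the Dirichlet series. -/
lemma hasSum_positiveRay {k : ℕ} (hk : 0 < k) {A B : ℤ → ℂ}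
    (hB : Function.Periodic B (k : ℤ)) (z : ℂ) (R r₂ : ℝ) {s : ℂ} (hs : 1 < s.re) :
    HasSum (partialTerm (positiveRay (-R) r₂) z s A B (-R) r₂)
      (A ⌊R⌋ * intChar R * L s B r₂) := by
  have hL := (isLContinuation_L hk hB r₂).2 s hs
  by_cases hR : Int.fract R = 0
  · have hRf : R = ⌊R⌋ := by rw [Int.fract] at hR; linarith
    rw [intChar, if_pos hR, mul_one]
    have hinj : Function.Injective
        (fun n : {n : ℤ // -r₂ < (n : ℝ)} => ((⌊R⌋, n.1) : ℤ × ℤ)) := fun a b h =>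
      Subtype.ext (Prod.ext_iff.1 h).2
    rw [← hinj.hasSum_iff]
    · refine (hL.mul_left (A ⌊R⌋)).congr_fun ?_
      rintro ⟨n, hn⟩
      have hmem : ((⌊R⌋, n) : ℤ × ℤ) ∈ positiveRay (-R) r₂ :=
        ⟨by simp only; linarith, by simp only; linarith⟩
      have hw : latticePoint z (-R) r₂ (⌊R⌋, n) = ((n : ℂ) + (r₂ : ℂ)) := by
        have : ((⌊R⌋ : ℤ) : ℂ) = (R : ℂ) := by
          exact_mod_cast congrArg (fun x : ℝ => (x : ℂ)) hRf.symm
        simp [latticePoint, this]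
      have hup : IsUpper ((n : ℂ) + (r₂ : ℂ)) := Or.inr ⟨by simp, by simp; linarith⟩
      simp only [Function.comp_apply, partialTerm, if_pos hmem, hw, hup.lowerPow_eq]
      ring
    · rintro ⟨m, n⟩ hp
      rw [partialTerm, if_neg]
      rintro ⟨h1, h2⟩
      simp only at h1 h2
      refine hp ⟨⟨n, by linarith⟩, Prod.ext ?_ rfl⟩
      have : (m : ℝ) = (⌊R⌋ : ℤ) := by linarith
      simp only
      exact_mod_cast this.symm
  · rw [intChar, if_neg hR]
    simp only [mul_zero, zero_mul]
    refine hasSum_zero.congr_fun ?_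
    rintro ⟨m, n⟩
    rw [partialTerm, if_neg]
    rintro ⟨h1, -⟩
    simp only at h1
    have : R = (m : ℤ) := by linarith
    exact hR (by rw [this, Int.fract_intCast])

/-- A horizontal line of the Eisenstein series, by Lipschitz's formula for the residue classes. -/
lemma hasSum_horizontalLine {k : ℕ} (hk : 0 < k) {B : ℤ → ℂ} (hB : Function.Periodic B (k : ℤ))
    {w s : ℂ} (hs : 1 < s.re) (hw : 0 < w.im) :
    HasSum (fun n : ℤ => B n * (w + n) ^ (-s))
      (∑ v ∈ Finset.range k, B v * (k : ℂ) ^ (-s) * (lipschitzFactor s *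
        ∑' l : ℕ, ((l : ℂ) + 1) ^ (s - 1) *
          Complex.exp (2 * Real.pi * Complex.I * ((w + v) / k) * (l + 1)))) := by
  have hk0 : (0 : ℝ) < k := by exact_mod_cast hk
  have hkc : (k : ℂ) ≠ 0 := by exact_mod_cast hk.ne'
  refine hasSum_of_finset_partition (Finset.range k) (fun v (q : ℤ) => (v : ℤ) + k * q) _ ?_ ?_ ?_
  · exact fun v hv v' hv' q q' h =>
      residue_unique (Finset.mem_range.1 hv) (Finset.mem_range.1 hv') h
  · intro n _
    obtain ⟨v, hv, q, h⟩ := residue_exists hk n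
    exact ⟨v, Finset.mem_range.2 hv, q, h⟩
  · intro v _
    have him : 0 < ((w + v) / k).im := by
      rw [Complex.div_natCast_im]
      simp only [Complex.add_im, Complex.natCast_im, add_zero]
      positivity
    refine ((hasSum_lipschitz hs him).mul_left (B v * (k : ℂ) ^ (-s))).congr_fun fun q => ?_
    have hper : B (v + k * q) = B v := by
      have := hB.int_mul q v
      rwa [mul_comm] at this
    have hsplit : w + ((v + k * q : ℤ) : ℂ) = k * ((w + v) / k + q) := by
      push_cast
      field_simp
      ring
    rw [hper, hsplit, natCast_mul_cpow hk]
    ring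

/-- The terms of the double series obtained from the rows above the real axis by Lipschitz's
formula: `x₀ + t` runs through the positive values of `m + r₁`, and `m₀ + t` through
the corresponding values of `m`. -/
noncomputable def fourierTerm (k : ℕ) (z s : ℂ) (A B : ℤ → ℂ) (r₂ : ℝ) (m₀ : ℤ) (x₀ : ℝ)
    (p : ℕ × ℕ) : ℂ :=
  ∑ v ∈ Finset.range k, A (m₀ + p.1) * B v * (((p.2 : ℂ) + 1) ^ (s - 1) *
    Complex.exp (2 * Real.pi * Complex.I * ((((x₀ + p.1 : ℝ) : ℂ) * z + r₂ + v) / k) *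
      ((p.2 : ℂ) + 1)))

/-- A summable bound for `fourierTerm`, uniform in vertical half-planes `Re s ≤ K + 1`. -/
lemma exists_fourierTerm_bound {k : ℕ} (hk : 0 < k) {A B : ℤ → ℂ}
    (hA : Function.Periodic A (k : ℤ)) (hB : Function.Periodic B (k : ℤ)) {z : ℂ} (hz : 0 < z.im)
    (r₂ : ℝ) (m₀ : ℤ) {x₀ : ℝ} (hx₀ : 0 < x₀) (K : ℕ) :
    ∃ u : ℕ × ℕ → ℝ, Summable u ∧ ∀ s : ℂ, s.re ≤ K + 1 → ∀ p,
      ‖fourierTerm k z s A B r₂ m₀ x₀ p‖ ≤ u p := by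
  obtain ⟨CA, hCA0, hCA⟩ := exists_norm_le_of_periodic hk hA
  obtain ⟨CB, hCB0, hCB⟩ := exists_norm_le_of_periodic hk hB
  have hk0 : (0 : ℝ) < k := by exact_mod_cast hk
  set c : ℝ := 2 * Real.pi * z.im / k with hc
  have hc0 : 0 < c := by positivity
  have h1 : Summable fun t : ℕ => Real.exp (-c * t) := by
    simpa using Real.summable_pow_mul_exp_neg_nat_mul 0 hc0
  have h2 : Summable fun l : ℕ => ((l : ℝ) + 1) ^ K * Real.exp (-(c * x₀) * (l + 1)) := by
    have := (summable_nat_add_iff 1).2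
      (Real.summable_pow_mul_exp_neg_nat_mul K (r := c * x₀) (by positivity))
    simpa using this
  refine ⟨fun p => (k * (CA * CB)) * (Real.exp (-c * p.1) *
    (((p.2 : ℝ) + 1) ^ K * Real.exp (-(c * x₀) * (p.2 + 1)))), ?_, ?_⟩
  · exact (h1.mul_of_nonneg h2 (fun _ => by positivity) (fun _ => by positivity)).mul_left _
  · rintro s hs ⟨t, l⟩
    simp only
    refine (norm_sum_le _ _).trans ?_
    have : ∀ v ∈ Finset.range k, ‖A (m₀ + t) * B v * (((l : ℂ) + 1) ^ (s - 1) *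
        Complex.exp (2 * Real.pi * Complex.I * ((((x₀ + t : ℝ) : ℂ) * z + r₂ + v) / k) *
          ((l : ℂ) + 1)))‖ ≤ (CA * CB) * (Real.exp (-c * t) *
        (((l : ℝ) + 1) ^ K * Real.exp (-(c * x₀) * (l + 1)))) := by
      intro v _
      have hl : (1 : ℝ) ≤ (l : ℝ) + 1 := by linarith [l.cast_nonneg (α := ℝ)]
      have hl0 : (0 : ℝ) ≤ l := l.cast_nonneg
      have ht0 : (0 : ℝ) ≤ t := t.cast_nonneg
      have hpow : ‖((l : ℂ) + 1) ^ (s - 1)‖ ≤ ((l : ℝ) + 1) ^ K := by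
        have hcast : ((l : ℂ) + 1) = (((l : ℝ) + 1 : ℝ) : ℂ) := by push_cast; rfl
        rw [hcast, Complex.norm_cpow_eq_rpow_re_of_pos (by linarith), ← Real.rpow_natCast]
        refine Real.rpow_le_rpow_of_exponent_le hl ?_
        simp only [Complex.sub_re, Complex.one_re]
        linarith
      have hexp : ‖Complex.exp (2 * Real.pi * Complex.I *
          ((((x₀ + t : ℝ) : ℂ) * z + r₂ + v) / k) * ((l : ℂ) + 1))‖ ≤
          Real.exp (-c * t) * Real.exp (-(c * x₀) * (l + 1)) := by
        rw [Complex.norm_exp, ← Real.exp_add]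
        refine Real.exp_le_exp.2 ?_
        have hre : (2 * Real.pi * Complex.I *
            ((((x₀ + t : ℝ) : ℂ) * z + r₂ + v) / k) * ((l : ℂ) + 1)).re =
            -(c * ((x₀ + t) * (l + 1))) := by
          have h3 : 2 * Real.pi * Complex.I *
              ((((x₀ + t : ℝ) : ℂ) * z + r₂ + v) / k) * ((l : ℂ) + 1) =
              ((2 * Real.pi / k * (l + 1) : ℝ) : ℂ) *
                (Complex.I * (((x₀ + t : ℝ) : ℂ) * z + ((r₂ + v : ℝ) : ℂ))) := by
            push_cast
            ring
          rw [h3, Complex.re_ofReal_mul, Complex.I_mul_re, Complex.add_im, Complex.im_ofReal_mul,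
            Complex.ofReal_im, hc]
          ring
        rw [hre]
        have h4 : c * (x₀ * (l + 1) + t) ≤ c * ((x₀ + t) * (l + 1)) := by
          refine mul_le_mul_of_nonneg_left ?_ hc0.le
          nlinarith
        linarith
      rw [norm_mul, norm_mul, norm_mul]
      calc _ ≤ CA * CB * (((l : ℝ) + 1) ^ K *
            (Real.exp (-c * t) * Real.exp (-(c * x₀) * (l + 1)))) := by
            gcongr
            · exact hCA _
            · exact hCB _
        _ = _ := by ring
    refine (Finset.sum_le_sum this).trans_eq ?_
    rw [Finset.sum_const, Finset.card_range, nsmul_eq_mul]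
    ring

lemma summable_fourierTerm {k : ℕ} (hk : 0 < k) {A B : ℤ → ℂ}
    (hA : Function.Periodic A (k : ℤ)) (hB : Function.Periodic B (k : ℤ)) {z : ℂ} (hz : 0 < z.im)
    (r₂ : ℝ) (m₀ : ℤ) {x₀ : ℝ} (hx₀ : 0 < x₀) (s : ℂ) :
    Summable (fourierTerm k z s A B r₂ m₀ x₀) := by
  obtain ⟨K, hK⟩ := exists_nat_ge s.re
  obtain ⟨u, hu, hle⟩ := exists_fourierTerm_bound hk hA hB hz r₂ m₀ hx₀ K
  exact Summable.of_norm_bounded hu (hle s (by linarith))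

lemma summable_lipschitz (s : ℂ) {w : ℂ} (hw : 0 < w.im) :
    Summable fun l : ℕ => ((l : ℂ) + 1) ^ (s - 1) *
      Complex.exp (2 * Real.pi * Complex.I * w * (l + 1)) := by
  have h := (summable_fourierTerm one_pos (A := fun _ => 1) (B := fun _ => 1) (fun _ => rfl)
    (fun _ => rfl) hw 0 0 one_pos s).prod_factor 0
  simpa [fourierTerm] using h

lemma differentiable_tsum_fourierTerm {k : ℕ} (hk : 0 < k) {A B : ℤ → ℂ}
    (hA : Function.Periodic A (k : ℤ)) (hB : Function.Periodic B (k : ℤ)) {z : ℂ} (hz : 0 < z.im)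
    (r₂ : ℝ) (m₀ : ℤ) {x₀ : ℝ} (hx₀ : 0 < x₀) :
    Differentiable ℂ (fun s => ∑' p, fourierTerm k z s A B r₂ m₀ x₀ p) := by
  intro s
  obtain ⟨K, hK⟩ := exists_nat_gt s.re
  obtain ⟨u, hu, hle⟩ := exists_fourierTerm_bound hk hA hB hz r₂ m₀ hx₀ K
  have hopen : IsOpen {w : ℂ | w.re < K} := isOpen_lt Complex.continuous_re continuous_const
  refine (differentiableOn_tsum_of_summable_norm hu (fun p => ?_) hopen
    (fun p w hw => hle w (le_of_lt (lt_trans hw (lt_add_one _))) p)).differentiableAt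
    (hopen.mem_nhds hK)
  refine Differentiable.differentiableOn ?_
  unfold fourierTerm
  refine Differentiable.fun_sum fun v _ => ?_
  refine Differentiable.const_mul (Differentiable.mul_const ?_ _) _
  intro w
  refine (differentiableAt_id.sub_const 1).const_cpow (Or.inl ?_)
  exact_mod_cast Nat.succ_ne_zero p.2

/-- The sum of the terms above the real axis continues to an entire function: Lipschitz's formula
turns it into a double series that converges for every `s`. -/
lemma exists_entire_positiveRows {k : ℕ} (hk : 0 < k) {A B : ℤ → ℂ}
    (hA : Function.Periodic A (k : ℤ)) (hB : Function.Periodic B (k : ℤ)) {z : ℂ} (hz : 0 < z.im)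
    (r₁ r₂ : ℝ) : ∃ g : ℂ → ℂ, Differentiable ℂ g ∧ ∀ s : ℂ, 2 < s.re →
      HasSum (partialTerm (positiveRows r₁) z s A B r₁ r₂) (g s) := by
  have hkc : (k : ℂ) ≠ 0 := by exact_mod_cast hk.ne'
  set m₀ : ℤ := ⌊-r₁⌋ + 1 with hm₀
  set x₀ : ℝ := m₀ + r₁ with hx
  have hx₀ : 0 < x₀ := by
    have := Int.lt_floor_add_one (-r₁)
    rw [hx, hm₀]; push_cast; linarith
  refine ⟨fun s => ((k : ℂ) ^ (-s) * lipschitzFactor s) *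
    ∑' p, fourierTerm k z s A B r₂ m₀ x₀ p, ?_, ?_⟩
  · refine (Differentiable.mul ?_ differentiable_lipschitzFactor).mul
      (differentiable_tsum_fourierTerm hk hA hB hz r₂ m₀ hx₀)
    exact fun s => (differentiableAt_id.neg).const_cpow (Or.inl hkc)
  · intro s hs
    have hsum := summable_partialTerm hk hA hB hz hs
      (S := positiveRows r₁) (r₁ := r₁) (r₂ := r₂) Set.subset_union_left
    have hfs := summable_fourierTerm hk hA hB hz r₂ m₀ hx₀ s
    have hinj : Function.Injective (fun t : ℕ => m₀ + (t : ℤ)) := fun a b h => by simpa using h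
    have hrow : ∀ m : ℤ, HasSum (fun n => partialTerm (positiveRows r₁) z s A B r₁ r₂ (m, n))
        (∑' n, partialTerm (positiveRows r₁) z s A B r₁ r₂ (m, n)) := fun m =>
      (hsum.prod_factor m).hasSum
    have h1 := hsum.hasSum.prod_fiberwise hrow
    have h2 := (hinj.hasSum_iff (fun m hm => ?_)).2 h1
    · have h3 := hfs.hasSum.prod_fiberwise (fun t => (hfs.prod_factor t).hasSum)
      have h4 := h3.mul_left ((k : ℂ) ^ (-s) * lipschitzFactor s)
      have h5 : ∀ t : ℕ, ∑' n, partialTerm (positiveRows r₁) z s A B r₁ r₂ (m₀ + (t : ℤ), n) =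
          ((k : ℂ) ^ (-s) * lipschitzFactor s) *
            ∑' l, fourierTerm k z s A B r₂ m₀ x₀ (t, l) := by
        intro t
        have hxt : 0 < x₀ + t := by positivity
        have hmem : ∀ n : ℤ, ((m₀ + (t : ℤ), n) : ℤ × ℤ) ∈ positiveRows r₁ := fun n => by
          simp only [positiveRows, Set.mem_ofPred_eq]
          push_cast
          linarith
        have him : 0 < ((((x₀ + t : ℝ) : ℂ) * z + r₂)).im := by
          simp only [Complex.add_im, Complex.im_ofReal_mul, Complex.ofReal_im, add_zero]
          positivity
        have h6 := (hasSum_horizontalLine hk hB (by linarith : 1 < s.re) him).mul_left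
          (A (m₀ + t))
        have h7 : (fun n => partialTerm (positiveRows r₁) z s A B r₁ r₂ (m₀ + (t : ℤ), n)) =
            fun n : ℤ => A (m₀ + t) * (B n * (((x₀ + t : ℝ) : ℂ) * z + r₂ + n) ^ (-s)) := by
          funext n
          rw [partialTerm_of_mem (hmem n)]
          have : latticePoint z r₁ r₂ (m₀ + (t : ℤ), n) = ((x₀ + t : ℝ) : ℂ) * z + r₂ + n := by
            simp only [latticePoint, hx]
            push_cast
            ring
          rw [this]
          ring
        rw [h7, h6.tsum_eq]
        simp only [fourierTerm]
        rw [Summable.tsum_finsetSum, Finset.mul_sum, Finset.mul_sum]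
        · refine Finset.sum_congr rfl fun v _ => ?_
          rw [tsum_mul_left]
          ring
        · intro v _
          refine Summable.mul_left _ (summable_lipschitz s ?_)
          rw [Complex.div_natCast_im]
          simp only [Complex.add_im, Complex.natCast_im, add_zero] at him ⊢
          positivity
      have h6 := h4.congr_fun (fun t => (h5 t))
      exact hsum.hasSum_iff.2 (h6.unique h2).symm
    · have hm0 : ¬ 0 < (m : ℝ) + r₁ := by
        intro h
        have h3 : m₀ ≤ m := by
          rw [hm₀]
          exact Int.add_one_le_iff.2 (by rw [Int.floor_lt]; linarith)
        exact hm ⟨(m - m₀).toNat, by simp only; omega⟩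
      refine (tsum_congr fun n => ?_).trans tsum_zero
      exact partialTerm_of_notMem hm0 _ _ _ _ _ _

/-- The Eisenstein series of periodic sequences continues analytically to `ℂ ∖ {1}`. -/
theorem exists_isEisensteinContinuation {k : ℕ} (hk : 0 < k) {A B : ℤ → ℂ}
    (hA : Function.Periodic A (k : ℤ)) (hB : Function.Periodic B (k : ℤ)) {z : ℂ} (hz : 0 < z.im)
    (r₁ r₂ : ℝ) : ∃ g, IsEisensteinContinuation z A B r₁ r₂ g := by
  have half : ∀ (A B : ℤ → ℂ), Function.Periodic A (k : ℤ) → Function.Periodic B (k : ℤ) →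
      ∀ r₁ r₂ : ℝ, ∃ g : ℂ → ℂ, DifferentiableOn ℂ g {1}ᶜ ∧ ∀ s : ℂ, 2 < s.re →
        HasSum (partialTerm (positiveRows r₁ ∪ positiveRay r₁ r₂) z s A B r₁ r₂) (g s) := by
    intro A B hA hB r₁ r₂
    obtain ⟨g, hg, hsum⟩ := exists_entire_positiveRows hk hA hB hz r₁ r₂
    refine ⟨fun s => g s + A ⌊-r₁⌋ * intChar (-r₁) * L s B r₂, ?_, fun s hs => ?_⟩
    · exact hg.differentiableOn.add ((isLContinuation_L hk hB r₂).1.const_mul _)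
    · have h1 := hasSum_positiveRay hk (A := A) hB z (-r₁) r₂ (s := s) (by linarith)
      rw [neg_neg] at h1
      exact ((hsum s hs).add h1).congr_fun
        fun p => partialTerm_union (disjoint_positiveRows_positiveRay r₁ r₂) _ _ _ _ _ _ _
  obtain ⟨g₁, hg₁, hs₁⟩ := half A B hA hB r₁ r₂
  obtain ⟨g₂, hg₂, hs₂⟩ := half (fun n => A (-n)) (fun n => B (-n)) (periodic_comp_neg hA)
    (periodic_comp_neg hB)
    (-r₁) (-r₂)
  refine ⟨fun s => g₁ s + Complex.exp (Real.pi * Complex.I * s) * g₂ s, ?_, fun s hs => ?_⟩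
  · refine hg₁.add (DifferentiableOn.mul ?_ hg₂)
    fun_prop
  · have h2 := ((Equiv.neg (ℤ × ℤ)).hasSum_iff.2 (hs₂ s hs)).mul_left
      (Complex.exp (Real.pi * Complex.I * s))
    exact ((hs₁ s hs).add h2).congr_fun fun p => eisensteinTerm_eq hz s A B r₁ r₂ p

theorem isEisensteinContinuation_G {k : ℕ} (hk : 0 < k) {A B : ℤ → ℂ}
    (hA : Function.Periodic A (k : ℤ)) (hB : Function.Periodic B (k : ℤ)) {z : ℂ} (hz : 0 < z.im)
    (r₁ r₂ : ℝ) : IsEisensteinContinuation z A B r₁ r₂ (fun s => G z s A B r₁ r₂) :=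
  Classical.epsilon_spec (exists_isEisensteinContinuation hk hA hB hz r₁ r₂)

/-! ### Loop integrals -/

/-- The closed half-strip bounded by the loop with parameters `δ, ε`. -/
def halfStrip (δ ε : ℝ) : Set ℂ := {u | -δ ≤ u.re ∧ |u.im| ≤ ε}

/-- The logarithm in the branch `0 < arg u < 2π`. -/
noncomputable def loopLog (u : ℂ) : ℂ := Complex.log (-u) + (Real.pi : ℂ) * Complex.I

lemma loopPow_eq_exp (u s : ℂ) : loopPow u s = Complex.exp (s * loopLog u) := rfl

lemma norm_loopLog_le (u : ℂ) : ‖loopLog u‖ ≤ |Real.log ‖u‖| + 2 * Real.pi := by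
  refine (Complex.norm_le_abs_re_add_abs_im _).trans (add_le_add ?_ ?_)
  · simp [loopLog, Complex.log_re]
  · have h1 := Complex.neg_pi_lt_arg (-u)
    have h2 := Complex.arg_le_pi (-u)
    rw [abs_le]
    simp only [loopLog, Complex.add_im, Complex.log_im, Complex.mul_im, Complex.ofReal_re,
      Complex.I_im, Complex.ofReal_im, Complex.I_re]
    constructor <;> linarith

lemma continuousAt_loopLog {u : ℂ} (h : -u ∈ Complex.slitPlane) : ContinuousAt loopLog u :=
  (continuousAt_id.neg.clog h).add continuousAt_const

/-- What the collapse of the loop onto the half-line needs of the kernel `H`: it is holomorphic in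
the half-strip apart from a pole of order at most two at the origin, and it decays
exponentially. -/
structure IsLoopKernel (δ ε : ℝ) (H : ℂ → ℂ) : Prop where
  differentiableAt : ∀ u ∈ halfStrip δ ε, u ≠ 0 → DifferentiableAt ℂ H u
  decay : ∃ C b x₀ : ℝ, 0 < b ∧ ∀ u ∈ halfStrip δ ε, x₀ ≤ u.re → ‖H u‖ ≤ C * Real.exp (-b * u.re)
  pole : ∃ C : ℝ, ∀ᶠ u in 𝓝[≠] (0 : ℂ), ‖u ^ 2 * H u‖ ≤ C

/-- Powers of `u` do not spoil the exponential decay of a kernel. -/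
lemma IsLoopKernel.decay_exp_log {δ ε : ℝ} {H : ℂ → ℂ} (hH : IsLoopKernel δ ε H)
    (R : ℝ) : ∃ C b x₀ : ℝ, 0 < b ∧ 1 ≤ x₀ ∧ ∀ u ∈ halfStrip δ ε, x₀ ≤ u.re →
      Real.exp (R * (|Real.log ‖u‖| + 2 * Real.pi)) * ‖H u‖ ≤ C * Real.exp (-b * u.re) := by
  obtain ⟨C, b, x₀, hb, hle⟩ := hH.decay
  set R' : ℝ := |R| + 1 with hR'
  have hR'0 : 0 < R' := by positivity
  set c : ℝ := b / (2 * R') with hc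
  have hc0 : 0 < c := by positivity
  have hlog : ∀ᶠ y : ℝ in atTop, Real.log y ≤ c * y := by
    filter_upwards [Real.isLittleO_log_id_atTop.bound hc0, eventually_ge_atTop (0 : ℝ)] with y hy hy0
    simp only [id, Real.norm_eq_abs, abs_of_nonneg hy0] at hy
    exact (le_abs_self _).trans hy
  obtain ⟨y₀, hy₀⟩ := eventually_atTop.1 hlog
  refine ⟨Real.exp (R' * (c * ε + 2 * Real.pi)) * C, b / 2, max (max x₀ 1) y₀, by positivity,
    (le_max_right _ _).trans (le_max_left _ _), fun u hu hx => ?_⟩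
  have hx₀ : x₀ ≤ u.re := ((le_max_left _ _).trans (le_max_left _ _)).trans hx
  have hx1 : 1 ≤ u.re := ((le_max_right _ _).trans (le_max_left _ _)).trans hx
  have hxy : y₀ ≤ u.re := (le_max_right _ _).trans hx
  have hε : 0 ≤ ε := (abs_nonneg _).trans hu.2
  have hn1 : 1 ≤ ‖u‖ := hx1.trans ((le_abs_self _).trans (Complex.abs_re_le_norm u))
  have hn2 : ‖u‖ ≤ u.re + ε := by
    refine (Complex.norm_le_abs_re_add_abs_im u).trans ?_
    rw [abs_of_nonneg (by linarith : (0 : ℝ) ≤ u.re)]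
    linarith [hu.2]
  have hl : |Real.log ‖u‖| ≤ c * (u.re + ε) := by
    rw [abs_of_nonneg (Real.log_nonneg hn1)]
    exact (Real.log_le_log (by linarith) hn2).trans (hy₀ _ (by linarith))
  have hexp : Real.exp (R * (|Real.log ‖u‖| + 2 * Real.pi)) ≤
      Real.exp (R' * (c * ε + 2 * Real.pi)) * Real.exp (b / 2 * u.re) := by
    rw [← Real.exp_add]
    refine Real.exp_le_exp.2 ?_
    have h1 : R * (|Real.log ‖u‖| + 2 * Real.pi) ≤ R' * (c * (u.re + ε) + 2 * Real.pi) := by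
      refine mul_le_mul ?_ (by linarith) (by positivity) hR'0.le
      linarith [le_abs_self R]
    have h2 : R' * c = b / 2 := by rw [hc]; field_simp
    calc _ ≤ _ := h1
      _ = R' * (c * ε + 2 * Real.pi) + R' * c * u.re := by ring
      _ = _ := by rw [h2]
  calc _ ≤ (Real.exp (R' * (c * ε + 2 * Real.pi)) * Real.exp (b / 2 * u.re)) *
        (C * Real.exp (-b * u.re)) := mul_le_mul hexp (hle u hu hx₀) (norm_nonneg _) (by positivity)
    _ = Real.exp (R' * (c * ε + 2 * Real.pi)) * C *
        (Real.exp (b / 2 * u.re) * Real.exp (-b * u.re)) := by ring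
    _ = _ := by rw [← Real.exp_add]; congr 2; ring

lemma integrableOn_of_exp_bound {f : ℝ → ℂ} {a C b x₀ : ℝ} (hb : 0 < b)
    (hf : ContinuousOn f (Set.Ici a)) (hle : ∀ x, a ≤ x → x₀ ≤ x → ‖f x‖ ≤ C * Real.exp (-b * x)) :
    IntegrableOn f (Set.Ioi a) := by
  have h1 : IntegrableOn (fun x => ‖f x‖) (Set.Ioi a) := by
    refine integrable_of_isBigO_exp_neg hb hf.norm (Asymptotics.IsBigO.of_bound C ?_)
    filter_upwards [eventually_ge_atTop a, eventually_ge_atTop x₀] with x ha hx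
    rw [norm_norm, Real.norm_of_nonneg (Real.exp_pos _).le]
    exact hle x ha hx
  exact (integrable_norm_iff ((hf.mono Set.Ioi_subset_Ici_self).aestronglyMeasurable
    measurableSet_Ioi)).1 h1

lemma continuousOn_line {F : ℂ → ℂ} {S : Set ℝ} {y : ℝ}
    (h : ∀ x ∈ S, ContinuousAt F ((x : ℂ) + (y : ℂ) * Complex.I)) :
    ContinuousOn (fun x : ℝ => F ((x : ℂ) + (y : ℂ) * Complex.I)) S := fun x hx =>
  (ContinuousAt.comp (f := fun x : ℝ => (x : ℂ) + (y : ℂ) * Complex.I) (h x hx)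
    (by fun_prop)).continuousWithinAt

lemma continuousOn_segment {F : ℂ → ℂ} {S : Set ℝ} {w : ℂ}
    (h : ∀ y ∈ S, ContinuousAt F (w + (y : ℂ) * Complex.I)) :
    ContinuousOn (fun y : ℝ => F (w + (y : ℂ) * Complex.I)) S := fun y hy =>
  (ContinuousAt.comp (f := fun y : ℝ => w + (y : ℂ) * Complex.I) (h y hy)
    (by fun_prop)).continuousWithinAt

lemma line_mem_halfStrip {δ ε x y : ℝ} (hx : -δ ≤ x) (hy : |y| ≤ ε) :
    (x : ℂ) + (y : ℂ) * Complex.I ∈ halfStrip δ ε := by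
  constructor <;> simpa

/-- The kernel times an exponential of `‖loopLog‖`, integrated along a horizontal side. -/
lemma IsLoopKernel.integrableOn_line {δ ε : ℝ} {H : ℂ → ℂ} (hH : IsLoopKernel δ ε H) {y : ℝ}
    (hy : |y| ≤ ε) (hy0 : y ≠ 0) (R : ℝ) :
    IntegrableOn (fun x : ℝ => Real.exp (R * ‖loopLog ((x : ℂ) + (y : ℂ) * Complex.I)‖) *
      ‖H ((x : ℂ) + (y : ℂ) * Complex.I)‖) (Set.Ioi (-δ)) := by
  obtain ⟨C, b, x₀, hb, -, hle⟩ := hH.decay_exp_log |R|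
  have hne : ∀ x : ℝ, (x : ℂ) + (y : ℂ) * Complex.I ≠ 0 := fun x h => hy0 (by
    simpa using congrArg Complex.im h)
  have hcl : ContinuousOn (fun x : ℝ => loopLog ((x : ℂ) + (y : ℂ) * Complex.I)) (Set.Ici (-δ)) :=
    continuousOn_line fun x _ => continuousAt_loopLog (Or.inr (by simpa using hy0))
  have hcH : ContinuousOn (fun x : ℝ => H ((x : ℂ) + (y : ℂ) * Complex.I)) (Set.Ici (-δ)) :=
    continuousOn_line fun x hx =>
      (hH.differentiableAt _ (line_mem_halfStrip hx hy) (hne x)).continuousAt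
  refine integrable_of_isBigO_exp_neg hb ?_ (Asymptotics.IsBigO.of_bound C ?_)
  · exact (Real.continuous_exp.comp_continuousOn (hcl.norm.const_mul R)).mul hcH.norm
  · filter_upwards [eventually_ge_atTop (-δ), eventually_ge_atTop x₀] with x ha hx
    rw [Real.norm_of_nonneg (by positivity), Real.norm_of_nonneg (Real.exp_pos _).le]
    have h1 := hle _ (line_mem_halfStrip ha hy) (by simpa using hx)
    have h2 : Real.exp (R * ‖loopLog ((x : ℂ) + (y : ℂ) * Complex.I)‖) ≤
        Real.exp (|R| * (|Real.log ‖(x : ℂ) + (y : ℂ) * Complex.I‖| + 2 * Real.pi)) := by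
      refine Real.exp_le_exp.2 (mul_le_mul (le_abs_self R) (norm_loopLog_le _) (norm_nonneg _)
        (abs_nonneg R))
    refine (mul_le_mul_of_nonneg_right h2 (norm_nonneg _)).trans (h1.trans_eq ?_)
    simp

/-- Integrability along a path against all exponentials of `‖loopLog‖` gives both convergence and
holomorphy in `s` of the integral of `u ^ (s - 1) H`. -/
lemma integrable_and_differentiable_of_path {μ : Measure ℝ} {γ : ℝ → ℂ} {H : ℂ → ℂ}
    (hl : AEStronglyMeasurable (fun x => loopLog (γ x)) μ)
    (hh : AEStronglyMeasurable (fun x => H (γ x)) μ)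
    (hint : ∀ R : ℝ, Integrable (fun x => Real.exp (R * ‖loopLog (γ x)‖) * ‖H (γ x)‖) μ) :
    (∀ s : ℂ, Integrable (fun x => loopPow (γ x) (s - 1) * H (γ x)) μ) ∧
      Differentiable ℂ (fun s : ℂ => ∫ x, loopPow (γ x) (s - 1) * H (γ x) ∂μ) := by
  constructor
  · intro s
    refine (hint ‖s - 1‖).mono'
      ((Complex.continuous_exp.comp_aestronglyMeasurable (hl.const_mul _)).mul hh)
      (Eventually.of_forall fun x => ?_)
    rw [norm_mul, loopPow_eq_exp, Complex.norm_exp]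
    refine mul_le_mul_of_nonneg_right (Real.exp_le_exp.2 ?_) (norm_nonneg _)
    exact (Complex.re_le_norm _).trans (norm_mul _ _).le
  · exact (differentiable_integral_exp_mul hl hh hint).comp (differentiable_id.sub_const 1)

section Kernel

variable {δ ε : ℝ} {H : ℂ → ℂ}

lemma IsLoopKernel.line (hH : IsLoopKernel δ ε H) {y : ℝ} (hy : |y| ≤ ε) (hy0 : y ≠ 0) :
    (∀ s : ℂ, IntegrableOn (fun x : ℝ => loopPow ((x : ℂ) + (y : ℂ) * Complex.I) (s - 1) *
      H ((x : ℂ) + (y : ℂ) * Complex.I)) (Set.Ioi (-δ))) ∧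
    Differentiable ℂ (fun s : ℂ => ∫ x : ℝ in Set.Ioi (-δ),
      loopPow ((x : ℂ) + (y : ℂ) * Complex.I) (s - 1) * H ((x : ℂ) + (y : ℂ) * Complex.I)) := by
  have hne : ∀ x : ℝ, (x : ℂ) + (y : ℂ) * Complex.I ≠ 0 := fun x h => hy0 (by
    simpa using congrArg Complex.im h)
  refine integrable_and_differentiable_of_path (γ := fun x : ℝ => (x : ℂ) + (y : ℂ) * Complex.I)
    ?_ ?_ (hH.integrableOn_line hy hy0)
  · exact ContinuousOn.aestronglyMeasurable (continuousOn_line fun x _ =>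
      continuousAt_loopLog (Or.inr (by simpa using hy0))) measurableSet_Ioi
  · exact ContinuousOn.aestronglyMeasurable (continuousOn_line fun x hx =>
      (hH.differentiableAt _ (line_mem_halfStrip (le_of_lt hx) hy) (hne x)).continuousAt)
      measurableSet_Ioi

lemma IsLoopKernel.segment (hH : IsLoopKernel δ ε H) (hδ : 0 < δ) :
    (∀ s : ℂ, IntegrableOn (fun y : ℝ => loopPow (-(δ : ℂ) + (y : ℂ) * Complex.I) (s - 1) *
      H (-(δ : ℂ) + (y : ℂ) * Complex.I)) (Set.Ioc (-ε) ε)) ∧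
    Differentiable ℂ (fun s : ℂ => ∫ y : ℝ in Set.Ioc (-ε) ε,
      loopPow (-(δ : ℂ) + (y : ℂ) * Complex.I) (s - 1) *
        H (-(δ : ℂ) + (y : ℂ) * Complex.I)) := by
  have hne : ∀ y : ℝ, -(δ : ℂ) + (y : ℂ) * Complex.I ≠ 0 := fun y h => by
    have := congrArg Complex.re h
    simp at this
    exact hδ.ne' this
  have hcl : ContinuousOn (fun y : ℝ => loopLog (-(δ : ℂ) + (y : ℂ) * Complex.I))
      (Set.Icc (-ε) ε) :=
    continuousOn_segment fun y _ => continuousAt_loopLog (Or.inl (by simpa using hδ))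
  have hcH : ContinuousOn (fun y : ℝ => H (-(δ : ℂ) + (y : ℂ) * Complex.I)) (Set.Icc (-ε) ε) :=
    continuousOn_segment fun y hy => (hH.differentiableAt _
      ⟨by simp, by simpa using abs_le.2 hy⟩ (hne y)).continuousAt
  refine integrable_and_differentiable_of_path
    (γ := fun y : ℝ => -(δ : ℂ) + (y : ℂ) * Complex.I) ?_ ?_ fun R => ?_
  · exact (hcl.mono Set.Ioc_subset_Icc_self).aestronglyMeasurable measurableSet_Ioc
  · exact (hcH.mono Set.Ioc_subset_Icc_self).aestronglyMeasurable measurableSet_Ioc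
  · refine IntegrableOn.mono_set ?_ Set.Ioc_subset_Icc_self
    exact ((Real.continuous_exp.comp_continuousOn (hcl.norm.const_mul R)).mul
      hcH.norm).integrableOn_Icc

theorem IsLoopKernel.loopIntegrable (hH : IsLoopKernel δ ε H) (hδ : 0 < δ) (hε : 0 < ε) (s : ℂ) :
    LoopIntegrable δ ε (fun u => loopPow u (s - 1) * H u) := by
  refine ⟨(hH.line (abs_of_pos hε).le hε.ne').1 s, ?_, ?_⟩
  · rw [intervalIntegrable_iff_integrableOn_Ioc_of_le (by linarith)]
    exact (hH.segment hδ).1 s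
  · have := (hH.line (y := -ε) (by rw [abs_neg, abs_of_pos hε]) (by linarith)).1 s
    simpa [← sub_eq_add_neg] using this

theorem IsLoopKernel.differentiable_loopIntegral (hH : IsLoopKernel δ ε H) (hδ : 0 < δ)
    (hε : 0 < ε) :
    Differentiable ℂ (fun s => loopIntegral δ ε (fun u => loopPow u (s - 1) * H u)) := by
  have h1 := (hH.line (abs_of_pos hε).le hε.ne').2
  have h2 := (hH.segment hδ).2
  have h3 := (hH.line (y := -ε) (by rw [abs_neg, abs_of_pos hε]) (by linarith)).2
  simp only [Complex.ofReal_neg, neg_mul, ← sub_eq_add_neg] at h3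
  unfold loopIntegral
  simp only [intervalIntegral.integral_of_le (by linarith : -ε ≤ ε)]
  exact (h1.neg.sub (h2.const_mul _)).add h3

/-- Cauchy's theorem for a half-strip that extends to `+∞`. -/
lemma halfStrip_cauchy {F : ℂ → ℂ} {a p q C b x₀ : ℝ} (hpq : p ≤ q) (hb : 0 < b)
    (hc : ContinuousOn F (Set.Ici a ×ℂ Set.Icc p q))
    (hd : DifferentiableOn ℂ F (Set.Ioi a ×ℂ Set.Ioo p q))
    (hle : ∀ u ∈ Set.Ici a ×ℂ Set.Icc p q, x₀ ≤ u.re → ‖F u‖ ≤ C * Real.exp (-b * u.re)) :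
    IntegrableOn (fun x : ℝ => F (x + p * Complex.I)) (Set.Ioi a) ∧
    IntegrableOn (fun x : ℝ => F (x + q * Complex.I)) (Set.Ioi a) ∧
    (∫ x : ℝ in Set.Ioi a, F (x + p * Complex.I)) - (∫ x : ℝ in Set.Ioi a, F (x + q * Complex.I))
      - Complex.I * ∫ y : ℝ in p..q, F (a + y * Complex.I) = 0 := by
  have hmem : ∀ x y : ℝ, a ≤ x → p ≤ y → y ≤ q →
      (x : ℂ) + (y : ℂ) * Complex.I ∈ Set.Ici a ×ℂ Set.Icc p q := fun x y h1 h2 h3 => by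
    rw [Complex.mem_reProdIm]
    simpa using ⟨h1, h2, h3⟩
  have hline : ∀ y : ℝ, p ≤ y → y ≤ q →
      IntegrableOn (fun x : ℝ => F (x + y * Complex.I)) (Set.Ioi a) := by
    intro y h1 h2
    refine integrableOn_of_exp_bound (C := C) (x₀ := x₀) hb ?_ ?_
    · exact hc.comp (by fun_prop) fun x hx => hmem x y hx h1 h2
    · intro x hx hx'
      simpa using hle _ (hmem x y hx h1 h2) (by simpa using hx')
  refine ⟨hline p le_rfl hpq, hline q hpq le_rfl, ?_⟩
  have t1 := intervalIntegral_tendsto_integral_Ioi a (hline p le_rfl hpq) tendsto_id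
  have t2 := intervalIntegral_tendsto_integral_Ioi a (hline q hpq le_rfl) tendsto_id
  have t3 : Tendsto (fun X : ℝ => ∫ y : ℝ in p..q, F (X + y * Complex.I)) atTop (𝓝 0) := by
    have hz : Tendsto (fun X : ℝ => C * Real.exp (-b * X) * |q - p|) atTop (𝓝 0) := by
      have h1 : Tendsto (fun X : ℝ => -b * X) atTop atBot :=
        tendsto_id.const_mul_atTop_of_neg (by linarith)
      have := ((Real.tendsto_exp_atBot.comp h1).const_mul C).mul_const |q - p|
      simpa using this
    refine squeeze_zero_norm' ?_ hz
    filter_upwards [eventually_ge_atTop a, eventually_ge_atTop x₀] with X ha hX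
    refine intervalIntegral.norm_integral_le_of_norm_le_const fun y hy => ?_
    rw [Set.uIoc_of_le hpq] at hy
    simpa using hle _ (hmem X y ha hy.1.le hy.2) (by simpa using hX)
  have hlim := ((t1.sub t2).add (t3.const_mul Complex.I)).sub_const
    (Complex.I * ∫ y : ℝ in p..q, F (a + y * Complex.I))
  rw [mul_zero, add_zero] at hlim
  refine tendsto_nhds_unique hlim (tendsto_const_nhds.congr' ?_)
  filter_upwards [eventually_ge_atTop a] with X hX
  have := Complex.integral_boundary_rect_eq_zero_of_continuousOn_of_differentiableOn F
    ((a : ℂ) + p * Complex.I) ((X : ℂ) + q * Complex.I) (hc.mono ?_) (hd.mono ?_)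
  · simp only [Complex.add_re, Complex.ofReal_re, Complex.mul_re, Complex.I_re, mul_zero,
      Complex.ofReal_im, Complex.I_im, mul_one, sub_self, add_zero, Complex.add_im,
      Complex.mul_im, zero_add, smul_eq_mul] at this
    simpa using this.symm
  · simp only [Complex.add_re, Complex.ofReal_re, Complex.mul_re, Complex.I_re, mul_zero,
      Complex.ofReal_im, Complex.I_im, mul_one, sub_self, add_zero, Complex.add_im,
      Complex.mul_im, zero_add, Set.uIcc_of_le hX, Set.uIcc_of_le hpq]
    exact Complex.reProdIm_subset_iff.2 (Set.prod_mono Set.Icc_subset_Ici_self le_rfl)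
  · simp only [Complex.add_re, Complex.ofReal_re, Complex.mul_re, Complex.I_re, mul_zero,
      Complex.ofReal_im, Complex.I_im, mul_one, sub_self, add_zero, Complex.add_im,
      Complex.mul_im, zero_add, min_eq_left hX, max_eq_right hX, min_eq_left hpq, max_eq_right hpq]
    exact Complex.reProdIm_subset_iff.2 (Set.prod_mono Set.Ioo_subset_Ioi_self le_rfl)

end Kernel

/-! ### Collapsing the loop onto the half-line -/

/-- `loopLog u` is the only logarithm of `u` with imaginary part in `(0, 2π]`. -/
lemma eq_loopLog_of_exp_eq {u l : ℂ} (h : Complex.exp l = u)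
    (h1 : 0 < l.im) (h2 : l.im ≤ 2 * Real.pi) : l = loopLog u := by
  have h3 : (l - Real.pi * Complex.I).im = l.im - Real.pi := by simp
  have h4 : Complex.exp (l - Real.pi * Complex.I) = -u := by
    rw [Complex.exp_sub, h, Complex.exp_pi_mul_I]
    ring
  have h5 := Complex.log_exp (x := l - Real.pi * Complex.I) (by rw [h3]; linarith)
    (by rw [h3]; linarith)
  rw [h4] at h5
  rw [loopLog, h5]
  ring

/-- The function `u ^ (s - 1) H(u)` in the branch of the power that has its cut where `c u` is
negative, with `u = (c u) exp κ`. Unlike `loopPow` it is continuous up to the positive real axis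
from one side; for `Re s > 3` it vanishes at the origin. -/
noncomputable def turnedKernel (c κ s : ℂ) (H : ℂ → ℂ) (u : ℂ) : ℂ :=
  Complex.exp ((s - 1) * κ) * (c * u) ^ (s - 1) * H u

lemma turnedKernel_eq_exp {c u : ℂ} (κ s : ℂ) (H : ℂ → ℂ) (h : c * u ≠ 0) :
    turnedKernel c κ s H u = Complex.exp ((s - 1) * (Complex.log (c * u) + κ)) * H u := by
  rw [turnedKernel, Complex.cpow_def_of_ne_zero h, ← Complex.exp_add]
  congr 2
  ring

lemma turnedKernel_eq_loop {c κ u : ℂ} (s : ℂ) (H : ℂ → ℂ) (hc : c * Complex.exp κ = 1)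
    (hu : u ≠ 0) (h1 : 0 < (c * u).arg + κ.im) (h2 : (c * u).arg + κ.im ≤ 2 * Real.pi) :
    turnedKernel c κ s H u = loopPow u (s - 1) * H u := by
  have hc0 : c ≠ 0 := fun h => by simp [h] at hc
  have hcu : c * u ≠ 0 := mul_ne_zero hc0 hu
  rw [turnedKernel_eq_exp κ s H hcu, loopPow_eq_exp]
  congr 3
  refine eq_loopLog_of_exp_eq ?_ ?_ ?_
  · rw [Complex.exp_add, Complex.exp_log hcu]
    linear_combination u * hc
  · simpa [Complex.log_im] using h1
  · simpa [Complex.log_im] using h2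

lemma continuousAt_turnedKernel_zero {δ ε : ℝ} {H : ℂ → ℂ} (hH : IsLoopKernel δ ε H) {c : ℂ}
    (hc : c ≠ 0) (κ : ℂ) {s : ℂ} (hs : 3 < s.re) : ContinuousAt (turnedKernel c κ s H) 0 := by
  have hs1 : s - 1 ≠ 0 := fun h => by
    have := congrArg Complex.re h
    simp at this
    linarith
  rw [continuousAt_iff_punctured_nhds]
  have h0 : turnedKernel c κ s H 0 = 0 := by simp [turnedKernel, Complex.zero_cpow hs1]
  rw [h0]
  have hs3 : 0 < (s - 3).re := by simp; linarith
  have h1 : Tendsto (fun u : ℂ => (c * u) ^ (s - 3)) (𝓝[≠] 0) (𝓝 0) := by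
    have h2 : ContinuousAt (fun u : ℂ => (c * u) ^ (s - 3)) 0 := by
      have h3 : ContinuousAt (fun x : ℂ => x ^ (s - 3)) (c * 0) :=
        Complex.continuousAt_cpow_const_of_re_pos (by simp) hs3
      exact ContinuousAt.comp (f := fun u : ℂ => c * u) h3 (by fun_prop)
    have h4 : (c * (0 : ℂ)) ^ (s - 3) = 0 := by
      rw [mul_zero, Complex.zero_cpow (fun h => by simp [h] at hs3)]
    have h5 := h2.tendsto
    rw [h4] at h5
    exact h5.mono_left nhdsWithin_le_nhds
  obtain ⟨C, hC⟩ := hH.pole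
  have h2 : Tendsto (fun u : ℂ => (c * u) ^ (s - 3) * (u ^ 2 * H u)) (𝓝[≠] 0) (𝓝 0) :=
    h1.zero_mul_isBoundedUnder_le ⟨C, by simpa [Function.comp_def] using hC⟩
  have h3 := h2.const_mul (Complex.exp ((s - 1) * κ) * c ^ 2)
  rw [mul_zero] at h3
  refine h3.congr' ?_
  filter_upwards [self_mem_nhdsWithin] with u hu
  have hcu : c * u ≠ 0 := mul_ne_zero hc hu
  have h4 : (c * u) ^ (s - 1) = (c * u) ^ (s - 3) * (c * u) ^ 2 := by
    rw [← Complex.cpow_ofNat, ← Complex.cpow_add _ _ hcu]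
    congr 1
    ring
  rw [turnedKernel, h4]
  ring

/-- Cauchy's theorem for `turnedKernel` in the upper or the lower half of the half-strip. -/
lemma turnedKernel_cauchy {δ ε : ℝ} {H : ℂ → ℂ} (hH : IsLoopKernel δ ε H) {c κ : ℂ} (hc : ‖c‖ = 1)
    (hκ : κ.re = 0) {p q : ℝ} (hp : -ε ≤ p) (hpq : p ≤ q) (hq : q ≤ ε)
    (hslit : ∀ u : ℂ, u ≠ 0 → p ≤ u.im → u.im ≤ q → c * u ∈ Complex.slitPlane)
    (hopen : ∀ u : ℂ, p < u.im → u.im < q → u ≠ 0)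
    (harg : ∀ u : ℂ, p ≤ u.im → u.im ≤ q → |(c * u).arg + κ.im| ≤ 2 * Real.pi)
    {s : ℂ} (hs : 3 < s.re) :
    IntegrableOn (fun x : ℝ => turnedKernel c κ s H (x + p * Complex.I)) (Set.Ioi (-δ)) ∧
    IntegrableOn (fun x : ℝ => turnedKernel c κ s H (x + q * Complex.I)) (Set.Ioi (-δ)) ∧
    (∫ x : ℝ in Set.Ioi (-δ), turnedKernel c κ s H (x + p * Complex.I)) -
      (∫ x : ℝ in Set.Ioi (-δ), turnedKernel c κ s H (x + q * Complex.I)) -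
      Complex.I * ∫ y : ℝ in p..q, turnedKernel c κ s H ((-δ : ℝ) + y * Complex.I) = 0 := by
  obtain ⟨C, b, x₀, hb, hx₀, hle⟩ := hH.decay_exp_log ‖s - 1‖
  have hc0 : c ≠ 0 := fun h => by simp [h] at hc
  have hstrip : ∀ u : ℂ, -δ ≤ u.re → p ≤ u.im → u.im ≤ q → u ∈ halfStrip δ ε :=
    fun u h1 h2 h3 => ⟨h1, abs_le.2 ⟨hp.trans h2, h3.trans hq⟩⟩
  have hdiff : ∀ u : ℂ, u ≠ 0 → -δ ≤ u.re → p ≤ u.im → u.im ≤ q →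
      DifferentiableAt ℂ (turnedKernel c κ s H) u := by
    intro u hu h1 h2 h3
    unfold turnedKernel
    refine DifferentiableAt.mul (DifferentiableAt.const_mul ?_ _)
      (hH.differentiableAt u (hstrip u h1 h2 h3) hu)
    exact (differentiableAt_id.const_mul c).cpow_const (hslit u hu h2 h3)
  refine halfStrip_cauchy hpq hb (C := C) (x₀ := x₀) ?_ ?_ ?_
  · intro u hu
    rw [Complex.mem_reProdIm] at hu
    refine ContinuousAt.continuousWithinAt ?_
    rcases eq_or_ne u 0 with rfl | h0
    · exact continuousAt_turnedKernel_zero hH hc0 κ hs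
    · exact (hdiff u h0 hu.1 hu.2.1 hu.2.2).continuousAt
  · intro u hu
    rw [Complex.mem_reProdIm] at hu
    exact (hdiff u (hopen u hu.2.1 hu.2.2) (le_of_lt hu.1) hu.2.1.le
      hu.2.2.le).differentiableWithinAt
  · intro u hu hx
    rw [Complex.mem_reProdIm] at hu
    refine le_trans ?_ (hle u (hstrip u hu.1 hu.2.1 hu.2.2) hx)
    have hu0 : u ≠ 0 := fun h => by
      rw [h, Complex.zero_re] at hx
      linarith
    rw [turnedKernel_eq_exp κ s H (mul_ne_zero hc0 hu0), norm_mul, Complex.norm_exp]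
    refine mul_le_mul_of_nonneg_right (Real.exp_le_exp.2 ?_) (norm_nonneg _)
    refine (Complex.re_le_norm _).trans ?_
    rw [norm_mul]
    refine mul_le_mul_of_nonneg_left ?_ (norm_nonneg _)
    refine (Complex.norm_le_abs_re_add_abs_im _).trans (add_le_add ?_ ?_)
    · simp [Complex.log_re, hκ, hc]
    · simpa [Complex.log_im] using harg u hu.2.1 hu.2.2

lemma abs_arg_neg_I_mul_le {u : ℂ} (h : 0 ≤ u.im) : |(-Complex.I * u).arg| ≤ Real.pi / 2 := by
  rw [Complex.abs_arg_le_pi_div_two_iff]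
  simpa using h

lemma abs_arg_I_mul_le {u : ℂ} (h : u.im ≤ 0) : |(Complex.I * u).arg| ≤ Real.pi / 2 := by
  rw [Complex.abs_arg_le_pi_div_two_iff]
  simpa using h

/-- `turnedKernel` in the branch used above the real axis. -/
noncomputable def upperKernel : ℂ → (ℂ → ℂ) → ℂ → ℂ :=
  turnedKernel (-Complex.I) (((Real.pi / 2 : ℝ) : ℂ) * Complex.I)

/-- `turnedKernel` in the branch used below the real axis. -/
noncomputable def lowerKernel : ℂ → (ℂ → ℂ) → ℂ → ℂ :=
  turnedKernel Complex.I (((3 * Real.pi / 2 : ℝ) : ℂ) * Complex.I)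

lemma upperKernel_eq_loop (s : ℂ) (H : ℂ → ℂ) {u : ℂ} (h : 0 < u.im ∨ (u.im = 0 ∧ u.re < 0)) :
    upperKernel s H u = loopPow u (s - 1) * H u := by
  have hpi := Real.pi_pos
  have hu : u ≠ 0 := by
    rintro rfl
    simp at h
  have him : ((((Real.pi / 2 : ℝ) : ℂ) * Complex.I)).im = Real.pi / 2 := by
    rw [Complex.im_ofReal_mul, Complex.I_im, mul_one]
  have hbd : 0 < (-Complex.I * u).arg + Real.pi / 2 ∧ (-Complex.I * u).arg ≤ Real.pi / 2 := by
    rcases h with h | ⟨h1, h2⟩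
    · have := abs_lt.1 (Complex.abs_arg_lt_pi_div_two_iff.2
        (Or.inl (by simpa using h) : 0 < (-Complex.I * u).re ∨ -Complex.I * u = 0))
      constructor <;> linarith [this.1, this.2]
    · have : (-Complex.I * u).arg = Real.pi / 2 :=
        Complex.arg_eq_pi_div_two_iff.2 ⟨by simpa using h1, by simpa using h2⟩
      rw [this]
      constructor <;> linarith
  refine turnedKernel_eq_loop s H ?_ hu ?_ ?_
  · push_cast
    rw [Complex.exp_pi_div_two_mul_I]
    simp
  · rw [him]; exact hbd.1
  · rw [him]; linarith [hbd.2]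

lemma lowerKernel_eq_loop (s : ℂ) (H : ℂ → ℂ) {u : ℂ} (h : u.im < 0 ∨ (u.im = 0 ∧ u.re < 0)) :
    lowerKernel s H u = loopPow u (s - 1) * H u := by
  have hpi := Real.pi_pos
  have hu : u ≠ 0 := by
    rintro rfl
    simp at h
  have him : ((((3 * Real.pi / 2 : ℝ) : ℂ) * Complex.I)).im = 3 * Real.pi / 2 := by
    rw [Complex.im_ofReal_mul, Complex.I_im, mul_one]
  have hbd : -(Real.pi / 2) ≤ (Complex.I * u).arg ∧ (Complex.I * u).arg ≤ Real.pi / 2 :=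
    abs_le.1 (abs_arg_I_mul_le (h.elim le_of_lt fun h => h.1.le))
  refine turnedKernel_eq_loop s H ?_ hu ?_ ?_
  · rw [show ((3 * Real.pi / 2 : ℝ) : ℂ) * Complex.I =
      Real.pi * Complex.I + Real.pi / 2 * Complex.I by push_cast; ring, Complex.exp_add,
      Complex.exp_pi_mul_I, Complex.exp_pi_div_two_mul_I]
    simp
  · rw [him]; linarith [hbd.1]
  · rw [him]; linarith [hbd.2]

lemma upperKernel_ofReal (s : ℂ) (H : ℂ → ℂ) {x : ℝ} (hx : 0 < x) :
    upperKernel s H x = (x : ℂ) ^ (s - 1) * H x := by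
  have h0 : -Complex.I * (x : ℂ) ≠ 0 := by simp [hx.ne']
  rw [upperKernel, turnedKernel_eq_exp _ _ _ h0, mul_comm (-Complex.I),
    Complex.log_ofReal_mul hx (by simp), Complex.log_neg_I,
    Complex.cpow_def_of_ne_zero (by exact_mod_cast hx.ne'), Complex.ofReal_log hx.le]
  congr 2
  push_cast
  ring

lemma lowerKernel_ofReal (s : ℂ) (H : ℂ → ℂ) {x : ℝ} (hx : 0 < x) :
    lowerKernel s H x = Complex.exp (2 * Real.pi * Complex.I * s) * ((x : ℂ) ^ (s - 1) * H x) := by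
  have h0 : Complex.I * (x : ℂ) ≠ 0 := by simp [hx.ne']
  rw [lowerKernel, turnedKernel_eq_exp _ _ _ h0, mul_comm Complex.I (x : ℂ),
    Complex.log_ofReal_mul hx (by simp), Complex.log_I,
    Complex.cpow_def_of_ne_zero (by exact_mod_cast hx.ne'), Complex.ofReal_log hx.le, ← mul_assoc,
    ← Complex.exp_add, ← Complex.exp_periodic]
  congr 2
  push_cast
  ring

/-- For `Re s > 3` the loop integral of `u ^ (s - 1) H(u)` is `exp (2 π i s) - 1` times the
integral over the positive half-line: the branches on the two sides differ by `exp (2 π i s)`, and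
the origin contributes nothing. -/
theorem IsLoopKernel.loopIntegral_eq {δ ε : ℝ} {H : ℂ → ℂ} (hH : IsLoopKernel δ ε H)
    (hδ : 0 < δ) (hε : 0 < ε) {s : ℂ} (hs : 3 < s.re) :
    loopIntegral δ ε (fun u => loopPow u (s - 1) * H u) =
      (Complex.exp (2 * Real.pi * Complex.I * s) - 1) *
        ∫ x : ℝ in Set.Ioi 0, (x : ℂ) ^ (s - 1) * H x := by
  have hpi := Real.pi_pos
  have hs1 : s - 1 ≠ 0 := fun h => by
    have := congrArg Complex.re h
    simp at this
    linarith
  obtain ⟨iu, -, hu⟩ := turnedKernel_cauchy hH (c := -Complex.I)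
    (κ := ((Real.pi / 2 : ℝ) : ℂ) * Complex.I) (by simp) (by rw [Complex.re_ofReal_mul]; simp)
    (p := 0) (q := ε) (by linarith) hε.le le_rfl
    (fun u h0 h1 _ => by
      rcases h1.eq_or_lt with h | h
      · refine Or.inr ?_
        simp only [neg_mul, Complex.neg_im, Complex.I_mul_im, ne_eq, neg_eq_zero]
        exact fun hr => h0 (Complex.ext hr h.symm)
      · exact Or.inl (by simpa using h))
    (fun u h1 _ h => by simp [h] at h1)
    (fun u h1 _ => by
      have := abs_le.1 (abs_arg_neg_I_mul_le h1)
      rw [Complex.im_ofReal_mul, Complex.I_im, mul_one, abs_le]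
      constructor <;> linarith [this.1, this.2]) hs
  obtain ⟨-, il, hl⟩ := turnedKernel_cauchy hH (c := Complex.I)
    (κ := ((3 * Real.pi / 2 : ℝ) : ℂ) * Complex.I) (by simp) (by rw [Complex.re_ofReal_mul]; simp)
    (p := -ε) (q := 0) le_rfl (by linarith) hε.le
    (fun u h0 _ h1 => by
      rcases h1.eq_or_lt with h | h
      · refine Or.inr ?_
        simp only [Complex.I_mul_im, ne_eq]
        exact fun hr => h0 (Complex.ext hr h)
      · exact Or.inl (by simpa using h))
    (fun u _ h1 h => by simp [h] at h1)
    (fun u _ h1 => by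
      have := abs_le.1 (abs_arg_I_mul_le h1)
      rw [Complex.im_ofReal_mul, Complex.I_im, mul_one, abs_le]
      constructor <;> linarith [this.1, this.2]) hs
  change IntegrableOn (fun x : ℝ => upperKernel s H (x + (0 : ℝ) * Complex.I)) _ at iu
  change IntegrableOn (fun x : ℝ => lowerKernel s H (x + (0 : ℝ) * Complex.I)) _ at il
  change (∫ x : ℝ in Set.Ioi (-δ), upperKernel s H (x + (0 : ℝ) * Complex.I)) -
      (∫ x : ℝ in Set.Ioi (-δ), upperKernel s H (x + ε * Complex.I)) -
      Complex.I * ∫ y : ℝ in (0 : ℝ)..ε, upperKernel s H ((-δ : ℝ) + y * Complex.I) = 0 at hu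
  change (∫ x : ℝ in Set.Ioi (-δ), lowerKernel s H (x + (-ε : ℝ) * Complex.I)) -
      (∫ x : ℝ in Set.Ioi (-δ), lowerKernel s H (x + (0 : ℝ) * Complex.I)) -
      Complex.I * ∫ y : ℝ in (-ε)..(0 : ℝ), lowerKernel s H ((-δ : ℝ) + y * Complex.I) = 0 at hl
  have e1 : ∀ x : ℝ, upperKernel s H (x + ε * Complex.I) =
      loopPow (x + ε * Complex.I) (s - 1) * H (x + ε * Complex.I) := fun x =>
    upperKernel_eq_loop s H (Or.inl (by simpa using hε))
  have e2 : ∀ x : ℝ, lowerKernel s H (x + (-ε : ℝ) * Complex.I) =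
      loopPow (x - ε * Complex.I) (s - 1) * H (x - ε * Complex.I) := fun x => by
    rw [Complex.ofReal_neg, neg_mul, ← sub_eq_add_neg]
    exact lowerKernel_eq_loop s H (Or.inl (by simpa using hε))
  have e3 : ∫ y : ℝ in (0 : ℝ)..ε, upperKernel s H ((-δ : ℝ) + y * Complex.I) =
      ∫ y : ℝ in (0 : ℝ)..ε, loopPow (-(δ : ℂ) + y * Complex.I) (s - 1) *
        H (-(δ : ℂ) + y * Complex.I) := by
    refine intervalIntegral.integral_congr fun y hy => ?_
    rw [Set.uIcc_of_le hε.le] at hy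
    simp only [Complex.ofReal_neg]
    refine upperKernel_eq_loop s H ?_
    rcases hy.1.eq_or_lt with h | h
    · exact Or.inr ⟨by simp [← h], by simpa using hδ⟩
    · exact Or.inl (by simpa using h)
  have e4 : ∫ y : ℝ in (-ε)..(0 : ℝ), lowerKernel s H ((-δ : ℝ) + y * Complex.I) =
      ∫ y : ℝ in (-ε)..(0 : ℝ), loopPow (-(δ : ℂ) + y * Complex.I) (s - 1) *
        H (-(δ : ℂ) + y * Complex.I) := by
    refine intervalIntegral.integral_congr fun y hy => ?_
    rw [Set.uIcc_of_le (by linarith)] at hy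
    simp only [Complex.ofReal_neg]
    refine lowerKernel_eq_loop s H ?_
    rcases hy.2.eq_or_lt with h | h
    · exact Or.inr ⟨by simp [h], by simpa using hδ⟩
    · exact Or.inl (by simpa using h)
  simp only [e1, e3] at hu
  simp only [e2, e4] at hl
  simp only [Complex.ofReal_zero, zero_mul, add_zero] at hu hl iu il
  have hseg := (hH.loopIntegrable hδ hε s).2.1
  have hsplit := intervalIntegral.integral_add_adjacent_intervals
    (hseg.mono_set (c := -ε) (d := 0) (by
      rw [Set.uIcc_of_le (by linarith), Set.uIcc_of_le (by linarith)]
      exact Set.Icc_subset_Icc_right hε.le))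
    (hseg.mono_set (c := 0) (d := ε) (by
      rw [Set.uIcc_of_le (by linarith), Set.uIcc_of_le (by linarith)]
      exact Set.Icc_subset_Icc_left (by linarith)))
  have hdiff : (∫ x : ℝ in Set.Ioi (-δ), lowerKernel s H x) -
      (∫ x : ℝ in Set.Ioi (-δ), upperKernel s H x) =
      (Complex.exp (2 * Real.pi * Complex.I * s) - 1) *
        ∫ x : ℝ in Set.Ioi 0, (x : ℂ) ^ (s - 1) * H x := by
    rw [← integral_sub il iu, ← integral_const_mul]
    rw [setIntegral_eq_of_subset_of_forall_sdiff_eq_zero measurableSet_Ioi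
      (Set.Ioi_subset_Ioi (by linarith : -δ ≤ 0))]
    · refine setIntegral_congr_fun measurableSet_Ioi fun x hx => ?_
      rw [upperKernel_ofReal s H hx, lowerKernel_ofReal s H hx]
      ring
    · intro x hx
      rcases lt_or_eq_of_le (not_lt.1 (show ¬ (0 : ℝ) < x from hx.2)) with h | h
      · rw [upperKernel_eq_loop s H (Or.inr ⟨by simp, by simpa using h⟩),
          lowerKernel_eq_loop s H (Or.inr ⟨by simp, by simpa using h⟩), sub_self]
      · simp [h, upperKernel, lowerKernel, turnedKernel, Complex.zero_cpow hs1]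
  rw [loopIntegral, ← hsplit, ← hdiff]
  linear_combination hu + hl

/-! ### The kernel of the transformation formula -/

/-- The factor of `u ^ (s - 1)` in the integrand of `loopI`. -/
noncomputable def loopKernel (k : ℕ) (τ : ℂ) (a b : ℝ) (u : ℂ) : ℂ :=
  Complex.exp (-(a : ℂ) * τ * k * u) / (Complex.exp (-(k * u * τ)) - 1) *
    (Complex.exp ((b : ℂ) * k * u) / (Complex.exp (k * u) - 1))

/-- Each factor of the kernel has at most a simple pole at the origin. -/
lemma tendsto_mul_div_exp_sub_one {γ : ℂ} (hγ : γ ≠ 0) (l : ℂ) :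
    Tendsto (fun u : ℂ => u * (Complex.exp (l * u) / (Complex.exp (γ * u) - 1))) (𝓝[≠] 0)
      (𝓝 γ⁻¹) := by
  have h1 : HasDerivAt (fun u : ℂ => Complex.exp (γ * u)) γ 0 := by
    have := ((hasDerivAt_id (0 : ℂ)).const_mul γ).cexp
    simpa using this
  have h2 := h1.tendsto_slope_zero
  simp only [zero_add, mul_zero, Complex.exp_zero, smul_eq_mul] at h2
  have h3 := h2.inv₀ hγ
  have h4 : Tendsto (fun u : ℂ => Complex.exp (l * u)) (𝓝[≠] 0) (𝓝 1) := by
    have : ContinuousAt (fun u : ℂ => Complex.exp (l * u)) 0 := by fun_prop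
    have h5 := this.tendsto
    simp only [mul_zero, Complex.exp_zero] at h5
    exact h5.mono_left nhdsWithin_le_nhds
  have h5 := h4.mul h3
  rw [one_mul] at h5
  refine h5.congr fun u => ?_
  rw [mul_inv, inv_inv]
  ring

lemma norm_exp_sub_one_ge_of_le {x : ℂ} (h : Real.exp x.re ≤ 1 / 2) :
    1 / 2 ≤ ‖Complex.exp x - 1‖ := by
  have := norm_sub_norm_le (1 : ℂ) (Complex.exp x)
  rw [norm_one, Complex.norm_exp, norm_sub_rev] at this
  linarith

lemma norm_exp_sub_one_ge_of_ge {x : ℂ} (h : 2 ≤ Real.exp x.re) :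
    Real.exp x.re / 2 ≤ ‖Complex.exp x - 1‖ := by
  have := norm_sub_norm_le (Complex.exp x) (1 : ℂ)
  rw [norm_one, Complex.norm_exp] at this
  linarith

/-- Apart from the zeros of the two denominators, the kernel is holomorphic; the condition `b < 1`
makes it decay. -/
lemma isLoopKernel_loopKernel {k : ℕ} (hk : 0 < k) {τ : ℂ} (hτ : 0 < τ.re) {a b δ ε : ℝ}
    (ha : 0 ≤ a) (hb : b < 1)
    (hzero : ∀ u ∈ halfStrip δ ε,
      (Complex.exp (-(k * u * τ)) - 1) * (Complex.exp (k * u) - 1) = 0 → u = 0) :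
    IsLoopKernel δ ε (loopKernel k τ a b) := by
  have hk0 : (0 : ℝ) < k := by exact_mod_cast hk
  have hkc : (k : ℂ) ≠ 0 := by exact_mod_cast hk.ne'
  have hτ0 : τ ≠ 0 := fun h => by simp [h] at hτ
  refine ⟨?_, ?_, ?_⟩
  · intro u hu h0
    have h1 : (Complex.exp (-(k * u * τ)) - 1) * (Complex.exp (k * u) - 1) ≠ 0 :=
      fun h => h0 (hzero u hu h)
    unfold loopKernel
    exact DifferentiableAt.mul
      (DifferentiableAt.div (by fun_prop) (by fun_prop) (left_ne_zero_of_mul h1))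
      (DifferentiableAt.div (by fun_prop) (by fun_prop) (right_ne_zero_of_mul h1))
  -- the first factor is bounded for large `Re u`, the second is `O (exp (-(1 - b) k Re u))`
  · set x₀ : ℝ := max (1 / k) ((1 / k + |τ.im| * ε) / τ.re)
    refine ⟨4, (1 - b) * k, x₀, mul_pos (by linarith) hk0, fun u hu hx => ?_⟩
    have hx1 : 1 ≤ k * u.re := by
      have := (le_max_left _ _).trans hx
      rw [div_le_iff₀ hk0] at this
      linarith
    have hx2 : 1 ≤ k * (u * τ).re := by
      have h1 := (le_max_right _ _).trans hx
      rw [div_le_iff₀ hτ] at h1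
      have h2 : u.im * τ.im ≤ |τ.im| * ε := by
        refine (le_abs_self _).trans ?_
        rw [abs_mul, mul_comm]
        exact mul_le_mul_of_nonneg_left hu.2 (abs_nonneg _)
      have h3 : 1 / (k : ℝ) ≤ (u * τ).re := by
        rw [Complex.mul_re]
        linarith
      rw [div_le_iff₀ hk0] at h3
      linarith
    have he : (2 : ℝ) ≤ Real.exp 1 := by linarith [Real.add_one_le_exp (1 : ℝ)]
    have hr1 : (-(k * u * τ)).re = -(k * (u * τ).re) := by
      rw [mul_assoc, Complex.neg_re, ← Complex.ofReal_natCast, Complex.re_ofReal_mul]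
    have hr2 : ((k : ℂ) * u).re = k * u.re := by
      rw [← Complex.ofReal_natCast, Complex.re_ofReal_mul]
    have hd1 : 1 / 2 ≤ ‖Complex.exp (-(k * u * τ)) - 1‖ := by
      refine norm_exp_sub_one_ge_of_le ?_
      rw [hr1, Real.exp_neg, one_div]
      exact inv_anti₀ (by norm_num) (he.trans (Real.exp_le_exp.2 hx2))
    have hd2 : Real.exp (k * u.re) / 2 ≤ ‖Complex.exp (k * u) - 1‖ := by
      rw [← hr2]
      exact norm_exp_sub_one_ge_of_ge (by rw [hr2]; exact he.trans (Real.exp_le_exp.2 hx1))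
    have hn1 : ‖Complex.exp (-(a : ℂ) * τ * k * u)‖ ≤ 1 := by
      rw [Complex.norm_exp, show -(a : ℂ) * τ * k * u = ((-(a * k) : ℝ) : ℂ) * (u * τ) by
        push_cast; ring, Complex.re_ofReal_mul, Real.exp_le_one_iff]
      have : 0 ≤ a * (k * (u * τ).re) := mul_nonneg ha (by linarith)
      linarith
    have hn2 : ‖Complex.exp ((b : ℂ) * k * u)‖ = Real.exp (b * k * u.re) := by
      rw [Complex.norm_exp, show (b : ℂ) * k * u = ((b * k : ℝ) : ℂ) * u by push_cast; ring,
        Complex.re_ofReal_mul]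
    rw [loopKernel, norm_mul, norm_div, norm_div, hn2]
    calc _ ≤ 1 / (1 / 2) * (Real.exp (b * k * u.re) / (Real.exp (k * u.re) / 2)) := by gcongr
      _ = 4 * (Real.exp (b * k * u.re) / Real.exp (k * u.re)) := by ring
      _ = 4 * Real.exp (-((1 - b) * k) * u.re) := by
        rw [← Real.exp_sub]
        congr 2
        ring
  · have h1 := tendsto_mul_div_exp_sub_one (γ := -(k * τ))
      (neg_ne_zero.2 (mul_ne_zero hkc hτ0)) (-(a : ℂ) * τ * k)
    have h2 := tendsto_mul_div_exp_sub_one hkc ((b : ℂ) * k)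
    have h3 := (h1.mul h2).norm
    refine ⟨‖(-(k * τ))⁻¹ * (k : ℂ)⁻¹‖ + 1, ?_⟩
    filter_upwards [h3.eventually_lt_const (lt_add_one _)] with u hu
    refine (le_of_eq ?_).trans hu.le
    congr 1
    rw [loopKernel, show -(k * u * τ) = -(k * τ) * u by ring]
    ring

lemma summable_one_div_linear_rpow {α x p : ℝ} (hα : 0 < α) (hx : 0 < x) (hp : 1 < p) :
    Summable fun n : ℕ => (α * (n + x)) ^ (-p) := by
  refine (((Real.summable_one_div_nat_add_rpow x p).2 hp).mul_left (α ^ (-p))).congr fun n => ?_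
  have : (0 : ℝ) < n + x := by positivity
  rw [abs_of_pos this, Real.mul_rpow hα.le this.le, Real.rpow_neg this.le, one_div]

/-- By the inequality `x y ≤ (x + y) ^ 2`, a sum over a quadrant is dominated by a product of two
simple sums. -/
lemma summable_rpow_add {f g : ℕ → ℝ} (hf : ∀ n, 0 < f n) (hg : ∀ n, 0 < g n) {σ : ℝ} (hσ : 0 < σ)
    (hsf : Summable fun n => f n ^ (-(σ / 2))) (hsg : Summable fun n => g n ^ (-(σ / 2))) :
    Summable fun p : ℕ × ℕ => (f p.1 + g p.2) ^ (-σ) := by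
  refine Summable.of_nonneg_of_le (fun p => ?_) (fun p => ?_)
    (hsf.mul_of_nonneg hsg (fun n => ?_) (fun n => ?_))
  · have := hf p.1; have := hg p.2; positivity
  · have h1 := hf p.1
    have h2 := hg p.2
    have h3 : (f p.1 + g p.2) ^ (-σ) = ((f p.1 + g p.2) ^ 2) ^ (-(σ / 2)) := by
      rw [← Real.rpow_natCast, ← Real.rpow_mul (by positivity)]
      congr 1
      push_cast
      ring
    rw [h3, ← Real.mul_rpow h1.le h2.le]
    exact Real.rpow_le_rpow_of_nonpos (by positivity) (by nlinarith) (by linarith)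
  · have := hf n; simp only [Pi.zero_apply]; positivity
  · have := hg n; simp only [Pi.zero_apply]; positivity

/-- On the positive half-line the kernel is the negative of a product of two geometric series. -/
lemma tsum_exp_eq_neg_loopKernel {k : ℕ} (hk : 0 < k) {τ : ℂ} (hτ : 0 < τ.re) (a b : ℝ) {x : ℝ}
    (hx : 0 < x) :
    ∑' p : ℕ × ℕ, Complex.exp (-((τ * (k * (a + p.1)) + k * (p.2 + 1 - b)) * x)) =
      -loopKernel k τ a b x := by
  have hk0 : (0 : ℝ) < k := by exact_mod_cast hk
  set ξ : ℂ := Complex.exp (-(k * x * τ))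
  set η : ℂ := Complex.exp (-(k * x))
  have hξ : ‖ξ‖ < 1 := by
    rw [Complex.norm_exp, show (-((k : ℂ) * x * τ)) = ((-(k * x) : ℝ) : ℂ) * τ by push_cast; ring,
      Complex.re_ofReal_mul, Real.exp_lt_one_iff]
    have := mul_pos (mul_pos hk0 hx) hτ
    linarith
  have hη : ‖η‖ < 1 := by
    rw [Complex.norm_exp, show (-((k : ℂ) * x)) = ((-(k * x) : ℝ) : ℂ) by push_cast; ring,
      Complex.ofReal_re, Real.exp_lt_one_iff]
    have := mul_pos hk0 hx
    linarith
  have h1 := tsum_mul_tsum_of_summable_norm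
    (summable_norm_geometric_of_norm_lt_one hξ) (summable_norm_geometric_of_norm_lt_one hη)
  rw [tsum_geometric_of_norm_lt_one hξ, tsum_geometric_of_norm_lt_one hη] at h1
  have hterm : ∀ p : ℕ × ℕ,
      Complex.exp (-((τ * (k * (a + p.1)) + k * (p.2 + 1 - b)) * x)) =
        (Complex.exp (-(a : ℂ) * τ * k * x) * Complex.exp ((b : ℂ) * k * x) * η) *
          (ξ ^ p.1 * η ^ p.2) := by
    intro p
    rw [← Complex.exp_nat_mul, ← Complex.exp_nat_mul, ← Complex.exp_add, ← Complex.exp_add,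
      ← Complex.exp_add, ← Complex.exp_add]
    congr 1
    ring
  rw [tsum_congr hterm, tsum_mul_left, ← h1, loopKernel]
  have hξ1 : ξ - 1 ≠ 0 := fun h => by
    rw [sub_eq_zero.1 h, norm_one] at hξ
    exact lt_irrefl _ hξ
  have hη1 : η - 1 ≠ 0 := fun h => by
    rw [sub_eq_zero.1 h, norm_one] at hη
    exact lt_irrefl _ hη
  have hη0 : η ≠ 0 := Complex.exp_ne_zero _
  have hinv : Complex.exp (k * x) = η⁻¹ := by
    rw [← Complex.exp_neg, neg_neg]
  have h3 : η⁻¹ - 1 ≠ 0 := fun h => hη1 (by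
    have : η⁻¹ = 1 := sub_eq_zero.1 h
    rw [inv_eq_one.1 this, sub_self])
  have h4 : 1 - ξ ≠ 0 := fun h => hξ1 (by linear_combination -h)
  have h5 : 1 - η ≠ 0 := fun h => hη1 (by linear_combination -h)
  rw [hinv]
  have h6 : (η⁻¹ - 1)⁻¹ = η * (1 - η)⁻¹ := by
    field_simp
  have h7 : (ξ - 1)⁻¹ = -(1 - ξ)⁻¹ := by
    rw [← neg_sub, inv_neg]
  rw [div_eq_mul_inv, div_eq_mul_inv, h6, h7]
  ring

/-- Integrating the geometric series term by term: `Γ(s)` times the sum over a quadrant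
is a Mellin transform of the kernel. -/
theorem hasSum_quadrant {k : ℕ} (hk : 0 < k) {τ : ℂ} (hτ : 0 < τ.re) {a b : ℝ}
    (ha : 0 < a) (hb : b < 1) {s : ℂ} (hs : 2 < s.re) :
    HasSum (fun p : ℕ × ℕ =>
        (τ * (k * (a + p.1)) + k * (p.2 + 1 - b)) ^ (-s) * Complex.Gamma s)
      (-∫ x : ℝ in Set.Ioi 0, (x : ℂ) ^ (s - 1) * loopKernel k τ a b x) := by
  have hk0 : (0 : ℝ) < k := by exact_mod_cast hk
  set W : ℕ × ℕ → ℂ := fun p => τ * (k * (a + p.1)) + k * (p.2 + 1 - b) with hW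
  have hre : ∀ p, (W p).re = τ.re * k * (p.1 + a) + k * (p.2 + (1 - b)) := fun p => by
    have : W p = ((k * (a + p.1) : ℝ) : ℂ) * τ + ((k * (p.2 + 1 - b) : ℝ) : ℂ) := by
      simp only [hW]
      push_cast
      ring
    rw [this, Complex.add_re, Complex.re_ofReal_mul, Complex.ofReal_re]
    ring
  have hX : ∀ n : ℕ, 0 < τ.re * k * (n + a) := fun n => by positivity
  have hY : ∀ n : ℕ, 0 < (k : ℝ) * (n + (1 - b)) := fun n => by
    have : 0 < 1 - b := by linarith
    positivity
  have hpos : ∀ p, 0 < (W p).re := fun p => by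
    rw [hre]
    exact add_pos (hX _) (hY _)
  have hs0 : 0 < s.re := by linarith
  have hsum : Summable fun p : ℕ × ℕ =>
      ∫ x : ℝ in Set.Ioi 0, ‖(x : ℂ) ^ (s - 1) * Complex.exp (-(W p * x))‖ := by
    have h1 := (summable_rpow_add hX hY hs0
      (summable_one_div_linear_rpow (by positivity) ha (by linarith))
      (summable_one_div_linear_rpow hk0 (by linarith) (by linarith))).mul_right (Real.Gamma s.re)
    refine h1.congr fun p => ?_
    rw [integral_norm_cpow_mul_exp_neg_mul hs0 (hpos p), hre, one_div,
      Real.inv_rpow (add_pos (hX _) (hY _)).le, Real.rpow_neg (add_pos (hX _) (hY _)).le]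
  have h2 := hasSum_integral_of_summable_integral_norm
    (fun p => integrableOn_cpow_mul_exp_neg_mul hs0 (hpos p)) hsum
  have h3 : ∫ x : ℝ in Set.Ioi 0, ∑' p, (x : ℂ) ^ (s - 1) * Complex.exp (-(W p * x)) =
      -∫ x : ℝ in Set.Ioi 0, (x : ℂ) ^ (s - 1) * loopKernel k τ a b x := by
    rw [← integral_neg]
    refine setIntegral_congr_fun measurableSet_Ioi fun x hx => ?_
    simp only [tsum_mul_left, hW]
    rw [tsum_exp_eq_neg_loopKernel hk hτ a b hx]
    ring
  rw [h3] at h2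
  refine h2.congr_fun fun p => ?_
  exact (integral_cpow_mul_exp_neg_mul hs0 (hpos p)).symm

/-- Admissible loops exist: the nonzero zeros have imaginary part bounded away from zero. -/
lemma exists_isAdmissibleLoop {k : ℕ} (hk : 0 < k) {c d : ℤ} {z : ℂ}
    (hτ : 0 < ((c : ℂ) * z + d).re) : ∃ δ ε : ℝ, IsAdmissibleLoop k c d z δ ε := by
  have hk0 : (0 : ℝ) < k := by exact_mod_cast hk
  have hkc : (k : ℂ) ≠ 0 := by exact_mod_cast hk.ne'
  have hpi := Real.pi_pos
  set τ : ℂ := (c : ℂ) * z + d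
  have hτ0 : τ ≠ 0 := fun h => by simp [h] at hτ
  -- a zero `u = 2 π i n / (k γ)` with `n ≠ 0` and `Re γ > 0` has `|Im u| ≥ 2 π Re γ / (k ‖γ‖²)`
  have key : ∀ γ : ℂ, 0 < γ.re → ∀ u : ℂ, |u.im| ≤ Real.pi * γ.re / (k * ‖γ‖ ^ 2) →
      Complex.exp (k * u * γ) = 1 → u = 0 := by
    intro γ hγ u hu hexp
    have hγ0 : γ ≠ 0 := fun h => by simp [h] at hγ
    have hn0 : 0 < ‖γ‖ := norm_pos_iff.2 hγ0
    obtain ⟨n, hn⟩ := Complex.exp_eq_one_iff.1 hexp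
    have h1 : (k * ‖γ‖ ^ 2 : ℝ) * u.im = 2 * Real.pi * n * γ.re := by
      have h2 : ((k * ‖γ‖ ^ 2 : ℝ) : ℂ) * u =
          ((2 * Real.pi * n : ℝ) : ℂ) * (Complex.I * (starRingEnd ℂ) γ) := by
        push_cast
        rw [← Complex.mul_conj']
        linear_combination ((starRingEnd ℂ) γ) * hn
      have h3 := congrArg Complex.im h2
      rw [Complex.im_ofReal_mul, Complex.im_ofReal_mul, Complex.I_mul_im, Complex.conj_re] at h3
      exact h3
    have hn' : n = 0 := by
      by_contra hne
      have h2 : (1 : ℝ) ≤ |(n : ℝ)| := by exact_mod_cast Int.one_le_abs hne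
      have h3 : (k * ‖γ‖ ^ 2 : ℝ) * |u.im| = 2 * Real.pi * |(n : ℝ)| * γ.re := by
        have h4 := congrArg abs h1
        rw [abs_mul (_ * _) u.im, abs_mul _ γ.re, abs_mul _ (n : ℝ), abs_of_pos hγ,
          abs_of_pos (by positivity : (0 : ℝ) < k * ‖γ‖ ^ 2), abs_of_pos (by positivity : (0 : ℝ) < 2 * Real.pi)] at h4
        exact h4
      rw [le_div_iff₀ (by positivity)] at hu
      have h5 : 0 < Real.pi * γ.re := by positivity
      nlinarith
    rw [hn'] at hn
    simpa [hkc, hγ0] using hn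
  refine ⟨1, min (Real.pi * τ.re / (k * ‖τ‖ ^ 2))
    (Real.pi * (1 : ℂ).re / (k * ‖(1 : ℂ)‖ ^ 2)), one_pos, ?_, ?_⟩
  · have : 0 < ‖τ‖ := norm_pos_iff.2 hτ0
    refine lt_min (by positivity) ?_
    simp only [Complex.one_re, norm_one]
    positivity
  · intro u _ hu h
    rcases mul_eq_zero.1 h with h | h
    · refine key τ hτ u (hu.trans (min_le_left _ _)) ?_
      rw [Complex.exp_neg] at h
      exact inv_eq_one.1 (sub_eq_zero.1 h)
    · refine key 1 (by simp) u (hu.trans (min_le_right _ _)) ?_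
      rw [mul_one]
      exact sub_eq_zero.1 h

/-! ### The action of the modular transformation on the terms -/

lemma latticePoint_eq_zero_iff {z : ℂ} (hz : 0 < z.im) (r₁ r₂ : ℝ) (p : ℤ × ℤ) :
    latticePoint z r₁ r₂ p = 0 ↔ (p.1 : ℝ) = -r₁ ∧ (p.2 : ℝ) = -r₂ := by
  constructor
  · intro h
    have h1 := congrArg Complex.im h
    have h2 := congrArg Complex.re h
    rw [latticePoint_im, Complex.zero_im] at h1
    rw [latticePoint_re, Complex.zero_re] at h2
    have h3 := (mul_eq_zero.1 h1).resolve_right hz.ne'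
    rw [h3] at h2
    constructor <;> linarith
  · rintro ⟨h1, h2⟩
    refine Complex.ext ?_ ?_
    · rw [latticePoint_re, h1, h2]; simp
    · rw [latticePoint_im, h1]; simp

lemma eisensteinTerm_of_eq_zero {z : ℂ} (hz : 0 < z.im) (s : ℂ) (A B : ℤ → ℂ) {r₁ r₂ : ℝ}
    {p : ℤ × ℤ} (h : latticePoint z r₁ r₂ p = 0) : eisensteinTerm z s A B r₁ r₂ p = 0 :=
  if_pos ((latticePoint_eq_zero_iff hz r₁ r₂ p).1 h)

lemma eisensteinTerm_of_ne_zero {z : ℂ} (hz : 0 < z.im) (s : ℂ) (A B : ℤ → ℂ) {r₁ r₂ : ℝ}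
    {p : ℤ × ℤ} (h : latticePoint z r₁ r₂ p ≠ 0) :
    eisensteinTerm z s A B r₁ r₂ p =
      A p.1 * B p.2 * lowerPow (latticePoint z r₁ r₂ p) (-s) :=
  if_neg (mt (latticePoint_eq_zero_iff hz r₁ r₂ p).2 h)

lemma isUpper_or_neg {w : ℂ} (hw : w ≠ 0) : IsUpper w ∨ IsUpper (-w) := by
  unfold IsUpper
  rcases lt_trichotomy w.im 0 with h | h | h
  · exact Or.inr (Or.inl (by simpa using h))
  · rcases lt_trichotomy w.re 0 with h' | h' | h'
    · exact Or.inr (Or.inr ⟨by simpa using h, by simpa using h'⟩)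
    · exact absurd (Complex.ext h' h) hw
    · exact Or.inl (Or.inr ⟨h, h'⟩)
  · exact Or.inl (Or.inl h)

lemma IsUpper.not_neg {w : ℂ} (h : IsUpper w) : ¬ IsUpper (-w) := by
  unfold IsUpper at *
  simp only [Complex.neg_im, Complex.neg_re]
  rintro (h' | ⟨h1, h2⟩) <;> rcases h with h | ⟨h3, h4⟩ <;> linarith

/-- The pairs in the closed upper half-plane whose argument is less than that of `c z + d`. -/
def sector (c d : ℤ) (r₁ r₂ : ℝ) : Set (ℤ × ℤ) :=
  {p | p ∈ positiveRows r₁ ∪ positiveRay r₁ r₂ ∧ ((p.1 : ℝ) + r₁) * d < ((p.2 : ℝ) + r₂) * c}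

lemma mem_sector_iff {z : ℂ} (hz : 0 < z.im) (c d : ℤ) {r₁ r₂ : ℝ} {p : ℤ × ℤ}
    (hp : IsUpper (latticePoint z r₁ r₂ p)) :
    p ∈ sector c d r₁ r₂ ↔
      (latticePoint z r₁ r₂ p * (starRingEnd ℂ) ((c : ℂ) * z + d)).im < 0 := by
  have him : (latticePoint z r₁ r₂ p * (starRingEnd ℂ) ((c : ℂ) * z + d)).im =
      (((p.1 : ℝ) + r₁) * d - ((p.2 : ℝ) + r₂) * c) * z.im := by
    rw [Complex.mul_im, latticePoint_re, latticePoint_im, Complex.conj_re, Complex.conj_im]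
    simp
    ring
  rw [him, mul_neg_iff]
  constructor
  · intro h
    exact Or.inr ⟨by linarith [h.2], hz⟩
  · rintro (h | h)
    · exact absurd h.2 (not_lt.2 hz.le)
    · exact ⟨(isUpper_latticePoint_iff hz r₁ r₂ p).1 hp, by linarith [h.1]⟩

lemma periodic_eq_of_dvd {k : ℕ} {f : ℤ → ℂ} (hf : Function.Periodic f (k : ℤ)) {m n : ℤ}
    (h : (k : ℤ) ∣ m - n) : f m = f n := by
  obtain ⟨q, hq⟩ := h
  have := hf.int_mul q n
  rw [show m = n + q * k by linarith]
  exact this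

lemma periodic_dilate {k : ℕ} {f : ℤ → ℂ} (hf : Function.Periodic f (k : ℤ)) (α : ℤ) :
    Function.Periodic (dilate f α) (k : ℤ) := fun n =>
  periodic_eq_of_dvd hf ⟨α, by ring⟩

/-- The linear change of variables of the lattice that corresponds to `V z = (a z + b) / (c z + d)`. -/
def latticeEquiv (a b c d : ℤ) (h : a * d - b * c = 1) : ℤ × ℤ ≃ ℤ × ℤ where
  toFun p := (a * p.1 + c * p.2, b * p.1 + d * p.2)
  invFun p := (d * p.1 - c * p.2, -b * p.1 + a * p.2)
  left_inv p := by
    ext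
    · simp only; linear_combination p.1 * h
    · simp only; linear_combination p.2 * h
  right_inv p := by
    ext
    · simp only; linear_combination p.1 * h
    · simp only; linear_combination p.2 * h

section Transformation

variable {k : ℕ} {f fs : ℤ → ℂ} (α β : ℤ) {r₁ r₂ R₁ R₂ : ℝ} {a b c d : ℤ} {z V : ℂ}

/-- Term by term, `(c z + d) ^ (-s) G(V z)` differs from `G(z)` in the terms of a sector. -/
lemma lowerPow_mul_eisensteinTerm (hf : Function.Periodic f (k : ℤ))
    (hfs : Function.Periodic fs (k : ℤ)) (hdet : a * d - b * c = 1)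
    (ha : (k : ℤ) ∣ a) (hd : (k : ℤ) ∣ d) (hR₁ : R₁ = a * r₁ + c * r₂)
    (hR₂ : R₂ = b * r₁ + d * r₂) (hz : 0 < z.im) (hi : 0 < ((c : ℂ) * z + d).im)
    (hr : 0 < ((c : ℂ) * z + d).re) (hV : V = ((a : ℂ) * z + b) / ((c : ℂ) * z + d))
    (hVi : 0 < V.im) (s : ℂ) (p : ℤ × ℤ) :
    lowerPow ((c : ℂ) * z + d) (-s) *
        eisensteinTerm V s (dilate fs (-β)) (dilate f (-α)) r₁ r₂ p =
      eisensteinTerm z s (dilate f (α * b)) (dilate fs (β * c)) R₁ R₂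
          (latticeEquiv a b c d hdet p) +
        (Complex.exp (-(Real.pi * Complex.I * s)) - Complex.exp (Real.pi * Complex.I * s)) *
          partialTerm (sector c d (-R₁) (-R₂)) z s (dilate f (-(α * b))) (dilate fs (-(β * c)))
            (-R₁) (-R₂) (-(latticeEquiv a b c d hdet p)) := by
  classical
  set τ : ℂ := (c : ℂ) * z + d with hτ
  have hτ0 : τ ≠ 0 := fun h => by simp [h] at hr
  set P := latticeEquiv a b c d hdet p with hP
  have hP1 : P.1 = a * p.1 + c * p.2 := rfl
  have hP2 : P.2 = b * p.1 + d * p.2 := rfl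
  set w := latticePoint z R₁ R₂ P with hw
  have hlat : latticePoint V r₁ r₂ p = w / τ := by
    rw [eq_div_iff hτ0, hw, latticePoint, latticePoint, hV, hP1, hP2, hR₁, hR₂]
    push_cast
    field_simp
    rw [hτ]
    ring
  have hneg : latticePoint z (-R₁) (-R₂) (-P) = -w := latticePoint_neg z R₁ R₂ P
  have hcf : f (-α * p.2) = f (α * b * P.1) := by
    refine periodic_eq_of_dvd hf (ha.mul_left (-α * P.2) |>.trans (dvd_of_eq ?_))
    rw [hP1, hP2]
    linear_combination (-α * p.2) * hdet
  have hcfs : fs (-β * p.1) = fs (β * c * P.2) := by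
    refine periodic_eq_of_dvd hfs (hd.mul_left (-β * P.1) |>.trans (dvd_of_eq ?_))
    rw [hP1, hP2]
    linear_combination (-β * p.1) * hdet
  by_cases hw0 : w = 0
  · have hnot : -P ∉ sector c d (-R₁) (-R₂) := fun h => by
      have := (isUpper_latticePoint_iff hz (-R₁) (-R₂) (-P)).2 h.1
      rw [hneg, hw0, neg_zero] at this
      exact this.ne_zero rfl
    rw [eisensteinTerm_of_eq_zero hVi _ _ _ (by rw [hlat, hw0, zero_div]),
      eisensteinTerm_of_eq_zero hz _ _ _ hw0, partialTerm_of_notMem hnot]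
    ring
  · rw [eisensteinTerm_of_ne_zero hVi _ _ _ (by rw [hlat]; exact div_ne_zero hw0 hτ0),
      eisensteinTerm_of_ne_zero hz _ _ _ hw0, hlat, ← hw]
    simp only [dilate]
    rw [hcf, hcfs]
    rcases isUpper_or_neg hw0 with hup | hup
    · have hnot : -P ∉ sector c d (-R₁) (-R₂) := fun h => by
        have := (isUpper_latticePoint_iff hz (-R₁) (-R₂) (-P)).2 h.1
        rw [hneg] at this
        exact hup.not_neg this
      rw [partialTerm_of_notMem hnot, hup.lowerPow_eq, ← lowerPow_div_of_upper hup hi s]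
      ring
    · have h1 := lowerPow_div_of_upper_neg hup hi hr s
      have h2 := hup.lowerPow_neg s
      rw [neg_neg] at h1 h2
      have hmem := mem_sector_iff hz c d (r₁ := -R₁) (r₂ := -R₂) (p := -P) (by rw [hneg]; exact hup)
      rw [hneg] at hmem
      rw [h2]
      by_cases hs : -P ∈ sector c d (-R₁) (-R₂)
      · rw [if_pos (hmem.1 hs)] at h1
        rw [partialTerm_of_mem hs, hneg]
        simp only [dilate, Prod.fst_neg, Prod.snd_neg, neg_mul_neg]
        linear_combination (fs (β * c * P.2) * f (α * b * P.1)) * h1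
      · rw [if_neg (mt hmem.2 hs)] at h1
        rw [partialTerm_of_notMem hs]
        linear_combination (fs (β * c * P.2) * f (α * b * P.1)) * h1

end Transformation

/-! ### The sum over a cone -/

/-- The pairs with `x = m + r₁ > 0` and `y = n + r₂ > x d / c`. -/
def cone (c d : ℤ) (r₁ r₂ : ℝ) : Set (ℤ × ℤ) :=
  {p | 0 < (p.1 : ℝ) + r₁ ∧ ((p.1 : ℝ) + r₁) * d < ((p.2 : ℝ) + r₂) * c}

lemma sector_eq {c d : ℤ} (hc : 0 < c) (r₁ r₂ : ℝ) :
    sector c d r₁ r₂ = cone c d r₁ r₂ ∪ positiveRay r₁ r₂ := by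
  have hc' : (0 : ℝ) < c := by exact_mod_cast hc
  ext p
  constructor
  · rintro ⟨h1 | h1, h2⟩
    · exact Or.inl ⟨h1, h2⟩
    · exact Or.inr h1
  · rintro (h | h)
    · exact ⟨Or.inl h.1, h.2⟩
    · refine ⟨Or.inr h, ?_⟩
      rw [h.1, zero_mul]
      exact mul_pos h.2 hc'

/-- The parametrization of the cone `m - R₁ > 0`, `n - R₂ > (m - R₁) d / c`. For given
`i = (j, μ, v)` the pairs have fixed residues modulo `c k` and `k`, and `p` runs through `ℕ × ℕ`. The
summand `d (μ + k p₁)` follows the slope of the boundary, so that `n` ranges over the integers above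
`⌊R₂ + d (j - {R₁}) / c⌋ + d (μ + k p₁)`. -/
noncomputable def conePoint (k : ℕ) (c d : ℤ) (R₁ R₂ : ℝ) (i : ℤ × ℕ × ℕ) (p : ℕ × ℕ) : ℤ × ℤ :=
  (⌊R₁⌋ + i.1 + c * (i.2.1 + k * p.1),
    ⌊R₂ + (d : ℝ) * ((i.1 : ℝ) - Int.fract R₁) / c⌋ - i.2.2 + k * (p.2 + 1) +
      d * (i.2.1 + k * p.1))

lemma conePoint_injective {k : ℕ} {c d : ℤ} (R₁ R₂ : ℝ) {i i' : ℤ × ℕ × ℕ}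
    (hi : i ∈ Finset.Icc 1 c ×ˢ (Finset.range k ×ˢ Finset.range k))
    (hi' : i' ∈ Finset.Icc 1 c ×ˢ (Finset.range k ×ˢ Finset.range k)) {p p' : ℕ × ℕ}
    (h : conePoint k c d R₁ R₂ i p = conePoint k c d R₁ R₂ i' p') : i = i' ∧ p = p' := by
  obtain ⟨j, μ, v⟩ := i
  obtain ⟨j', μ', v'⟩ := i'
  obtain ⟨t, q⟩ := p
  obtain ⟨t', q'⟩ := p'
  simp only [Finset.mem_product, Finset.mem_Icc, Finset.mem_range] at hi hi'
  obtain ⟨h1, h2⟩ := Prod.ext_iff.1 h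
  simp only [conePoint] at h1 h2
  obtain ⟨hj, hw⟩ := int_residue_unique (c := c) (i := j - 1) (i' := j' - 1) (by omega) (by omega)
    (by omega) (by omega) (q := μ + k * t) (q' := μ' + k * t') (by linarith)
  have hj : j = j' := by omega
  subst hj
  obtain ⟨hμ, ht⟩ := residue_unique hi.2.1 hi'.2.1 hw
  rw [hw] at h2
  obtain ⟨hv, hq⟩ := int_residue_unique (c := k) (i := k - 1 - v) (i' := k - 1 - v') (by omega)
    (by omega) (by omega) (by omega) (q := q) (q' := q') (by linarith)
  refine ⟨?_, ?_⟩
  · simp only [Prod.mk.injEq, true_and]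
    omega
  · simp only [Prod.mk.injEq]
    omega

lemma exists_conePoint {k : ℕ} (hk : 0 < k) {c d : ℤ} (hc : 0 < c) {R₁ R₂ : ℝ} {p : ℤ × ℤ}
    (hp : p ∈ cone c d (-R₁) (-R₂)) :
    ∃ i ∈ Finset.Icc 1 c ×ˢ (Finset.range k ×ˢ Finset.range k), ∃ a,
      conePoint k c d R₁ R₂ i a = p := by
  have hc' : (0 : ℝ) < c := by exact_mod_cast hc
  have hk' : (0 : ℤ) < k := by exact_mod_cast hk
  obtain ⟨m, n⟩ := p
  obtain ⟨h1, h2⟩ := hp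
  simp only at h1 h2
  have hm : ⌊R₁⌋ < m := Int.floor_lt.2 (by linarith)
  set i := (m - ⌊R₁⌋ - 1) % c with hi
  set w := (m - ⌊R₁⌋ - 1) / c with hw
  have hi0 : 0 ≤ i := Int.emod_nonneg _ hc.ne'
  have hic : i < c := Int.emod_lt_of_pos _ hc
  have hiw : i + c * w = m - ⌊R₁⌋ - 1 := Int.emod_add_mul_ediv _ c
  have hw0 : 0 ≤ w := Int.ediv_nonneg (by omega) hc.le
  obtain ⟨μ, hμ, t, ht⟩ := residue_exists hk w
  have ht0 : 0 ≤ t := by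
    by_contra! hneg
    have : (k : ℤ) * t ≤ k * (-1) := mul_le_mul_of_nonneg_left (by omega) hk'.le
    omega
  set θ : ℝ := R₂ + (d : ℝ) * (((i + 1 : ℤ) : ℝ) - Int.fract R₁) / c with hθ
  have hn : ⌊θ⌋ < n - d * w := by
    rw [Int.floor_lt, hθ]
    have h3 : (m : ℝ) = ⌊R₁⌋ + (i + 1 : ℤ) + c * w := by
      have : m = ⌊R₁⌋ + (i + 1) + c * w := by linarith
      exact_mod_cast this
    have h4 : R₁ = ⌊R₁⌋ + Int.fract R₁ := (Int.floor_add_fract R₁).symm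
    have h5 : (m : ℝ) + -R₁ = ((i + 1 : ℤ) : ℝ) - Int.fract R₁ + c * w := by linarith
    rw [h5] at h2
    push_cast at h2 ⊢
    rw [← lt_sub_iff_add_lt', div_lt_iff₀ hc']
    linarith
  set r := (n - d * w - ⌊θ⌋ - 1) % k with hr
  set q := (n - d * w - ⌊θ⌋ - 1) / k with hq
  have hr0 : 0 ≤ r := Int.emod_nonneg _ hk'.ne'
  have hrk : r < k := Int.emod_lt_of_pos _ hk'
  have hrq : r + k * q = n - d * w - ⌊θ⌋ - 1 := Int.emod_add_mul_ediv _ _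
  have hq0 : 0 ≤ q := Int.ediv_nonneg (by omega) hk'.le
  have hv : (((k - 1 - r).toNat : ℕ) : ℤ) = k - 1 - r := Int.toNat_of_nonneg (by omega)
  lift t to ℕ using ht0
  clear_value q
  lift q to ℕ using hq0
  refine ⟨(i + 1, μ, (k - 1 - r).toNat), ?_, (t, q), ?_⟩
  · simp only [Finset.mem_product, Finset.mem_Icc, Finset.mem_range]
    refine ⟨⟨by omega, by omega⟩, hμ, ?_⟩
    omega
  · simp only [conePoint]
    rw [ht, hv, ← hθ]
    ext
    · simp only; linarith
    · simp only; linarith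

/-- The coordinates `x = m - R₁` and `y = n - R₂` on a residue class of the cone. -/
lemma conePoint_coordinates {k : ℕ} (hk : 0 < k) {c : ℤ} (hc : 0 < c) (d : ℤ) (R₁ R₂ : ℝ)
    (j : ℤ) (μ v : ℕ) (p : ℕ × ℕ) :
    ((conePoint k c d R₁ R₂ (j, μ, v) p).1 : ℝ) + -R₁ =
      c * (k * (((c : ℝ) * μ + j - Int.fract R₁) / (c * k) + p.1)) ∧
    ((conePoint k c d R₁ R₂ (j, μ, v) p).2 : ℝ) + -R₂ =
      d * (k * (((c : ℝ) * μ + j - Int.fract R₁) / (c * k) + p.1)) +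
      k * (p.2 + 1 - ((v : ℝ) + Int.fract (((d : ℝ) * j + rho R₁ R₂ c d) / c)) / k) := by
  have hcr : (c : ℝ) ≠ 0 := by exact_mod_cast hc.ne'
  have hkr : (k : ℝ) ≠ 0 := by exact_mod_cast hk.ne'
  set θ : ℝ := R₂ + (d : ℝ) * ((j : ℝ) - Int.fract R₁) / c with hθ
  have hfr : Int.fract (((d : ℝ) * j + rho R₁ R₂ c d) / c) = θ - ⌊θ⌋ := by
    have h1 : ((d : ℝ) * j + rho R₁ R₂ c d) / c = θ - ⌊R₂⌋ := by
      rw [rho, hθ, ← Int.self_sub_floor R₂]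
      field_simp
      ring
    rw [h1, Int.fract_sub_intCast, Int.self_sub_floor]
  constructor
  · simp only [conePoint]
    rw [← Int.self_sub_floor R₁]
    field_simp
    push_cast
    ring
  · have h2 : R₂ = θ - (d : ℝ) * ((j : ℝ) - Int.fract R₁) / c := by rw [hθ]; ring
    rw [hfr]
    simp only [conePoint]
    rw [← hθ, h2]
    field_simp
    push_cast
    ring

/-- The sum over a cone as a combination of Mellin transforms of the loop kernels. -/
theorem hasSum_cone {k : ℕ} (hk : 0 < k) {A B : ℤ → ℂ}
    (hA : Function.Periodic A (k : ℤ)) (hB : Function.Periodic B (k : ℤ)) {c d : ℤ} (hc : 0 < c)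
    (hd : (k : ℤ) ∣ d) {z : ℂ} (hr : 0 < ((c : ℂ) * z + d).re) (R₁ R₂ : ℝ) {s : ℂ}
    (hs : 2 < s.re) :
    HasSum (partialTerm (cone c d (-R₁) (-R₂)) z s A B (-R₁) (-R₂))
      (∑ j ∈ Finset.Icc 1 c, ∑ μ ∈ Finset.range k, ∑ v ∈ Finset.range k,
        A (μ * c + j + ⌊R₁⌋) * B (⌊R₂ + (d : ℝ) * ((j : ℝ) - Int.fract R₁) / c⌋ - v) *
        ((Complex.Gamma s)⁻¹ * -∫ x : ℝ in Set.Ioi 0, (x : ℂ) ^ (s - 1) *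
          loopKernel k ((c : ℂ) * z + d) (((c : ℝ) * μ + j - Int.fract R₁) / (c * k))
            (((v : ℝ) + Int.fract (((d : ℝ) * j + rho R₁ R₂ c d) / c)) / k) x)) := by
  have hcr : (0 : ℝ) < c := by exact_mod_cast hc
  have hkr : (0 : ℝ) < k := by exact_mod_cast hk
  have hΓ : Complex.Gamma s ≠ 0 := Complex.Gamma_ne_zero_of_re_pos (by linarith)
  have hprod : ∀ g : ℤ → ℕ → ℕ → ℂ, ∑ j ∈ Finset.Icc 1 c, ∑ μ ∈ Finset.range k,
      ∑ v ∈ Finset.range k, g j μ v =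
      ∑ i ∈ Finset.Icc 1 c ×ˢ (Finset.range k ×ˢ Finset.range k), g i.1 i.2.1 i.2.2 := fun g => by
    rw [Finset.sum_product]
    refine Finset.sum_congr rfl fun j _ => ?_
    rw [Finset.sum_product]
  rw [hprod]
  refine hasSum_of_finset_partition _ (conePoint k c d R₁ R₂) _ ?_ ?_ ?_
  · exact fun i hi i' hi' p p' h => conePoint_injective R₁ R₂ hi hi' h
  · intro p hp
    refine exists_conePoint hk hc ?_
    by_contra h
    exact hp (partialTerm_of_notMem h _ _ _ _ _ _)
  · rintro ⟨j, μ, v⟩ hi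
    simp only [Finset.mem_product, Finset.mem_Icc, Finset.mem_range] at hi
    set x₀ : ℝ := ((c : ℝ) * μ + j - Int.fract R₁) / (c * k) with hx₀
    set y₀ : ℝ := ((v : ℝ) + Int.fract (((d : ℝ) * j + rho R₁ R₂ c d) / c)) / k with hy₀
    have hj : (1 : ℝ) ≤ j := by exact_mod_cast hi.1.1
    have hx₀pos : 0 < x₀ := by
      have := Int.fract_lt_one R₁
      have h1 : (0 : ℝ) ≤ c * μ := by positivity
      refine div_pos (by linarith) (by positivity)
    have hy₀lt : y₀ < 1 := by
      have := Int.fract_lt_one (((d : ℝ) * j + rho R₁ R₂ c d) / c)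
      have h1 : (v : ℝ) + 1 ≤ k := by exact_mod_cast hi.2.2
      rw [hy₀, div_lt_one hkr]
      linarith
    have h := (hasSum_quadrant hk hr hx₀pos hy₀lt hs).mul_left
      (A (μ * c + j + ⌊R₁⌋) * B (⌊R₂ + (d : ℝ) * ((j : ℝ) - Int.fract R₁) / c⌋ - v) *
        (Complex.Gamma s)⁻¹)
    simp only
    rw [← mul_assoc (A _ * B _)]
    refine h.congr_fun fun p => ?_
    obtain ⟨hx, hy⟩ := conePoint_coordinates hk hc d R₁ R₂ j μ v p
    rw [← hx₀] at hx
    rw [← hx₀, ← hy₀] at hy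
    have hlat : latticePoint z (-R₁) (-R₂) (conePoint k c d R₁ R₂ (j, μ, v) p) =
        ((c : ℂ) * z + d) * (k * (x₀ + p.1)) + k * (p.2 + 1 - y₀) := by
      have hx' := congrArg (fun y : ℝ => (y : ℂ)) hx
      have hy' := congrArg (fun y : ℝ => (y : ℂ)) hy
      push_cast at hx' hy'
      rw [latticePoint]
      push_cast
      linear_combination z * hx' + hy'
    have hmem : conePoint k c d R₁ R₂ (j, μ, v) p ∈ cone c d (-R₁) (-R₂) := by
      have h1 : 0 < k * ((p.2 : ℝ) + 1 - y₀) := by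
        have := p.2.cast_nonneg (α := ℝ)
        exact mul_pos hkr (by linarith)
      refine ⟨?_, ?_⟩
      · rw [hx]; positivity
      · rw [hx, hy]
        have := mul_pos h1 hcr
        linarith
    have hA' : A (conePoint k c d R₁ R₂ (j, μ, v) p).1 = A (μ * c + j + ⌊R₁⌋) :=
      periodic_eq_of_dvd hA ⟨c * p.1, by simp only [conePoint]; ring⟩
    have hB' : B (conePoint k c d R₁ R₂ (j, μ, v) p).2 =
        B (⌊R₂ + (d : ℝ) * ((j : ℝ) - Int.fract R₁) / c⌋ - v) := by
      obtain ⟨d', hd'⟩ := hd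
      refine periodic_eq_of_dvd hB ⟨p.2 + 1 + d' * (μ + k * p.1), ?_⟩
      simp only [conePoint]
      linear_combination (μ + k * p.1 : ℤ) * hd'
    rw [partialTerm_of_mem hmem, hA', hB', hlat]
    field_simp

/-! ### The transformation formula -/

lemma loopIntegrand_eq (k : ℕ) (z s : ℂ) (c d : ℤ) (R₁ R₂ : ℝ) (j : ℤ) (μ v : ℕ) :
    loopIntegrand k z s c d R₁ R₂ j μ v = fun u => loopPow u (s - 1) *
      loopKernel k ((c : ℂ) * z + d) (((c : ℝ) * μ + j - Int.fract R₁) / (c * k))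
        (((v : ℝ) + Int.fract (((d : ℝ) * j + rho R₁ R₂ c d) / c)) / k) u := by
  funext u
  rw [loopIntegrand, loopKernel, mul_assoc]

lemma isLoopKernel_of_admissible {k : ℕ} (hk : 0 < k) {c d : ℤ} (hc : 0 < c) {z : ℂ}
    (hr : 0 < ((c : ℂ) * z + d).re) {δ ε : ℝ} (hadm : IsAdmissibleLoop k c d z δ ε) (R₁ R₂ : ℝ)
    {j : ℤ} (hj : 1 ≤ j) (μ : ℕ) {v : ℕ} (hv : v < k) :
    IsLoopKernel δ ε
      (loopKernel k ((c : ℂ) * z + d) (((c : ℝ) * μ + j - Int.fract R₁) / (c * k))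
        (((v : ℝ) + Int.fract (((d : ℝ) * j + rho R₁ R₂ c d) / c)) / k)) := by
  have hcr : (0 : ℝ) < c := by exact_mod_cast hc
  have hkr : (0 : ℝ) < k := by exact_mod_cast hk
  refine isLoopKernel_loopKernel hk hr ?_ ?_ fun u hu => hadm.2.2 u hu.1 hu.2
  · have := Int.fract_lt_one R₁
    have h1 : (0 : ℝ) ≤ c * μ := by positivity
    have h2 : (1 : ℝ) ≤ j := by exact_mod_cast hj
    exact div_nonneg (by linarith) (by positivity)
  · have := Int.fract_lt_one (((d : ℝ) * j + rho R₁ R₂ c d) / c)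
    have h1 : (v : ℝ) + 1 ≤ k := by exact_mod_cast hv
    rw [div_lt_one hkr]
    linarith

/-- The finite sum of loop integrals in the transformation formula. -/
noncomputable def loopSum (δ ε : ℝ) (k : ℕ) (A B : ℤ → ℂ) (z s : ℂ) (c d : ℤ) (R₁ R₂ : ℝ) : ℂ :=
  ∑ j ∈ Finset.Icc 1 c, ∑ μ ∈ Finset.range k, ∑ v ∈ Finset.range k,
    A (μ * c + j + ⌊R₁⌋) * B (⌊R₂ + (d : ℝ) * ((j : ℝ) - Int.fract R₁) / c⌋ - v) *
      loopI δ ε k z s c d R₁ R₂ j μ v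

lemma differentiable_loopSum {k : ℕ} (hk : 0 < k) (A B : ℤ → ℂ) {c d : ℤ} (hc : 0 < c) {z : ℂ}
    (hr : 0 < ((c : ℂ) * z + d).re) {δ ε : ℝ} (hadm : IsAdmissibleLoop k c d z δ ε) (R₁ R₂ : ℝ) :
    Differentiable ℂ (fun s => loopSum δ ε k A B z s c d R₁ R₂) := by
  unfold loopSum
  refine Differentiable.fun_sum fun j hj => Differentiable.fun_sum fun μ _ =>
    Differentiable.fun_sum fun v hv => Differentiable.const_mul ?_ _
  simp only [loopI, loopIntegrand_eq]
  exact (isLoopKernel_of_admissible hk hc hr hadm R₁ R₂ (Finset.mem_Icc.1 hj).1 μ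
    (Finset.mem_range.1 hv)).differentiable_loopIntegral hadm.1 hadm.2.1

/-- The factor `e (-s / 2)` makes the monodromy factor of the loop antisymmetric. -/
lemma e_neg_half_mul (s : ℂ) :
    e (-s / 2) * (Complex.exp (2 * Real.pi * Complex.I * s) - 1) =
      Complex.exp (Real.pi * Complex.I * s) - Complex.exp (-(Real.pi * Complex.I * s)) := by
  rw [e, mul_sub, mul_one, ← Complex.exp_add]
  congr 2 <;> ring

lemma exp_sub_exp_eq_sin (s : ℂ) :
    Complex.exp (-(Real.pi * Complex.I * s)) - Complex.exp (Real.pi * Complex.I * s) =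
      -(2 * Complex.I * Complex.sin (Real.pi * s)) := by
  rw [Complex.sin, show -((Real.pi : ℂ) * s) * Complex.I = -(Real.pi * Complex.I * s) by ring,
    show ((Real.pi : ℂ) * s) * Complex.I = Real.pi * Complex.I * s by ring]
  linear_combination (Complex.exp (-(Real.pi * Complex.I * s)) -
    Complex.exp (Real.pi * Complex.I * s)) * Complex.I_mul_I

section Transformation

variable {k : ℕ} {f fs : ℤ → ℂ} (α β : ℤ) {r₁ r₂ R₁ R₂ : ℝ} {a b c d : ℤ} {z V : ℂ} {δ ε : ℝ}

/-- The transformation formula, divided by `Γ(s)`, in the domain of convergence. -/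
lemma transformation_of_three_lt_re (hk : 0 < k) (hf : Function.Periodic f (k : ℤ))
    (hfs : Function.Periodic fs (k : ℤ)) (hdet : a * d - b * c = 1) (hc : 0 < c)
    (ha : (k : ℤ) ∣ a) (hd : (k : ℤ) ∣ d) (hR₁ : R₁ = a * r₁ + c * r₂)
    (hR₂ : R₂ = b * r₁ + d * r₂) (hz : 0 < z.im) (hi : 0 < ((c : ℂ) * z + d).im)
    (hr : 0 < ((c : ℂ) * z + d).re) (hV : V = ((a : ℂ) * z + b) / ((c : ℂ) * z + d))
    (hVi : 0 < V.im) (hadm : IsAdmissibleLoop k c d z δ ε) {s : ℂ} (hs : 3 < s.re) :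
    lowerPow ((c : ℂ) * z + d) (-s) * G V s (dilate fs (-β)) (dilate f (-α)) r₁ r₂ =
      G z s (dilate f (α * b)) (dilate fs (β * c)) R₁ R₂ -
        2 * Complex.I * Complex.sin (Real.pi * s) *
          (dilate f (-(α * b)) ⌊R₁⌋ * intChar R₁) * L s (dilate fs (-(β * c))) (-R₂) +
        (Complex.Gamma s)⁻¹ * (e (-s / 2) *
          loopSum δ ε k (dilate f (-(α * b))) (dilate fs (-(β * c))) z s c d R₁ R₂) := by
  have hpV := (isEisensteinContinuation_G hk (periodic_dilate hfs (-β)) (periodic_dilate hf (-α))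
    hVi r₁ r₂).2 s (by linarith)
  have hpz := (isEisensteinContinuation_G hk (periodic_dilate hf (α * b))
    (periodic_dilate hfs (β * c)) hz R₁ R₂).2 s (by linarith)
  have hcone := hasSum_cone hk (periodic_dilate hf (-(α * b))) (periodic_dilate hfs (-(β * c)))
    hc hd hr R₁ R₂ (s := s) (by linarith)
  have hray := hasSum_positiveRay hk (A := dilate f (-(α * b))) (periodic_dilate hfs (-(β * c)))
    z R₁ (-R₂) (s := s) (by linarith)
  have hdisj : Disjoint (cone c d (-R₁) (-R₂)) (positiveRay (-R₁) (-R₂)) :=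
    Set.disjoint_left.2 fun p h1 h2 => (ne_of_gt h1.1) h2.1
  have hunion : partialTerm (sector c d (-R₁) (-R₂)) z s (dilate f (-(α * b)))
      (dilate fs (-(β * c))) (-R₁) (-R₂) = fun p =>
      partialTerm (cone c d (-R₁) (-R₂)) z s (dilate f (-(α * b))) (dilate fs (-(β * c)))
        (-R₁) (-R₂) p +
      partialTerm (positiveRay (-R₁) (-R₂)) z s (dilate f (-(α * b))) (dilate fs (-(β * c)))
        (-R₁) (-R₂) p := by
    rw [sector_eq hc]
    exact funext (partialTerm_union hdisj z s _ _ _ _)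
  have hsec := hcone.add hray
  rw [← hunion] at hsec
  have h1 := (latticeEquiv a b c d hdet).hasSum_iff.2 (hpz.add
    (((Equiv.neg (ℤ × ℤ)).hasSum_iff.2 hsec).mul_left
      (Complex.exp (-(Real.pi * Complex.I * s)) - Complex.exp (Real.pi * Complex.I * s))))
  have h2 := h1.congr_fun fun p => lowerPow_mul_eisensteinTerm α β hf hfs hdet ha hd hR₁ hR₂ hz hi
    hr hV hVi s p
  have h3 := (hpV.mul_left (lowerPow ((c : ℂ) * z + d) (-s))).unique h2
  have hloop : loopSum δ ε k (dilate f (-(α * b))) (dilate fs (-(β * c))) z s c d R₁ R₂ =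
      (Complex.exp (2 * Real.pi * Complex.I * s) - 1) *
        ∑ j ∈ Finset.Icc 1 c, ∑ μ ∈ Finset.range k, ∑ v ∈ Finset.range k,
          dilate f (-(α * b)) (μ * c + j + ⌊R₁⌋) *
          dilate fs (-(β * c)) (⌊R₂ + (d : ℝ) * ((j : ℝ) - Int.fract R₁) / c⌋ - v) *
          ∫ x : ℝ in Set.Ioi 0, (x : ℂ) ^ (s - 1) *
            loopKernel k ((c : ℂ) * z + d) (((c : ℝ) * μ + j - Int.fract R₁) / (c * k))
              (((v : ℝ) + Int.fract (((d : ℝ) * j + rho R₁ R₂ c d) / c)) / k) x := by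
    simp only [loopSum, Finset.mul_sum]
    refine Finset.sum_congr rfl fun j hj => Finset.sum_congr rfl fun μ _ =>
      Finset.sum_congr rfl fun v hv => ?_
    rw [loopI, loopIntegrand_eq, (isLoopKernel_of_admissible hk hc hr hadm R₁ R₂
      (Finset.mem_Icc.1 hj).1 μ (Finset.mem_range.1 hv)).loopIntegral_eq hadm.1 hadm.2.1 hs]
    ring
  rw [h3, hloop, ← mul_assoc (e (-s / 2)), e_neg_half_mul]
  have hin : ∀ g : ℤ → ℕ → ℕ → ℂ, ∀ h : ℤ → ℕ → ℕ → ℂ,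
      ∑ j ∈ Finset.Icc 1 c, ∑ μ ∈ Finset.range k, ∑ v ∈ Finset.range k,
        g j μ v * ((Complex.Gamma s)⁻¹ * -h j μ v) =
      -(Complex.Gamma s)⁻¹ * ∑ j ∈ Finset.Icc 1 c, ∑ μ ∈ Finset.range k, ∑ v ∈ Finset.range k,
        g j μ v * h j μ v := by
    intro g h
    simp only [Finset.mul_sum]
    refine Finset.sum_congr rfl fun j _ => Finset.sum_congr rfl fun μ _ =>
      Finset.sum_congr rfl fun v _ => ?_
    ring
  rw [hin]
  have hsin := exp_sub_exp_eq_sin s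
  linear_combination (dilate f (-(α * b)) ⌊R₁⌋ * intChar R₁ *
    L s (dilate fs (-(β * c))) (-R₂)) * hsin

/-- The transformation formula, divided by `Γ(s)`, by analytic continuation to `ℂ ∖ {1}`. -/
lemma transformation_div_Gamma (hk : 0 < k) (hf : Function.Periodic f (k : ℤ))
    (hfs : Function.Periodic fs (k : ℤ)) (hdet : a * d - b * c = 1) (hc : 0 < c)
    (ha : (k : ℤ) ∣ a) (hd : (k : ℤ) ∣ d) (hR₁ : R₁ = a * r₁ + c * r₂)
    (hR₂ : R₂ = b * r₁ + d * r₂) (hz : 0 < z.im) (hi : 0 < ((c : ℂ) * z + d).im)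
    (hr : 0 < ((c : ℂ) * z + d).re) (hV : V = ((a : ℂ) * z + b) / ((c : ℂ) * z + d))
    (hVi : 0 < V.im) (hadm : IsAdmissibleLoop k c d z δ ε) {s : ℂ} (hs : s ≠ 1) :
    lowerPow ((c : ℂ) * z + d) (-s) * G V s (dilate fs (-β)) (dilate f (-α)) r₁ r₂ =
      G z s (dilate f (α * b)) (dilate fs (β * c)) R₁ R₂ -
        2 * Complex.I * Complex.sin (Real.pi * s) *
          (dilate f (-(α * b)) ⌊R₁⌋ * intChar R₁) * L s (dilate fs (-(β * c))) (-R₂) +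
        (Complex.Gamma s)⁻¹ * (e (-s / 2) *
          loopSum δ ε k (dilate f (-(α * b))) (dilate fs (-(β * c))) z s c d R₁ R₂) := by
  have hopen : IsOpen ({1}ᶜ : Set ℂ) := isOpen_compl_singleton
  have hconn : IsPreconnected ({1}ᶜ : Set ℂ) :=
    (isConnected_compl_singleton_of_one_lt_rank (by simp) 1).isPreconnected
  have hdV := (isEisensteinContinuation_G hk (periodic_dilate hfs (-β)) (periodic_dilate hf (-α))
    hVi r₁ r₂).1
  have hdz := (isEisensteinContinuation_G hk (periodic_dilate hf (α * b))
    (periodic_dilate hfs (β * c)) hz R₁ R₂).1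
  have hdL := (isLContinuation_L hk (periodic_dilate hfs (-(β * c))) (-R₂)).1
  have hdS := differentiable_loopSum hk (dilate f (-(α * b))) (dilate fs (-(β * c))) hc hr hadm
    R₁ R₂
  have hleft : DifferentiableOn ℂ (fun s => lowerPow ((c : ℂ) * z + d) (-s) *
      G V s (dilate fs (-β)) (dilate f (-α)) r₁ r₂) {1}ᶜ := by
    refine DifferentiableOn.mul ?_ hdV
    simp only [lowerPow_eq_exp]
    fun_prop
  have hright : DifferentiableOn ℂ (fun s => G z s (dilate f (α * b)) (dilate fs (β * c)) R₁ R₂ -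
        2 * Complex.I * Complex.sin (Real.pi * s) *
          (dilate f (-(α * b)) ⌊R₁⌋ * intChar R₁) * L s (dilate fs (-(β * c))) (-R₂) +
        (Complex.Gamma s)⁻¹ * (e (-s / 2) *
          loopSum δ ε k (dilate f (-(α * b))) (dilate fs (-(β * c))) z s c d R₁ R₂)) {1}ᶜ := by
    refine (hdz.sub (DifferentiableOn.mul ?_ hdL)).add (Differentiable.differentiableOn
      (Complex.differentiable_one_div_Gamma.mul (Differentiable.mul ?_ hdS)))
    · refine Differentiable.differentiableOn ?_
      refine Differentiable.mul_const (Differentiable.const_mul ?_ _) _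
      exact Complex.differentiable_sin.comp (differentiable_id.const_mul _)
    · unfold e
      fun_prop
  have h4 : (4 : ℂ) ∈ ({1}ᶜ : Set ℂ) := by
    simp only [Set.mem_compl_iff, Set.mem_singleton_iff]
    norm_num
  refine (hleft.analyticOnNhd hopen).eqOn_of_preconnected_of_eventuallyEq
    (hright.analyticOnNhd hopen) hconn h4 ?_ hs
  have hev : ∀ᶠ w : ℂ in 𝓝 4, 3 < w.re :=
    (isOpen_lt continuous_const Complex.continuous_re).mem_nhds (by norm_num)
  filter_upwards [hev] with w hw
  exact transformation_of_three_lt_re α β hk hf hfs hdet hc ha hd hR₁ hR₂ hz hi hr hV hVi hadm hw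

end Transformation

/-- Near every point, all other points are regular points of `Γ` different from `1`. -/
lemma eventually_ne_one_and_Gamma_ne_zero (s₀ : ℂ) :
    ∀ᶠ s in 𝓝[≠] s₀, s ≠ 1 ∧ Complex.Gamma s ≠ 0 := by
  have hclosed : IsClosed ((fun n : ℤ => (n : ℂ)) '' {n | (n : ℂ) ≠ s₀}) :=
    Complex.isClosedEmbedding_intCast.isClosedMap _ (isClosed_discrete _)
  have hmem : s₀ ∈ ((fun n : ℤ => (n : ℂ)) '' {n | (n : ℂ) ≠ s₀})ᶜ := by
    rintro ⟨n, hn, h⟩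
    exact hn h
  filter_upwards [mem_nhdsWithin_of_mem_nhds (hclosed.isOpen_compl.mem_nhds hmem),
    self_mem_nhdsWithin] with s h1 h2
  have hint : ∀ n : ℤ, s ≠ n := by
    rintro n rfl
    exact h1 ⟨n, h2, rfl⟩
  refine ⟨by exact_mod_cast hint 1, fun h => ?_⟩
  obtain ⟨m, hm⟩ := (Complex.Gamma_eq_zero_iff s).1 h
  exact hint (-m) (by rw [hm]; push_cast; rfl)

theorem transformation {k : ℕ} (hk : 0 < k) {f fs : ℤ → ℂ} (hf : Function.Periodic f (k : ℤ))
    (hfs : Function.Periodic fs (k : ℤ)) (α β : ℤ) {r₁ r₂ R₁ R₂ : ℝ} {a b c d : ℤ} {z V : ℂ}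
    {δ ε : ℝ} (hdet : a * d - b * c = 1) (hc : 0 < c)
    (ha : (k : ℤ) ∣ a) (hd : (k : ℤ) ∣ d) (hR₁ : R₁ = a * r₁ + c * r₂)
    (hR₂ : R₂ = b * r₁ + d * r₂) (hz : 0 < z.im) (hi : 0 < ((c : ℂ) * z + d).im)
    (hr : 0 < ((c : ℂ) * z + d).re) (hV : V = ((a : ℂ) * z + b) / ((c : ℂ) * z + d))
    (hVi : 0 < V.im) (hadm : IsAdmissibleLoop k c d z δ ε) :
    (∀ s : ℂ, s ≠ 1 → (∀ n : ℕ, s ≠ -(n : ℂ)) →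
      lowerPow ((c : ℂ) * z + d) (-s) * Complex.Gamma s *
          G V s (dilate fs (-β)) (dilate f (-α)) r₁ r₂ =
        Complex.Gamma s * G z s (dilate f (α * b)) (dilate fs (β * c)) R₁ R₂ -
          2 * Complex.I * Complex.Gamma s * Complex.sin (Real.pi * s) *
            (f (-α * b * ⌊R₁⌋) * intChar R₁) * L s (dilate fs (-(β * c))) (-R₂) +
          e (-s / 2) * ∑ j ∈ Finset.Icc 1 c, ∑ μ ∈ Finset.range k, ∑ v ∈ Finset.range k,
            f (-α * b * (μ * c + j + ⌊R₁⌋)) *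
            fs (-β * c * (⌊R₂ + (d : ℝ) * ((j : ℝ) - Int.fract R₁) / c⌋ - v)) *
            loopI δ ε k z s c d R₁ R₂ j μ v) ∧
    (∀ s₀ : ℂ, Tendsto (fun s : ℂ =>
      lowerPow ((c : ℂ) * z + d) (-s) * Complex.Gamma s *
          G V s (dilate fs (-β)) (dilate f (-α)) r₁ r₂ -
        Complex.Gamma s * G z s (dilate f (α * b)) (dilate fs (β * c)) R₁ R₂ +
        2 * Complex.I * Complex.Gamma s * Complex.sin (Real.pi * s) *
          (f (-α * b * ⌊R₁⌋) * intChar R₁) * L s (dilate fs (-(β * c))) (-R₂))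
      (𝓝[≠] s₀)
      (𝓝 (e (-s₀ / 2) * ∑ j ∈ Finset.Icc 1 c, ∑ μ ∈ Finset.range k, ∑ v ∈ Finset.range k,
            f (-α * b * (μ * c + j + ⌊R₁⌋)) *
            fs (-β * c * (⌊R₂ + (d : ℝ) * ((j : ℝ) - Int.fract R₁) / c⌋ - v)) *
            loopI δ ε k z s₀ c d R₁ R₂ j μ v))) := by
  have hsum : ∀ s : ℂ, ∑ j ∈ Finset.Icc 1 c, ∑ μ ∈ Finset.range k, ∑ v ∈ Finset.range k,
      f (-α * b * (μ * c + j + ⌊R₁⌋)) *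
      fs (-β * c * (⌊R₂ + (d : ℝ) * ((j : ℝ) - Int.fract R₁) / c⌋ - v)) *
      loopI δ ε k z s c d R₁ R₂ j μ v =
      loopSum δ ε k (dilate f (-(α * b))) (dilate fs (-(β * c))) z s c d R₁ R₂ := fun s => by
    simp only [loopSum, dilate, neg_mul]
  have hcoef : f (-α * b * ⌊R₁⌋) = dilate f (-(α * b)) ⌊R₁⌋ := by
    simp only [dilate, neg_mul]
  simp only [hsum, hcoef]
  have key : ∀ s : ℂ, s ≠ 1 → Complex.Gamma s ≠ 0 →
      lowerPow ((c : ℂ) * z + d) (-s) * Complex.Gamma s *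
          G V s (dilate fs (-β)) (dilate f (-α)) r₁ r₂ =
        Complex.Gamma s * G z s (dilate f (α * b)) (dilate fs (β * c)) R₁ R₂ -
          2 * Complex.I * Complex.Gamma s * Complex.sin (Real.pi * s) *
            (dilate f (-(α * b)) ⌊R₁⌋ * intChar R₁) * L s (dilate fs (-(β * c))) (-R₂) +
          e (-s / 2) *
            loopSum δ ε k (dilate f (-(α * b))) (dilate fs (-(β * c))) z s c d R₁ R₂ := by
    intro s hs hΓ
    have h := transformation_div_Gamma α β hk hf hfs hdet hc ha hd hR₁ hR₂ hz hi hr hV hVi hadm hs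
    have hinv : Complex.Gamma s * (Complex.Gamma s)⁻¹ = 1 := mul_inv_cancel₀ hΓ
    linear_combination Complex.Gamma s * h + (e (-s / 2) *
      loopSum δ ε k (dilate f (-(α * b))) (dilate fs (-(β * c))) z s c d R₁ R₂) * hinv
  refine ⟨fun s hs hn => key s hs (Complex.Gamma_ne_zero hn), fun s₀ => ?_⟩
  have hcont : ContinuousAt (fun s => e (-s / 2) *
      loopSum δ ε k (dilate f (-(α * b))) (dilate fs (-(β * c))) z s c d R₁ R₂) s₀ := by
    refine ContinuousAt.mul ?_ (differentiable_loopSum hk _ _ hc hr hadm R₁ R₂).continuous.continuousAt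
    unfold e
    fun_prop
  refine (hcont.tendsto.mono_left nhdsWithin_le_nhds).congr' ?_
  filter_upwards [eventually_ne_one_and_Gamma_ne_zero s₀] with s hs
  rw [key s hs.1 hs.2]
  ring

lemma im_moebius_pos {a b c d : ℤ} (hdet : a * d - b * c = 1) {z : ℂ} (hz : 0 < z.im)
    (hτ : (c : ℂ) * z + d ≠ 0) : 0 < (((a : ℂ) * z + b) / ((c : ℂ) * z + d)).im := by
  have hdet' : (a : ℝ) * d - b * c = 1 := by exact_mod_cast hdet
  have hn : 0 < Complex.normSq ((c : ℂ) * z + d) := Complex.normSq_pos.2 hτ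
  rw [Complex.div_im, ← sub_div]
  refine div_pos ?_ hn
  simp only [Complex.add_im, Complex.mul_im, Complex.intCast_re, Complex.intCast_im, zero_mul,
    add_zero, Complex.add_re, Complex.mul_re, sub_zero]
  have : a * z.im * (c * z.re + d) - (a * z.re + b) * (c * z.im) = ((a : ℝ) * d - b * c) * z.im := by
    ring
  rw [this, hdet', one_mul]
  exact hz

end PeriodicEisenstein

theorem mainTheorem2 (k : ℕ) (hk : 0 < k) (f fs : ℤ → ℂ)
    (hf : Function.Periodic f (k : ℤ)) (hfs : Function.Periodic fs (k : ℤ))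
    (α β : ℤ) (r₁ r₂ : ℝ) :
    -- the transformation formula under `V z = (a z + b) / (c z + d)`
    (∀ a b c d : ℤ, a * d - b * c = 1 → 0 < c → a ≡ 0 [ZMOD k] → d ≡ 0 [ZMOD k] →
      ∀ R₁ R₂ : ℝ, R₁ = a * r₁ + c * r₂ → R₂ = b * r₁ + d * r₂ →
      ∀ z : ℂ, 0 < z.im → -(d : ℝ) / c < z.re →
      ∀ V : ℂ, V = ((a : ℂ) * z + b) / ((c : ℂ) * z + d) →
      -- the functions involved are analytic continuations of convergent series
      PeriodicEisenstein.IsEisensteinContinuation V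
        (PeriodicEisenstein.dilate fs (-β)) (PeriodicEisenstein.dilate f (-α)) r₁ r₂
        (fun s => PeriodicEisenstein.G V s
          (PeriodicEisenstein.dilate fs (-β)) (PeriodicEisenstein.dilate f (-α)) r₁ r₂) ∧
      PeriodicEisenstein.IsEisensteinContinuation z
        (PeriodicEisenstein.dilate f (α * b)) (PeriodicEisenstein.dilate fs (β * c)) R₁ R₂
        (fun s => PeriodicEisenstein.G z s
          (PeriodicEisenstein.dilate f (α * b)) (PeriodicEisenstein.dilate fs (β * c)) R₁ R₂) ∧
      PeriodicEisenstein.IsLContinuation (PeriodicEisenstein.dilate fs (-(β * c))) (-R₂)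
        (fun s => PeriodicEisenstein.L s (PeriodicEisenstein.dilate fs (-(β * c))) (-R₂)) ∧
      -- admissible loops exist, and every admissible loop may be used
      (∃ δ ε : ℝ, PeriodicEisenstein.IsAdmissibleLoop k c d z δ ε) ∧
      ∀ δ ε : ℝ, PeriodicEisenstein.IsAdmissibleLoop k c d z δ ε →
        (∀ s : ℂ, ∀ j ∈ Finset.Icc 1 c, ∀ μ ∈ Finset.range k, ∀ v ∈ Finset.range k,
          PeriodicEisenstein.LoopIntegrable δ ε
            (PeriodicEisenstein.loopIntegrand k z s c d R₁ R₂ j μ v)) ∧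
        -- the formula wherever all its terms are defined
        (∀ s : ℂ, s ≠ 1 → (∀ n : ℕ, s ≠ -(n : ℂ)) →
          PeriodicEisenstein.lowerPow ((c : ℂ) * z + d) (-s) * Complex.Gamma s *
              PeriodicEisenstein.G V s
                (PeriodicEisenstein.dilate fs (-β)) (PeriodicEisenstein.dilate f (-α)) r₁ r₂ =
            Complex.Gamma s *
              PeriodicEisenstein.G z s
                (PeriodicEisenstein.dilate f (α * b)) (PeriodicEisenstein.dilate fs (β * c)) R₁ R₂
            - 2 * Complex.I * Complex.Gamma s * Complex.sin (Real.pi * s) *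
              (f (-α * b * ⌊R₁⌋) * PeriodicEisenstein.intChar R₁) *
              PeriodicEisenstein.L s (PeriodicEisenstein.dilate fs (-(β * c))) (-R₂)
            + PeriodicEisenstein.e (-s / 2) *
              ∑ j ∈ Finset.Icc 1 c, ∑ μ ∈ Finset.range k, ∑ v ∈ Finset.range k,
                f (-α * b * (μ * c + j + ⌊R₁⌋)) *
                fs (-β * c * (⌊R₂ + (d : ℝ) * ((j : ℝ) - Int.fract R₁) / c⌋ - v)) *
                PeriodicEisenstein.loopI δ ε k z s c d R₁ R₂ j μ v) ∧
        -- the formula at every point, the poles of the individual terms included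
        (∀ s₀ : ℂ, Tendsto (fun s : ℂ =>
            PeriodicEisenstein.lowerPow ((c : ℂ) * z + d) (-s) * Complex.Gamma s *
              PeriodicEisenstein.G V s
                (PeriodicEisenstein.dilate fs (-β)) (PeriodicEisenstein.dilate f (-α)) r₁ r₂
            - Complex.Gamma s *
              PeriodicEisenstein.G z s
                (PeriodicEisenstein.dilate f (α * b)) (PeriodicEisenstein.dilate fs (β * c)) R₁ R₂
            + 2 * Complex.I * Complex.Gamma s * Complex.sin (Real.pi * s) *
              (f (-α * b * ⌊R₁⌋) * PeriodicEisenstein.intChar R₁) *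
              PeriodicEisenstein.L s (PeriodicEisenstein.dilate fs (-(β * c))) (-R₂))
          (𝓝[≠] s₀)
          (𝓝 (PeriodicEisenstein.e (-s₀ / 2) *
              ∑ j ∈ Finset.Icc 1 c, ∑ μ ∈ Finset.range k, ∑ v ∈ Finset.range k,
                f (-α * b * (μ * c + j + ⌊R₁⌋)) *
                fs (-β * c * (⌊R₂ + (d : ℝ) * ((j : ℝ) - Int.fract R₁) / c⌋ - v)) *
                PeriodicEisenstein.loopI δ ε k z s₀ c d R₁ R₂ j μ v)))) ∧
    -- the special case `V z = -1 / z`, where `R₁ = r₂` and `R₂ = -r₁`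
    (∀ z : ℂ, 0 < z.im → 0 < z.re →
      ∀ δ ε : ℝ, PeriodicEisenstein.IsAdmissibleLoop k 1 0 z δ ε →
        (∀ s : ℂ, s ≠ 1 → (∀ n : ℕ, s ≠ -(n : ℂ)) →
          PeriodicEisenstein.lowerPow z (-s) * Complex.Gamma s *
              PeriodicEisenstein.G (-1 / z) s
                (PeriodicEisenstein.dilate fs (-β)) (PeriodicEisenstein.dilate f (-α)) r₁ r₂ =
            Complex.Gamma s *
              PeriodicEisenstein.G z s
                (PeriodicEisenstein.dilate f (-α)) (PeriodicEisenstein.dilate fs β) r₂ (-r₁)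
            - 2 * Complex.I * Complex.Gamma s * Complex.sin (Real.pi * s) *
              (f (α * ⌊r₂⌋) * PeriodicEisenstein.intChar r₂) *
              PeriodicEisenstein.L s (PeriodicEisenstein.dilate fs (-β)) r₁
            + PeriodicEisenstein.e (-s / 2) *
              ∑ μ ∈ Finset.range k, ∑ v ∈ Finset.range k,
                f (α * (μ + 1 + ⌊r₂⌋)) * fs (-β * (⌊-r₁⌋ - v)) *
                PeriodicEisenstein.loopI δ ε k z s 1 0 r₂ (-r₁) 1 μ v) ∧
        (∀ s₀ : ℂ, Tendsto (fun s : ℂ =>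
            PeriodicEisenstein.lowerPow z (-s) * Complex.Gamma s *
              PeriodicEisenstein.G (-1 / z) s
                (PeriodicEisenstein.dilate fs (-β)) (PeriodicEisenstein.dilate f (-α)) r₁ r₂
            - Complex.Gamma s *
              PeriodicEisenstein.G z s
                (PeriodicEisenstein.dilate f (-α)) (PeriodicEisenstein.dilate fs β) r₂ (-r₁)
            + 2 * Complex.I * Complex.Gamma s * Complex.sin (Real.pi * s) *
              (f (α * ⌊r₂⌋) * PeriodicEisenstein.intChar r₂) *
              PeriodicEisenstein.L s (PeriodicEisenstein.dilate fs (-β)) r₁)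
          (𝓝[≠] s₀)
          (𝓝 (PeriodicEisenstein.e (-s₀ / 2) *
              ∑ μ ∈ Finset.range k, ∑ v ∈ Finset.range k,
                f (α * (μ + 1 + ⌊r₂⌋)) * fs (-β * (⌊-r₁⌋ - v)) *
                PeriodicEisenstein.loopI δ ε k z s₀ 1 0 r₂ (-r₁) 1 μ v)))) := by
  have hτ : ∀ c d : ℤ, 0 < c → ∀ z : ℂ, 0 < z.im → -(d : ℝ) / c < z.re →
      0 < ((c : ℂ) * z + d).im ∧ 0 < ((c : ℂ) * z + d).re := by
    intro c d hc z hz hre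
    have hc' : (0 : ℝ) < c := by exact_mod_cast hc
    rw [div_lt_iff₀ hc'] at hre
    constructor
    · simpa using mul_pos hc' hz
    · simp
      linarith
  refine ⟨?_, ?_⟩
  · intro a b c d hdet hc ha hd R₁ R₂ hR₁ hR₂ z hz hre V hV
    obtain ⟨hi, hr⟩ := hτ c d hc z hz hre
    have hVi : 0 < V.im := by
      rw [hV]
      exact PeriodicEisenstein.im_moebius_pos hdet hz (fun h => by simp [h] at hr)
    refine ⟨PeriodicEisenstein.isEisensteinContinuation_G hk
        (PeriodicEisenstein.periodic_dilate hfs _) (PeriodicEisenstein.periodic_dilate hf _) hVi _ _,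
      PeriodicEisenstein.isEisensteinContinuation_G hk
        (PeriodicEisenstein.periodic_dilate hf _) (PeriodicEisenstein.periodic_dilate hfs _) hz _ _,
      PeriodicEisenstein.isLContinuation_L hk (PeriodicEisenstein.periodic_dilate hfs _) _,
      PeriodicEisenstein.exists_isAdmissibleLoop hk hr, fun δ ε hadm => ⟨?_, ?_⟩⟩
    · intro s j hj μ _ v hv
      rw [PeriodicEisenstein.loopIntegrand_eq]
      exact (PeriodicEisenstein.isLoopKernel_of_admissible hk hc hr hadm R₁ R₂
        (Finset.mem_Icc.1 hj).1 μ (Finset.mem_range.1 hv)).loopIntegrable hadm.1 hadm.2.1 s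
    · exact PeriodicEisenstein.transformation hk hf hfs α β hdet hc
        (Int.modEq_zero_iff_dvd.1 ha) (Int.modEq_zero_iff_dvd.1 hd) hR₁ hR₂ hz hi hr hV hVi hadm
  · intro z hz hre δ ε hadm
    obtain ⟨hi, hr⟩ := hτ 1 0 one_pos z hz (by simpa using hre)
    have hV : -1 / z = (((0 : ℤ) : ℂ) * z + (-1 : ℤ)) / (((1 : ℤ) : ℂ) * z + (0 : ℤ)) := by simp
    have hVi : 0 < (-1 / z).im := by
      rw [hV]
      exact PeriodicEisenstein.im_moebius_pos (by norm_num) hz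
        (fun h => by rw [h] at hr; simp at hr)
    have h := PeriodicEisenstein.transformation hk hf hfs α β (r₁ := r₁) (r₂ := r₂) (R₁ := r₂)
      (R₂ := -r₁) (a := 0) (b := -1) (c := 1) (d := 0) (by norm_num) one_pos (dvd_zero _)
      (dvd_zero _) (by simp) (by simp) hz hi hr hV hVi hadm
    simpa using h
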